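/- **Conventions.** A black box field $\mathsf K$ with input length $l=l(\mathsf K)$ encrypting a finite field $F$ operates on $0$–$1$ strings of length $l$; some strings, the cryptoelements, encrypt elements of $F$ (every element has at least one encryption, possibly several), and $\pi$ denotes the map from cryptoelements to encrypted elements. The box (i) returns independent random cryptoelements whose images under $\pi$ are almost uniform in $F$ (at statistical distance at most $1/4$ from uniform); (ii) given encryptions of $a$ and $b$, returns encryptions of $a+b$, $ab$ and, if $a\neq 0$, $a^{-1}$ (possibly randomized); (iii) decides whether two cryptoelements encrypt the same element. The characteristic $p$ is known, i.e. part of the input. The field $\mathbb F_{p^n}$ is explicitly given as $\mathbb F_p[X]/(f)$ with $f$ a monic irreducible polynomial of degree $n$ over $\mathbb F_p=\mathbb Z/p\mathbb Z$, its elements being written as vectors of $n$ integers in $\{0,\dots,p-1\}$, the coordinates in the basis $1,X,\dots,X^{n-1}$. Running times are bit complexities (logarithmic-cost random access machine with oracles, one oracle call costing the length of the query and of the answer). The prime subfield of $\mathsf K$ is $\mathsf K_0=\{x:\pi(x)\in F_0\}$, where $F_0$ is the prime subfield of $F$. An isomorphism $\mathsf K_0\to\mathbb F_p$ is a map $\delta$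 on strings with $\delta(x)=\psi(\pi(x))$ for $x\in\mathsf K_0$, where $\psi:F_0\to\mathbb F_p$ is a field isomorphism. **Theorem.** There are a polynomial $P$ and three fixed oracle programs $\mathtt{find}$, $\mathtt{enc}$, $\mathtt{dec}$ such that the following holds for all primes $p$, all monic irreducible $f\in\mathbb F_p[X]$ of degree $n$, every finite field $F$ of order $p^n$, every $l$, every black box field $\mathsf K$ of input length $l$ encrypting $F$, and every $k\ge 0$. The randomized program $\mathtt{find}$, which uses $\mathsf K$ and coin tosses, on input $(p,l,k,f)$ always halts within time $P(l+k)$, and with probability at least $1-2^{-k}$ its output $A$ is such that for some field isomorphism $\varphi:\mathbb F_{p^n}\to F$: 1. (isomorphism $\mathbb F_{p^n}\to\mathsf K$) the program $\mathtt{enc}$, which is deterministic apart from any randomness in the answers of $\mathsf K$ and uses only the field operations and the equality test of $\mathsf K$, on input $(p,l,f,A,a)$ with $a\in\mathbb F_{p^n}$ always returns within time $P(l)$ a cryptoelement encrypting $\varphi(a)$; 2. (isomorphism $\mathsf K\to\mathbb F_{p^n}$, extending a given $\mathsf K_0\to\mathbb F_p$) for every isomorphism $\delta:\mathsf K_0\to\mathbb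 F_p$, the program $\mathtt{dec}$, using the field operations and the equality test of $\mathsf K$ and an oracle for $\delta$, on input $(p,l,x,f,A)$ with $x\in\mathsf K$ always returns within time $P(l)$ the element $\varphi^{-1}(\pi(x))$ of $\mathbb F_{p^n}$; and this isomorphism extends $\delta$: $\varphi^{-1}(u)=\psi(u)\in\mathbb F_p\subseteq\mathbb F_{p^n}$ for $u\in F_0$. In particular the two isomorphisms are mutually inverse (up to equality in $\mathsf K$), so the problem of finding efficient two-way isomorphisms $\mathsf K\leftrightarrow\mathbb F_{p^n}$ reduces in probabilistic polynomial time to the same problem for $\mathsf K_0$ and $\mathbb F_p$. -/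

import Mathlib

open Polynomial
open scoped ENNReal

namespace BBField

/-! ## Algorithms

A random access machine with logarithmic cost and oracles, programmed in a structured way.
A memory holds scalar variables (natural numbers) and array variables (finite lists of natural
numbers).  Every operation is charged the bit length of the data it reads, so that the running
time is polynomially related to that of an oracle Turing machine.  Algorithms are finite
programs; the only source of randomness are the oracles. -/

/-- Memory: scalar variables and array variables. -/
structure Store where
  num : ℕ → ℕ
  arr : ℕ → List ℕ

/-- Bit length of an array. -/
def arraySize (w : List ℕ) : ℕ := (w.map fun k => Nat.size k + 1).sum

/-- Arithmetic expressions; `sub` is truncated subtraction, `div`, `mod` are integer division. -/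
inductive Expr : Type
  | lit (k : ℕ)
  | var (x : ℕ)
  | len (a : ℕ)
  | get (a : ℕ) (i : Expr)
  | add (e₁ e₂ : Expr)
  | sub (e₁ e₂ : Expr)
  | mul (e₁ e₂ : Expr)
  | div (e₁ e₂ : Expr)
  | mod (e₁ e₂ : Expr)

/-- Value of an expression (an array read out of range gives `0`). -/
def Expr.eval (s : Store) : Expr → ℕ
  | .lit k => k
  | .var x => s.num x
  | .len a => (s.arr a).length
  | .get a i => (s.arr a).getD (i.eval s) 0
  | .add e₁ e₂ => e₁.eval s + e₂.eval s
  | .sub e₁ e₂ => e₁.eval s - e₂.eval s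
  | .mul e₁ e₂ => e₁.eval s * e₂.eval s
  | .div e₁ e₂ => e₁.eval s / e₂.eval s
  | .mod e₁ e₂ => e₁.eval s % e₂.eval s

/-- Time to evaluate an expression: the number of operations plus the total bit length of the
constants, scalars and arrays that are read. -/
def Expr.cost (s : Store) : Expr → ℕ
  | .lit k => 1 + Nat.size k
  | .var x => 1 + Nat.size (s.num x)
  | .len a => 1 + arraySize (s.arr a)
  | .get a i => 1 + arraySize (s.arr a) + i.cost s
  | .add e₁ e₂ => 1 + e₁.cost s + e₂.cost s
  | .sub e₁ e₂ => 1 + e₁.cost s + e₂.cost s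
  | .mul e₁ e₂ => 1 + e₁.cost s + e₂.cost s
  | .div e₁ e₂ => 1 + e₁.cost s + e₂.cost s
  | .mod e₁ e₂ => 1 + e₁.cost s + e₂.cost s

/-- Programs with access to the oracles listed by `ι`. -/
inductive Program (ι : Type) : Type
  /-- do nothing -/
  | skip
  /-- `x := e` -/
  | assign (x : ℕ) (e : Expr)
  /-- make the array `a` empty -/
  | clear (a : ℕ)
  /-- append `e` at the end of the array `a` -/
  | push (a : ℕ) (e : Expr)
  /-- `a[i] := e`, without effect if `i` is out of range -/
  | put (a : ℕ) (i e : Expr)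
  /-- `x :=` the answer of oracle `q` to the query `(e₁, e₂)` -/
  | query (q : ι) (x : ℕ) (e₁ e₂ : Expr)
  | seq (c₁ c₂ : Program ι)
  /-- run `c₁` if `e` is nonzero, otherwise `c₂` -/
  | ite (e : Expr) (c₁ c₂ : Program ι)
  /-- repeat `c` as long as `e` is nonzero -/
  | whileDo (e : Expr) (c : Program ι)

/-- An oracle system: a query is answered by a random number, drawn afresh at each call. -/
abbrev Oracles (ι : Type) := ι → ℕ → ℕ → PMF ℕ

/-- Result of a run with a time limit: `none` if the limit was exceeded, otherwise the final
memory and the time that is left. -/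
abbrev Outcome := Option (Store × ℕ)

/-- `s` with `x := k`. -/
def Store.setNum (s : Store) (x k : ℕ) : Store := { s with num := Function.update s.num x k }

/-- `s` with `a := w`. -/
def Store.setArr (s : Store) (a : ℕ) (w : List ℕ) : Store :=
  { s with arr := Function.update s.arr a w }

/-- Spend `cost` out of the remaining time `t`, arriving at memory `s`. -/
def spend (cost t : ℕ) (s : Store) : Outcome :=
  if cost ≤ t then some (s, t - cost) else none

/-- Continue a run that has not exceeded its limit. -/
noncomputable def Outcome.andThen (o : Outcome) (g : ℕ → Store → PMF Outcome) : PMF Outcome :=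
  match o with
  | none => PMF.pure none
  | some (s, t) => g t s

/-- At most `m` rounds of a loop.  A test costs at least one unit of time, so with time limit `t`
nothing is lost by allowing `t` rounds. -/
noncomputable def loopRun (e : Expr) (body : ℕ → Store → PMF Outcome) :
    ℕ → ℕ → Store → PMF Outcome
  | 0, _, _ => PMF.pure none
  | m + 1, t, s =>
    (spend (1 + e.cost s) t s).andThen fun t' _ =>
      if e.eval s = 0 then PMF.pure (some (s, t'))
      else (body t' s).bind fun o => o.andThen (loopRun e body m)

/-- Run a program with time limit `t` from memory `s`. -/
noncomputable def Program.run {ι : Type} (O : Oracles ι) :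
    Program ι → ℕ → Store → PMF Outcome
  | .skip, t, s => PMF.pure (spend 1 t s)
  | .assign x e, t, s => PMF.pure (spend (1 + e.cost s) t (s.setNum x (e.eval s)))
  | .clear a, t, s => PMF.pure (spend 1 t (s.setArr a []))
  | .push a e, t, s => PMF.pure (spend (1 + e.cost s) t (s.setArr a (s.arr a ++ [e.eval s])))
  | .put a i e, t, s =>
    PMF.pure (spend (1 + arraySize (s.arr a) + i.cost s + e.cost s) t
      (s.setArr a ((s.arr a).set (i.eval s) (e.eval s))))
  | .query q x e₁ e₂, t, s =>
    (O q (e₁.eval s) (e₂.eval s)).map fun k =>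
      spend (1 + e₁.cost s + e₂.cost s + Nat.size k) t (s.setNum x k)
  | .seq c₁ c₂, t, s => (c₁.run O t s).bind fun o => o.andThen (c₂.run O)
  | .ite e c₁ c₂, t, s =>
    (spend (1 + e.cost s) t s).andThen fun t' _ =>
      if e.eval s = 0 then c₂.run O t' s else c₁.run O t' s
  | .whileDo e c, t, s => loopRun e (c.run O) t t s

/-- Whatever the oracles answer, the program halts within time `T`, and the final memory
satisfies `Q`. -/
def Program.Achieves {ι : Type} (c : Program ι) (O : Oracles ι) (T : ℕ) (s : Store)
    (Q : Store → Prop) : Prop :=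
  ∀ o ∈ (c.run O T s).support, ∃ s' t', o = some (s', t') ∧ Q s'

/-- The probability that the program fails to halt within time `T` in a memory that
satisfies `Q`. -/
noncomputable def Program.failure {ι : Type} (c : Program ι) (O : Oracles ι) (T : ℕ) (s : Store)
    (Q : Store → Prop) : ℝ≥0∞ :=
  (c.run O T s).toOuterMeasure {o | ¬ ∃ s' t', o = some (s', t') ∧ Q s'}

/-- Initial memory: the given scalars and arrays in variables `0, 1, 2, …`, all else blank. -/
def input (nums : List ℕ) (arrs : List (List ℕ)) : Store :=
  ⟨fun x => nums.getD x 0, fun a => arrs.getD a []⟩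

/-! ## Black box fields -/

/-- A black box field operating on 0-1 strings of length `l` and encrypting the finite field `F`.
An element may have several encryptions and the answers may be randomized; nothing is assumed
about the behaviour on strings that are not cryptoelements, or about the inverse of zero. -/
structure BlackBoxField (F : Type*) [Field F] [Fintype F] (l : ℕ) where
  /-- The canonical projection; `none` for a string that is not a cryptoelement. -/
  proj : BitVec l → Option F
  proj_surj : ∀ a : F, ∃ x, proj x = some a
  /-- Random cryptoelements. -/
  sample : PMF (BitVec l)
  sample_mem : ∀ x ∈ sample.support, ∃ a, proj x = some a
  /-- The random element is almost uniform: at statistical distance at most `1/4` from uniform. -/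
  sample_unif : ∀ S : Finset F,
    (S.card : ℝ≥0∞) / (Fintype.card F : ℝ≥0∞) ≤
      sample.toOuterMeasure {x | ∃ a ∈ S, proj x = some a} + 1 / 4
  add : BitVec l → BitVec l → PMF (BitVec l)
  mul : BitVec l → BitVec l → PMF (BitVec l)
  inv : BitVec l → PMF (BitVec l)
  eq : BitVec l → BitVec l → PMF Bool
  add_spec : ∀ x y a b, proj x = some a → proj y = some b →
    ∀ z ∈ (add x y).support, proj z = some (a + b)
  mul_spec : ∀ x y a b, proj x = some a → proj y = some b →
    ∀ z ∈ (mul x y).support, proj z = some (a * b)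
  inv_spec : ∀ x a, proj x = some a → a ≠ 0 → ∀ z ∈ (inv x).support, proj z = some a⁻¹
  eq_spec : ∀ x y a b, proj x = some a → proj y = some b →
    ∀ v ∈ (eq x y).support, (v = true ↔ a = b)

/-- Field operations and equality test of the black box. -/
inductive FieldOp : Type
  | add | mul | inv | eq

/-- Sources of randomness: a fair coin, and random cryptoelements from the black box. -/
inductive RandomOp : Type
  | coin | sample

variable {F : Type*} [Field F] [Fintype F] {l : ℕ}

/-- The black box as an oracle; strings are passed as the numbers they denote in binary. -/
noncomputable def BlackBoxField.ops (K : BlackBoxField F l) : Oracles FieldOp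
  | .add, x, y => (K.add (BitVec.ofNat l x) (BitVec.ofNat l y)).map BitVec.toNat
  | .mul, x, y => (K.mul (BitVec.ofNat l x) (BitVec.ofNat l y)).map BitVec.toNat
  | .inv, x, _ => (K.inv (BitVec.ofNat l x)).map BitVec.toNat
  | .eq, x, y => (K.eq (BitVec.ofNat l x) (BitVec.ofNat l y)).map Bool.toNat

/-- Randomness as an oracle. -/
noncomputable def BlackBoxField.random (K : BlackBoxField F l) : Oracles RandomOp
  | .coin, _, _ => (PMF.uniformOfFintype Bool).map Bool.toNat
  | .sample, _, _ => K.sample.map BitVec.toNat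

/-- `δ` maps cryptoelements of the prime subfield of `K` to residues `0, …, p - 1`, and encrypts
the isomorphism `ψ` from the prime subfield onto `ℤ/p`. -/
def BlackBoxField.PrimeIso (K : BlackBoxField F l) {p : ℕ}
    (ψ : (⊥ : Subfield F) ≃+* ZMod p) (δ : BitVec l → ℕ) : Prop :=
  ∀ (x : BitVec l) (u : (⊥ : Subfield F)), K.proj x = some (u : F) → δ x = (ψ u).val

/-- A map from strings to numbers as an oracle. -/
noncomputable def mapOracle (δ : BitVec l → ℕ) : Oracles Unit :=
  fun _ x _ => PMF.pure (δ (BitVec.ofNat l x))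

/-! ## Explicitly given finite fields

The field with `p ^ n` elements is given by a monic irreducible polynomial `f` of degree `n`
over `ℤ/p`, as `(ℤ/p)[X]/(f)`; its elements are given by their `n` coordinates with respect to
the powers of the image of `X`, and residues mod `p` by the integers `0, …, p - 1`. -/

/-- The list of coefficients of `f`, leading coefficient last. -/
def coeffList {p : ℕ} (f : (ZMod p)[X]) : List ℕ :=
  List.ofFn fun i : Fin (f.natDegree + 1) => (f.coeff i).val

/-- A coordinate vector as it is given to, or printed by, an algorithm. -/
def coordList {p n : ℕ} (c : Fin n → ZMod p) : List ℕ := List.ofFn fun i => (c i).val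

/-- The element with the coordinates `c`. -/
noncomputable def element {p : ℕ} (f : (ZMod p)[X]) (c : Fin f.natDegree → ZMod p) :
    AdjoinRoot f :=
  ∑ i, AdjoinRoot.of f (c i) * AdjoinRoot.root f ^ (i : ℕ)

/-- With the auxiliary data `A`, the deterministic program `enc` computes within time `T` an
isomorphism from the explicitly given field to `K` which encrypts `φ`. -/
def ComputesTo {p : ℕ} (f : (ZMod p)[X]) (K : BlackBoxField F l) (enc : Program FieldOp)
    (T : ℕ) (A : List ℕ) (φ : AdjoinRoot f ≃+* F) : Prop :=
  ∀ c : Fin f.natDegree → ZMod p,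
    enc.Achieves K.ops T (input [p, l] [coeffList f, A, coordList c]) fun s =>
      ∃ y : BitVec l, s.num 0 = y.toNat ∧ K.proj y = some (φ (element f c))

/-- With the auxiliary data `A` and an oracle for `δ`, the program `dec` computes within time `T`
an isomorphism from `K` to the explicitly given field which encrypts the inverse of `φ`. -/
def ComputesFrom {p : ℕ} (f : (ZMod p)[X]) (K : BlackBoxField F l)
    (dec : Program (FieldOp ⊕ Unit)) (δ : BitVec l → ℕ) (T : ℕ) (A : List ℕ)
    (φ : AdjoinRoot f ≃+* F) : Prop :=
  ∀ (x : BitVec l) (c : Fin f.natDegree → ZMod p), K.proj x = some (φ (element f c)) →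
    dec.Achieves (Sum.elim K.ops (mapOracle δ)) T
      (input [p, l, x.toNat] [coeffList f, A]) fun s => s.arr 0 = coordList c

end BBField

open BBField

namespace BBField

/-! ## Expectations -/

/-! Write `n` for the degree of `f` and `g` for `f` read over `F`. As `F` has `p ^ n` elements, `g`
has `n` distinct roots in `F` (`card_roots_map`), and each root `α` gives an isomorphism `φ` sending
`X` to `α`. It remains to find an encrypted root and data that invert `φ`.

A polynomial of degree less than `n` is determined by its values at the roots of `g`, so arithmetic
modulo `g` on encrypted coefficient vectors is pointwise arithmetic of functions on the roots
(`IsEncPoly`, `shiftAdd_poly`, `mulInto_poly`). The search maintains a polynomial `E`; the analysis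
follows the set `S` of roots at which `E` does not vanish. At the start `E = 1`. A round draws a
random `r` and replaces `E` by `E * (σ(1 + r X) + 1)` unless that product is zero; here `σ` is the
power with exponent half of `|F|`, rounded down, for odd `p`, and one plus the absolute trace for `p
= 2`. Two roots stay together in `S` only if `r` does not separate them. At least a third of all `r`
separate a given pair (`card_separated`), so with a sampling error of 1/4 a pair stays with
probability at most 11/12, and the expected number of ordered pairs decays geometrically
(`expect_card_offDiag_le`). No gcd or polynomial division occurs.

Once `S = {α}`, `E` is a constant multiple of `g / (X - α)`. Then `X * E` is congruent to `α * E`,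
and `α` is a quotient of two top coefficients (`writeKey_ensures`). The encryptions of `0` and `1`
needed beforehand are `p * a` and `a * a⁻¹` for a random nonzero `a`.

The same `E` inverts `φ`: the elements `E.coeff i / E.eval α` form the basis dual to the powers of
`α` for the trace form, so the coordinates of an element are traces (`sum_pow_eq_coordinate`).
Traces lie in the prime field, where `δ` reads them. Encoding is Horner's scheme at `α`.
Compatibility with `δ` is automatic, because `ZMod p` has only one ring homomorphism to `F`.

Programs are verified by a calculus of expectations, `Program.Expects`, in which exceeding a time or
size bound has value `∞`. A single such bound yields both halting under all oracle answers and the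
failure probability. -/

/-- Expected value of `g` under `p`. -/
noncomputable def expect {α : Type*} (p : PMF α) (g : α → ℝ≥0∞) : ℝ≥0∞ := ∑' a, p a * g a

theorem expect_pure {α : Type*} (a : α) (g : α → ℝ≥0∞) : expect (PMF.pure a) g = g a := by
  unfold expect
  rw [tsum_eq_single a]
  · simp
  · intro b hb
    simp [PMF.pure_apply, hb]

theorem expect_bind {α β : Type*} (p : PMF α) (f : α → PMF β) (g : β → ℝ≥0∞) :
    expect (p.bind f) g = expect p fun a => expect (f a) g := by
  unfold expect
  simp only [PMF.bind_apply, ← ENNReal.tsum_mul_right, ← ENNReal.tsum_mul_left]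
  rw [ENNReal.tsum_comm]
  simp only [mul_assoc]

theorem expect_map {α β : Type*} (p : PMF α) (f : α → β) (g : β → ℝ≥0∞) :
    expect (p.map f) g = expect p fun a => g (f a) := by
  unfold PMF.map
  rw [expect_bind]
  simp [expect_pure]

theorem expect_mono {α : Type*} (p : PMF α) {g h : α → ℝ≥0∞}
    (H : ∀ a ∈ p.support, g a ≤ h a) : expect p g ≤ expect p h := by
  refine ENNReal.tsum_le_tsum fun a => ?_
  by_cases ha : a ∈ p.support
  · gcongr
    exact H a ha
  · rw [PMF.mem_support_iff, not_not] at ha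
    simp [ha]

theorem expect_const {α : Type*} (p : PMF α) (c : ℝ≥0∞) : expect p (fun _ => c) = c := by
  simp [expect, ENNReal.tsum_mul_right]

theorem expect_le {α : Type*} (p : PMF α) {g : α → ℝ≥0∞} {c : ℝ≥0∞}
    (H : ∀ a ∈ p.support, g a ≤ c) : expect p g ≤ c :=
  (expect_mono p H).trans (expect_const p c).le

theorem expect_add {α : Type*} (p : PMF α) (g h : α → ℝ≥0∞) :
    expect p (fun a => g a + h a) = expect p g + expect p h := by
  simp [expect, mul_add, ENNReal.tsum_add]

theorem expect_const_mul {α : Type*} (p : PMF α) (c : ℝ≥0∞) (g : α → ℝ≥0∞) :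
    expect p (fun a => c * g a) = c * expect p g := by
  simp [expect, ← ENNReal.tsum_mul_left, mul_left_comm]

theorem expect_finset_sum {α κ : Type*} (p : PMF α) (S : Finset κ) (g : κ → α → ℝ≥0∞) :
    expect p (fun a => ∑ i ∈ S, g i a) = ∑ i ∈ S, expect p (g i) := by
  classical
  induction S using Finset.induction_on with
  | empty => simp [expect]
  | insert i S hi ih => simp only [Finset.sum_insert hi, expect_add, ih]

theorem expect_indicator {α : Type*} (p : PMF α) (s : Set α) [DecidablePred (· ∈ s)] :
    expect p (fun a => if a ∈ s then 1 else 0) = p.toOuterMeasure s := by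
  classical
  rw [PMF.toOuterMeasure_apply]
  refine tsum_congr fun a => ?_
  by_cases h : a ∈ s <;> simp [h]

/-! ## Resource bounds -/

/-- All numbers in memory have at most `B` bits and all arrays at most `B` entries. -/
def Store.Bounded (B : ℕ) (s : Store) : Prop :=
  (∀ x, s.num x < 2 ^ B) ∧ ∀ a, (s.arr a).length ≤ B ∧ ∀ v ∈ s.arr a, v < 2 ^ B

/-- Size of an expression. -/
def Expr.nodes : Expr → ℕ
  | .lit k => 1 + Nat.size k
  | .var _ => 1
  | .len _ => 1
  | .get _ i => 1 + i.nodes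
  | .add e₁ e₂ => 1 + e₁.nodes + e₂.nodes
  | .sub e₁ e₂ => 1 + e₁.nodes + e₂.nodes
  | .mul e₁ e₂ => 1 + e₁.nodes + e₂.nodes
  | .div e₁ e₂ => 1 + e₁.nodes + e₂.nodes
  | .mod e₁ e₂ => 1 + e₁.nodes + e₂.nodes

/-- Bound for the cost of one operation in a bounded memory. -/
noncomputable def unitCost : ℕ[X] := X * (X + 1) + 1

theorem eval_unitCost (B : ℕ) : unitCost.eval B = B * (B + 1) + 1 := by
  simp [unitCost]

theorem Store.Bounded.arraySize_le {B : ℕ} {s : Store} (h : s.Bounded B) (a : ℕ) :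
    arraySize (s.arr a) ≤ B * (B + 1) := by
  unfold arraySize
  refine (List.sum_le_card_nsmul _ (B + 1) ?_).trans ?_
  · intro x hx
    obtain ⟨v, hv, rfl⟩ := List.mem_map.1 hx
    have := Nat.size_le.2 ((h.2 a).2 v hv)
    omega
  · rw [List.length_map, smul_eq_mul]
    exact Nat.mul_le_mul_right _ (h.2 a).1

/-- Only data that are read are charged, so intermediate values may exceed `2 ^ B` without harm. -/
theorem Expr.cost_le {B : ℕ} {s : Store} (h : s.Bounded B) (e : Expr) :
    e.cost s ≤ e.nodes * unitCost.eval B := by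
  have hB : B ≤ B * (B + 1) := Nat.le_mul_of_pos_right _ (Nat.succ_pos _)
  rw [eval_unitCost]
  induction e with
  | lit k => exact Nat.le_mul_of_pos_right _ (Nat.succ_pos _)
  | var x =>
    have := Nat.size_le.2 (h.1 x)
    simp only [Expr.cost, Expr.nodes]; omega
  | len a =>
    have := h.arraySize_le a
    simp only [Expr.cost, Expr.nodes]; omega
  | get a i ih =>
    have := h.arraySize_le a
    simp only [Expr.cost, Expr.nodes, add_mul]; omega
  | _ => simp only [Expr.cost, Expr.nodes, add_mul]; omega

/-! ### Time bounds and a calculus of expected values for programs -/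

namespace Program

variable {ι : Type}

/-- A bound for the running time in a memory that stays bounded by the argument of the
polynomial, if every loop has at most that many rounds. -/
noncomputable def time : Program ι → ℕ[X]
  | .skip => 1
  | .assign _ e => 1 + (e.nodes : ℕ[X]) * unitCost
  | .clear _ => 1
  | .push _ e => 1 + (e.nodes : ℕ[X]) * unitCost
  | .put _ i e => 1 + unitCost + (i.nodes : ℕ[X]) * unitCost + (e.nodes : ℕ[X]) * unitCost
  | .query _ _ e₁ e₂ => 1 + (e₁.nodes : ℕ[X]) * unitCost + (e₂.nodes : ℕ[X]) * unitCost + X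
  | .seq c₁ c₂ => c₁.time + c₂.time
  | .ite e c₁ c₂ => 1 + (e.nodes : ℕ[X]) * unitCost + c₁.time + c₂.time
  | .whileDo e c => (X + 1) * (1 + (e.nodes : ℕ[X]) * unitCost + c.time)

/-- The scalars that may be changed. -/
def writesNum : Program ι → ℕ → Bool
  | .skip, _ => false
  | .assign x _, y => x == y
  | .clear _, _ => false
  | .push _ _, _ => false
  | .put _ _ _, _ => false
  | .query _ x _ _, y => x == y
  | .seq c₁ c₂, y => c₁.writesNum y || c₂.writesNum y
  | .ite _ c₁ c₂, y => c₁.writesNum y || c₂.writesNum y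
  | .whileDo _ c, y => c.writesNum y

/-- The arrays that may be changed. -/
def writesArr : Program ι → ℕ → Bool
  | .skip, _ => false
  | .assign _ _, _ => false
  | .clear a, b => a == b
  | .push a _, b => a == b
  | .put a _ _, b => a == b
  | .query _ _ _ _, _ => false
  | .seq c₁ c₂, y => c₁.writesArr y || c₂.writesArr y
  | .ite _ c₁ c₂, y => c₁.writesArr y || c₂.writesArr y
  | .whileDo _ c, y => c.writesArr y

/-- Only variables that `c` writes to have been changed. -/
def Frame (c : Program ι) (s s' : Store) : Prop :=
  (∀ x, c.writesNum x = false → s'.num x = s.num x) ∧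
    ∀ a, c.writesArr a = false → s'.arr a = s.arr a

theorem Frame.refl (c : Program ι) (s : Store) : c.Frame s s := ⟨fun _ _ => rfl, fun _ _ => rfl⟩

theorem Frame.trans {c c₁ c₂ : Program ι} {s s₁ s₂ : Store} (h₁ : c₁.Frame s s₁)
    (h₂ : c₂.Frame s₁ s₂)
    (hn : ∀ x, c.writesNum x = false → c₁.writesNum x = false ∧ c₂.writesNum x = false)
    (ha : ∀ x, c.writesArr x = false → c₁.writesArr x = false ∧ c₂.writesArr x = false) :
    c.Frame s s₂ :=
  ⟨fun x hx => (h₂.1 x (hn x hx).2).trans (h₁.1 x (hn x hx).1),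
    fun x hx => (h₂.2 x (ha x hx).2).trans (h₁.2 x (ha x hx).1)⟩

open Classical in
/-- The value `X` of the final memory, or `∞` if one of the bounds is violated. -/
noncomputable def weight (c : Program ι) (T B t : ℕ) (s : Store) (X : Store → ℝ≥0∞) :
    Outcome → ℝ≥0∞
  | none => ⊤
  | some (s', t') => if t ≤ t' + T ∧ s'.Bounded B ∧ c.Frame s s' then X s' else ⊤

open Classical in
theorem weight_some (c : Program ι) (T B t : ℕ) (s : Store) (X : Store → ℝ≥0∞) (s' : Store)
    (t' : ℕ) : c.weight T B t s X (some (s', t')) =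
      if t ≤ t' + T ∧ s'.Bounded B ∧ c.Frame s s' then X s' else ⊤ := rfl

/-- From a memory `s` bounded by `B`, the program always halts within its time bound and with a
bounded memory, and the expected value of `X` at the end is at most `ε`. -/
def Expects (c : Program ι) (O : Oracles ι) (B : ℕ) (s : Store) (X : Store → ℝ≥0∞)
    (ε : ℝ≥0∞) : Prop :=
  s.Bounded B → ∀ t, c.time.eval B ≤ t →
    expect (c.run O t s) (c.weight (c.time.eval B) B t s X) ≤ ε

open Classical in
/-- From a memory `s` bounded by `B`, the program always halts within its time bound and with a
bounded memory that satisfies `Q`. -/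
def Ensures (c : Program ι) (O : Oracles ι) (B : ℕ) (s : Store) (Q : Store → Prop) : Prop :=
  c.Expects O B s (fun s' => if Q s' then 0 else ⊤) 0

variable {O : Oracles ι} {B : ℕ} {s : Store} {c c₁ c₂ : Program ι}

theorem Expects.mono {X X' : Store → ℝ≥0∞} {ε ε' : ℝ≥0∞} (h : c.Expects O B s X ε)
    (hX : ∀ s', c.Frame s s' → X' s' ≤ X s') (hε : ε ≤ ε') : c.Expects O B s X' ε' := by
  intro hs t ht
  refine (expect_mono _ ?_).trans ((h hs t ht).trans hε)
  rintro (_ | ⟨s', t'⟩) -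
  · exact le_rfl
  · simp only [weight_some]
    split_ifs with h1
    · exact hX s' h1.2.2
    · exact le_rfl

theorem Expects.top (X : Store → ℝ≥0∞) : c.Expects O B s X ⊤ := fun _ _ _ => le_top

/-- An expectation of a function with values `0` and `∞` that equals zero forces the value `0` on
the whole support. This passes from certain events to expectations. -/
theorem Ensures.expects {Q : Store → Prop} {X : Store → ℝ≥0∞} {ε : ℝ≥0∞}
    (h : c.Ensures O B s Q) (hX : ∀ s', c.Frame s s' → Q s' → X s' ≤ ε) :
    c.Expects O B s X ε := by
  classical
  intro hs t ht
  have h0 := h hs t ht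
  refine expect_le _ fun o ho => ?_
  have h1 : c.weight (c.time.eval B) B t s (fun s' => if Q s' then 0 else ⊤) o = 0 := by
    have h2 := (ENNReal.summable.tsum_eq_zero_iff).1 (nonpos_iff_eq_zero.1 h0) o
    exact (mul_eq_zero.1 h2).resolve_left ((PMF.mem_support_iff _ _).1 ho)
  rcases o with _ | ⟨s', t'⟩
  · simp [weight] at h1
  · rw [weight_some] at h1 ⊢
    split_ifs at h1 ⊢ with h2 h3
    all_goals first | exact hX s' h2.2.2 h3 | simp at h1

theorem Ensures.mono {Q Q' : Store → Prop} (h : c.Ensures O B s Q)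
    (hQ : ∀ s', c.Frame s s' → Q s' → Q' s') : c.Ensures O B s Q' :=
  h.expects fun s' hf hq => by simp [hQ s' hf hq]

/-! ### Single statements -/

theorem expects_pure_of {X : Store → ℝ≥0∞} {ε : ℝ≥0∞} {s' : Store} {n t : ℕ}
    (hn : n ≤ c.time.eval B) (ht : c.time.eval B ≤ t) (hf : c.Frame s s')
    (hb : s'.Bounded B) (hX : X s' ≤ ε) :
    c.weight (c.time.eval B) B t s X (spend n t s') ≤ ε := by
  rw [spend, if_pos (hn.trans ht), weight_some, if_pos ⟨by omega, hb, hf⟩]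
  exact hX

theorem _root_.BBField.Store.Bounded.setNum (hs : s.Bounded B) {x k : ℕ} (hk : k < 2 ^ B) :
    (s.setNum x k).Bounded B := by
  refine ⟨fun y => ?_, hs.2⟩
  simp only [Store.setNum, Function.update_apply]
  split_ifs
  · exact hk
  · exact hs.1 y

theorem _root_.BBField.Store.Bounded.setArr (hs : s.Bounded B) {a : ℕ} {w : List ℕ}
    (hw : w.length ≤ B) (hv : ∀ v ∈ w, v < 2 ^ B) : (s.setArr a w).Bounded B := by
  refine ⟨hs.1, fun y => ?_⟩
  simp only [Store.setArr, Function.update_apply]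
  split_ifs
  · exact ⟨hw, hv⟩
  · exact hs.2 y

@[simp] theorem _root_.BBField.Store.setNum_num (s : Store) (x k y : ℕ) :
    (s.setNum x k).num y = if y = x then k else s.num y := by
  simp [Store.setNum, Function.update_apply]

@[simp] theorem _root_.BBField.Store.setNum_arr (s : Store) (x k : ℕ) :
    (s.setNum x k).arr = s.arr := rfl

@[simp] theorem _root_.BBField.Store.setArr_arr (s : Store) (a : ℕ) (w : List ℕ) (b : ℕ) :
    (s.setArr a w).arr b = if b = a then w else s.arr b := by
  simp [Store.setArr, Function.update_apply]

@[simp] theorem _root_.BBField.Store.setArr_num (s : Store) (a : ℕ) (w : List ℕ) :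
    (s.setArr a w).num = s.num := rfl

theorem expects_skip {X : Store → ℝ≥0∞} {ε : ℝ≥0∞} (hX : X s ≤ ε) :
    (skip : Program ι).Expects O B s X ε := by
  intro hs t ht
  rw [run, expect_pure]
  exact expects_pure_of (by simp [time]) ht (Frame.refl _ _) hs hX

theorem expects_assign {X : Store → ℝ≥0∞} {ε : ℝ≥0∞} {x : ℕ} {e : Expr}
    (hv : e.eval s < 2 ^ B) (hX : X (s.setNum x (e.eval s)) ≤ ε) :
    (assign x e : Program ι).Expects O B s X ε := by
  intro hs t ht
  rw [run, expect_pure]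
  refine expects_pure_of ?_ ht ⟨fun y hy => ?_, fun _ _ => rfl⟩ (hs.setNum hv) hX
  · simpa [time] using Expr.cost_le hs e
  · simp only [writesNum, beq_eq_false_iff_ne] at hy
    simp [hy.symm]

theorem expects_clear {X : Store → ℝ≥0∞} {ε : ℝ≥0∞} {a : ℕ} (hX : X (s.setArr a []) ≤ ε) :
    (clear a : Program ι).Expects O B s X ε := by
  intro hs t ht
  rw [run, expect_pure]
  refine expects_pure_of (by simp [time]) ht ⟨fun _ _ => rfl, fun y hy => ?_⟩
    (hs.setArr (by simp) (by simp)) hX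
  simp only [writesArr, beq_eq_false_iff_ne] at hy
  simp [hy.symm]

theorem expects_push {X : Store → ℝ≥0∞} {ε : ℝ≥0∞} {a : ℕ} {e : Expr}
    (hv : e.eval s < 2 ^ B) (hl : (s.arr a).length < B)
    (hX : X (s.setArr a (s.arr a ++ [e.eval s])) ≤ ε) :
    (push a e : Program ι).Expects O B s X ε := by
  intro hs t ht
  rw [run, expect_pure]
  refine expects_pure_of ?_ ht ⟨fun _ _ => rfl, fun y hy => ?_⟩ (hs.setArr (by simpa using hl) ?_) hX
  · simpa [time] using Expr.cost_le hs e
  · simp only [writesArr, beq_eq_false_iff_ne] at hy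
    simp [hy.symm]
  · intro v hv'
    rcases List.mem_append.1 hv' with h | h
    · exact (hs.2 a).2 v h
    · rw [List.mem_singleton.1 h]; exact hv

theorem expects_put {X : Store → ℝ≥0∞} {ε : ℝ≥0∞} {a : ℕ} {i e : Expr}
    (hv : e.eval s < 2 ^ B)
    (hX : X (s.setArr a ((s.arr a).set (i.eval s) (e.eval s))) ≤ ε) :
    (put a i e : Program ι).Expects O B s X ε := by
  intro hs t ht
  rw [run, expect_pure]
  refine expects_pure_of ?_ ht ⟨fun _ _ => rfl, fun y hy => ?_⟩
    (hs.setArr (by simpa using (hs.2 a).1) ?_) hX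
  · have h1 := Expr.cost_le hs e
    have h2 := Expr.cost_le hs i
    have h3 := hs.arraySize_le a
    have h4 := eval_unitCost B
    simp only [time, eval_add, eval_one, eval_mul, eval_natCast]
    simp only [Nat.cast_id]
    omega
  · simp only [writesArr, beq_eq_false_iff_ne] at hy
    simp [hy.symm]
  · intro v hv'
    rcases List.mem_or_eq_of_mem_set hv' with h | h
    · exact (hs.2 a).2 v h
    · rw [h]; exact hv

theorem expects_query {X : Store → ℝ≥0∞} {ε : ℝ≥0∞} {q : ι} {x : ℕ} {e₁ e₂ : Expr}
    (hv : ∀ k ∈ (O q (e₁.eval s) (e₂.eval s)).support, k < 2 ^ B)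
    (hX : expect (O q (e₁.eval s) (e₂.eval s)) (fun k => X (s.setNum x k)) ≤ ε) :
    (query q x e₁ e₂).Expects O B s X ε := by
  intro hs t ht
  rw [run, expect_map]
  refine (expect_mono _ fun k hk => ?_).trans hX
  refine expects_pure_of ?_ ht ⟨fun y hy => ?_, fun _ _ => rfl⟩ (hs.setNum (hv k hk)) le_rfl
  · have h1 := Expr.cost_le hs e₁
    have h2 := Expr.cost_le hs e₂
    have h3 := Nat.size_le.2 (hv k hk)
    simp only [time, eval_add, eval_one, eval_mul, eval_natCast, eval_X]
    simp only [Nat.cast_id]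
    omega
  · simp only [writesNum, beq_eq_false_iff_ne] at hy
    simp [hy.symm]

/-! ### Composition, branching and loops -/

/-- Common core of sequencing and of a loop round: time budgets add up and frames compose, while a
first run that violates a bound already has weight `∞` on the right. -/
theorem expect_andThen_le {X Y : Store → ℝ≥0∞} {T T₁ T₂ t : ℕ} {g : ℕ → Store → PMF Outcome}
    (hY : ∀ s₁ t₁, s₁.Bounded B → c₁.Frame s s₁ → T₂ ≤ t₁ →
      expect (g t₁ s₁) (c₂.weight T₂ B t₁ s₁ X) ≤ Y s₁)
    (hn : ∀ x, c.writesNum x = false → c₁.writesNum x = false ∧ c₂.writesNum x = false)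
    (ha : ∀ x, c.writesArr x = false → c₁.writesArr x = false ∧ c₂.writesArr x = false)
    (hT : T₁ + T₂ ≤ T) (ht : T ≤ t) (o : Outcome) :
    expect (o.andThen g) (c.weight T B t s X) ≤ c₁.weight T₁ B t s Y o := by
  rcases o with _ | ⟨s₁, t₁⟩
  · exact le_top
  · rw [weight_some]
    split_ifs with h1
    · refine (expect_mono _ ?_).trans (hY s₁ t₁ h1.2.1 h1.2.2 (by omega))
      rintro (_ | ⟨s', t'⟩) -
      · exact le_rfl
      · rw [weight_some, weight_some]
        split_ifs with h2 h3 h3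
        · exact le_rfl
        · exact le_top
        · exact absurd ⟨by omega, h3.2.1, h1.2.2.trans h3.2.2 hn ha⟩ h2
        · exact le_rfl
    · exact le_top

theorem Expects.seq {X Y : Store → ℝ≥0∞} {ε : ℝ≥0∞} (h₁ : c₁.Expects O B s Y ε)
    (h₂ : ∀ s', c₁.Frame s s' → c₂.Expects O B s' X (Y s')) :
    (seq c₁ c₂).Expects O B s X ε := by
  intro hs t ht
  rw [run, expect_bind]
  simp only [time, eval_add] at ht ⊢
  refine (expect_mono _ fun o _ => ?_).trans (h₁ hs t (by omega))
  exact expect_andThen_le (fun s₁ t₁ hb hf ht₁ => h₂ s₁ hf hb t₁ ht₁)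
    (by simp [writesNum]) (by simp [writesArr]) le_rfl ht o

theorem Expects.ite {X : Store → ℝ≥0∞} {ε : ℝ≥0∞} {e : Expr}
    (h₁ : e.eval s ≠ 0 → c₁.Expects O B s X ε) (h₂ : e.eval s = 0 → c₂.Expects O B s X ε) :
    (ite e c₁ c₂).Expects O B s X ε := by
  intro hs t ht
  have he := Expr.cost_le hs e
  rw [run]
  simp only [time, eval_add, eval_one, eval_mul, eval_natCast, Nat.cast_id] at ht ⊢
  rw [spend, if_pos (by omega)]
  change expect (if e.eval s = 0 then _ else _) _ ≤ ε
  have key : ∀ c' : Program ι, c'.Expects O B s X ε → (c'.time.eval B ≤ c₁.time.eval B + c₂.time.eval B) →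
      (∀ x, (Program.ite e c₁ c₂).writesNum x = false → c'.writesNum x = false) →
      (∀ x, (Program.ite e c₁ c₂).writesArr x = false → c'.writesArr x = false) →
      expect (c'.run O (t - (1 + e.cost s)) s) ((Program.ite e c₁ c₂).weight
        (1 + e.nodes * unitCost.eval B + c₁.time.eval B + c₂.time.eval B) B t s X) ≤ ε := by
    intro c' h hT hn ha
    refine (expect_mono _ ?_).trans (h hs (t - (1 + e.cost s)) (by omega))
    rintro (_ | ⟨s', t'⟩) -
    · exact le_rfl
    · rw [weight_some, weight_some]
      split_ifs with h2 h3 h3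
      · exact le_rfl
      · exact le_top
      · exact absurd ⟨by omega, h3.2.1, fun x hx => h3.2.2.1 x (hn x hx),
          fun x hx => h3.2.2.2 x (ha x hx)⟩ h2
      · exact le_rfl
  split_ifs with h0
  · exact key c₂ (h₂ h0) (by omega) (by simp [writesNum]) (by simp [writesArr])
  · exact key c₁ (h₁ h0) (by omega) (by simp +contextual [writesNum])
      (by simp +contextual [writesArr])

/-- `J r` is a bound for the final expectation when at most `r` rounds remain; the value `∞` marks
states outside the invariant, about which nothing is claimed. Demanding a predecessor of `r` for
each round forces the test to fail at `r = 0`. -/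
theorem Expects.whileDo {X : Store → ℝ≥0∞} {e : Expr} {J : ℕ → Store → ℝ≥0∞}
    (hJ : ∀ r s', (Program.whileDo e c).Frame s s' → J r s' ≠ ⊤ → (e.eval s' = 0 → X s' ≤ J r s') ∧
      (e.eval s' ≠ 0 → ∃ r', r = r' + 1 ∧ c.Expects O B s' (J r') (J r s')))
    {r : ℕ} (hr : r ≤ B) : (Program.whileDo e c).Expects O B s X (J r s) := by
  intro hs t ht
  rw [run]
  have key : ∀ r m t s', s'.Bounded B → (Program.whileDo e c).Frame s s' →
      (r + 1) * (1 + e.nodes * unitCost.eval B + c.time.eval B) ≤ t → r + 1 ≤ m →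
      expect (loopRun e (c.run O) m t s') ((Program.whileDo e c).weight
        ((r + 1) * (1 + e.nodes * unitCost.eval B + c.time.eval B)) B t s' X) ≤ J r s' := by
    intro r
    induction r with
    | zero =>
      intro m t s' hs' hf ht hm
      by_cases htop : J 0 s' = ⊤
      · rw [htop]; exact le_top
      obtain ⟨h1, h2⟩ := hJ 0 s' hf htop
      have h0 : e.eval s' = 0 := by
        by_contra h
        obtain ⟨r', hr', -⟩ := h2 h
        omega
      obtain ⟨m, rfl⟩ := Nat.exists_eq_add_of_le hm
      have he := Expr.cost_le hs' e
      rw [show 0 + 1 + m = m + 1 by omega, loopRun, spend, if_pos (by omega)]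
      change expect (if e.eval s' = 0 then _ else _) _ ≤ _
      rw [if_pos h0, expect_pure, weight_some, if_pos ⟨by omega, hs', Frame.refl _ _⟩]
      exact h1 h0
    | succ r ih =>
      intro m t s' hs' hf ht hm
      by_cases htop : J (r + 1) s' = ⊤
      · rw [htop]; exact le_top
      obtain ⟨h1, h2⟩ := hJ (r + 1) s' hf htop
      obtain ⟨m, rfl⟩ := Nat.exists_eq_add_of_le hm
      have he := Expr.cost_le hs' e
      have hle : 1 + e.nodes * unitCost.eval B + c.time.eval B ≤
          (r + 1 + 1) * (1 + e.nodes * unitCost.eval B + c.time.eval B) :=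
        Nat.le_mul_of_pos_left _ (by omega)
      rw [show r + 1 + 1 + m = (r + 1 + m) + 1 by omega, loopRun, spend, if_pos (by omega)]
      change expect (if e.eval s' = 0 then _ else _) _ ≤ _
      split_ifs with h0
      · rw [expect_pure, weight_some, if_pos ⟨by omega, hs', Frame.refl _ _⟩]
        exact h1 h0
      · obtain ⟨r', hr', hc⟩ := h2 h0
        obtain rfl : r' = r := by omega
        rw [expect_bind]
        have hsplit : (r' + 1 + 1) * (1 + e.nodes * unitCost.eval B + c.time.eval B) =
          (r' + 1) * (1 + e.nodes * unitCost.eval B + c.time.eval B) +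
            (1 + e.nodes * unitCost.eval B) + c.time.eval B := by ring
        rw [hsplit] at ht ⊢
        refine (expect_mono _ fun o _ => ?_).trans (hc hs' (t - (1 + e.cost s')) (by omega))
        have := expect_andThen_le (c := Program.whileDo e c) (c₁ := c)
          (c₂ := Program.whileDo e c) (s := s') (B := B) (X := X) (Y := J r')
          (t := t - (1 + e.cost s'))
          (T₁ := c.time.eval B)
          (T := (r' + 1) * (1 + e.nodes * unitCost.eval B + c.time.eval B) + c.time.eval B)
          (g := loopRun e (c.run O) (r' + 1 + m))
          (fun s₁ t₁ hb hf' ht₁ => ih (r' + 1 + m) t₁ s₁ hb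
            (hf.trans (c₂ := c) hf' (by simp [writesNum]) (by simp [writesArr])) ht₁ (by omega))
          (by simp [writesNum]) (by simp [writesArr])
          (by omega) (by omega) o
        refine le_trans (expect_mono _ ?_) this
        rintro (_ | ⟨s₂, t₂⟩) -
        · exact le_rfl
        · rw [weight_some, weight_some]
          split_ifs with h2 h3 h3
          · exact le_rfl
          · exact le_top
          · exact absurd ⟨by omega, h3.2⟩ h2
          · exact le_rfl
  simp only [time, eval_add, eval_one, eval_mul, eval_natCast, Nat.cast_id, eval_X] at ht ⊢
  have hle : (r + 1) * (1 + e.nodes * unitCost.eval B + c.time.eval B) ≤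
      (B + 1) * (1 + e.nodes * unitCost.eval B + c.time.eval B) := by gcongr
  -- `loopRun` starts with as many rounds as units of time, and the time bound of the loop is at
  -- least `B + 1`, which leaves room for `r + 1` tests.
  have hB : B + 1 ≤ (B + 1) * (1 + e.nodes * unitCost.eval B + c.time.eval B) :=
    Nat.le_mul_of_pos_right _ (by omega)
  refine le_trans (expect_mono _ ?_) (key r t t s hs (Frame.refl _ _) (hle.trans ht) (by omega))
  rintro (_ | ⟨s₂, t₂⟩) -
  · exact le_rfl
  · rw [weight_some, weight_some]
    split_ifs with h2 h3 h3
    · exact le_rfl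
    · exact le_top
    · exact absurd ⟨by omega, h3.2⟩ h2
    · exact le_rfl

/-! ### Certain events -/

theorem Ensures.skip {Q : Store → Prop} (hQ : Q s) : (skip : Program ι).Ensures O B s Q :=
  expects_skip (by simp [hQ])

theorem Ensures.assign {Q : Store → Prop} {x : ℕ} {e : Expr} (hv : e.eval s < 2 ^ B)
    (hQ : Q (s.setNum x (e.eval s))) : (assign x e : Program ι).Ensures O B s Q :=
  expects_assign hv (by simp [hQ])

theorem Ensures.clear {Q : Store → Prop} {a : ℕ} (hQ : Q (s.setArr a [])) :
    (clear a : Program ι).Ensures O B s Q :=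
  expects_clear (by simp [hQ])

theorem Ensures.push {Q : Store → Prop} {a : ℕ} {e : Expr} (hv : e.eval s < 2 ^ B)
    (hl : (s.arr a).length < B) (hQ : Q (s.setArr a (s.arr a ++ [e.eval s]))) :
    (push a e : Program ι).Ensures O B s Q :=
  expects_push hv hl (by simp [hQ])

theorem Ensures.put {Q : Store → Prop} {a : ℕ} {i e : Expr} (hv : e.eval s < 2 ^ B)
    (hQ : Q (s.setArr a ((s.arr a).set (i.eval s) (e.eval s)))) :
    (put a i e : Program ι).Ensures O B s Q :=
  expects_put hv (by simp [hQ])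

theorem Ensures.query {Q : Store → Prop} {q : ι} {x : ℕ} {e₁ e₂ : Expr}
    (hQ : ∀ k ∈ (O q (e₁.eval s) (e₂.eval s)).support, k < 2 ^ B ∧ Q (s.setNum x k)) :
    (query q x e₁ e₂).Ensures O B s Q :=
  expects_query (fun k hk => (hQ k hk).1) (expect_le _ fun k hk => by simp [(hQ k hk).2])

theorem Ensures.seq_expects {R : Store → Prop} {X : Store → ℝ≥0∞} {ε : ℝ≥0∞}
    (h₁ : c₁.Ensures O B s R) (h₂ : ∀ s', c₁.Frame s s' → R s' → c₂.Expects O B s' X ε) :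
    (seq c₁ c₂).Expects O B s X ε := by
  classical
  refine Expects.seq (Y := fun s' => if R s' then ε else ⊤)
    (h₁.expects fun s' _ hR => by simp [hR]) fun s' hf => ?_
  split_ifs with hR
  · exact h₂ s' hf hR
  · exact Expects.top _

theorem Ensures.seq {R Q : Store → Prop} (h₁ : c₁.Ensures O B s R)
    (h₂ : ∀ s', c₁.Frame s s' → R s' → c₂.Ensures O B s' Q) : (seq c₁ c₂).Ensures O B s Q :=
  h₁.seq_expects h₂

theorem Ensures.andThen {Q : Store → Prop}
    (h : c₁.Ensures O B s fun s' => c₂.Ensures O B s' Q) : (Program.seq c₁ c₂).Ensures O B s Q :=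
  h.seq fun _ _ h' => h'

/-- Boundedness of the initial memory is a premise inside `Expects`, so it may be assumed when a
value must be shown to fit. -/
theorem Ensures.of_bounded {Q : Store → Prop} (h : s.Bounded B → c.Ensures O B s Q) :
    c.Ensures O B s Q := fun hs => h hs hs

theorem Ensures.ite {Q : Store → Prop} {e : Expr} (h₁ : e.eval s ≠ 0 → c₁.Ensures O B s Q)
    (h₂ : e.eval s = 0 → c₂.Ensures O B s Q) : (ite e c₁ c₂).Ensures O B s Q :=
  Expects.ite h₁ h₂

theorem Ensures.whileDo {Q : Store → Prop} {e : Expr} {J : ℕ → Store → Prop}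
    (hJ : ∀ r s', (Program.whileDo e c).Frame s s' → J r s' → (e.eval s' = 0 → Q s') ∧
      (e.eval s' ≠ 0 → ∃ r', r = r' + 1 ∧ c.Ensures O B s' (J r')))
    {r : ℕ} (hr : r ≤ B) (h : J r s) : (Program.whileDo e c).Ensures O B s Q := by
  classical
  have := Expects.whileDo (O := O) (B := B) (s := s) (c := c) (e := e)
    (X := fun s' => if Q s' then 0 else ⊤) (J := fun r s' => if J r s' then 0 else ⊤) ?_ hr
  · simp only [h, if_true] at this
    exact this
  · intro r s' hf htop
    have hJs : J r s' := by
      by_contra h'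
      simp [h'] at htop
    obtain ⟨h1, h2⟩ := hJ r s' hf hJs
    refine ⟨fun h0 => by simp [h1 h0], fun h0 => ?_⟩
    obtain ⟨r', hr', hc⟩ := h2 h0
    refine ⟨r', hr', ?_⟩
    simp only [hJs, if_true]
    exact hc

/-! ### Counting loops -/

/-- `for i := 0, …, N - 1 do c`, for scalars `i` and `N`. -/
def forUp (i N : ℕ) (c : Program ι) : Program ι :=
  .seq (.assign i (.lit 0)) (.whileDo (.sub (.var N) (.var i))
    (.seq c (.assign i (.add (.var i) (.lit 1)))))

theorem lt_two_pow_of_le {i B : ℕ} (h : i ≤ B) : i < 2 ^ B :=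
  lt_of_le_of_lt h Nat.lt_two_pow_self

theorem Expects.forUp {X : Store → ℝ≥0∞} {ε : ℝ≥0∞} {i N n : ℕ} {J : ℕ → Store → ℝ≥0∞}
    (hN : s.num N = n) (hNi : N ≠ i) (hnB : n ≤ B) (hcN : c.writesNum N = false)
    (hci : c.writesNum i = false) (h0 : J 0 (s.setNum i 0) ≤ ε)
    (hJ : ∀ j s', j < n → (Program.forUp i N c).Frame s s' → s'.num i = j →
      c.Expects O B s' (fun s'' => J (j + 1) (s''.setNum i (j + 1))) (J j s'))
    (hX : ∀ s', (Program.forUp i N c).Frame s s' → s'.num i = n → X s' ≤ J n s') :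
    (Program.forUp i N c).Expects O B s X ε := by
  classical
  have hfN : (Program.forUp i N c).writesNum N = false := by
    simp [Program.forUp, writesNum, hcN, hNi.symm]
  refine Expects.seq (Y := fun s' => if s' = s.setNum i 0 then ε else ⊤)
    (expects_assign (by simp [Expr.eval]) (by simp [Expr.eval])) fun s₁ hf₁ => ?_
  split_ifs with h1
  swap
  · exact Expects.top _
  -- The number of remaining rounds is tied to the counter by `i + r = n`; all other states get the
  -- value `∞`.
  have hw := Expects.whileDo (O := O) (B := B) (s := s₁) (c := Program.seq c (.assign i (.add (.var i) (.lit 1))))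
    (e := .sub (.var N) (.var i)) (X := X)
    (J := fun r s' => if s'.num i + r = n then J (s'.num i) s' else ⊤) (r := n) ?_ hnB
  · refine Expects.mono hw (fun _ _ => le_rfl) ?_
    subst h1
    simpa using h0
  · intro r s' hf htop
    have hlt : s'.num i + r = n := by
      by_contra h'
      simp [h'] at htop
    have hF : (Program.forUp i N c).Frame s s' := hf₁.trans hf
      (by simp [Program.forUp, writesNum]) (by simp [Program.forUp, writesArr])
    have hN' : s'.num N = n := by rw [hF.1 N hfN, hN]
    simp only [Expr.eval, hN', hlt, if_true]
    refine ⟨fun h => ?_, fun h => ?_⟩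
    · have hi : s'.num i = n := by omega
      rw [hi]
      exact hX s' hF hi
    · refine ⟨r - 1, by omega, ?_⟩
      refine Expects.seq (hJ (s'.num i) s' (by omega) hF rfl) fun s₂ hf₂ => ?_
      have hi : s₂.num i = s'.num i := hf₂.1 i hci
      refine expects_assign (lt_two_pow_of_le ?_) ?_
      · simp only [Expr.eval]; omega
      · simp only [Expr.eval, Store.setNum_num, if_true, hi]
        rw [if_pos (by omega)]

theorem Ensures.forUp {Q : Store → Prop} {i N n : ℕ} {I : ℕ → Store → Prop}
    (hN : s.num N = n) (hNi : N ≠ i) (hnB : n ≤ B) (hcN : c.writesNum N = false)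
    (hci : c.writesNum i = false) (h0 : I 0 (s.setNum i 0))
    (hI : ∀ j s', j < n → (Program.forUp i N c).Frame s s' → s'.num i = j → I j s' →
      c.Ensures O B s' (fun s'' => I (j + 1) (s''.setNum i (j + 1))))
    (hQ : ∀ s', (Program.forUp i N c).Frame s s' → s'.num i = n → I n s' → Q s') :
    (Program.forUp i N c).Ensures O B s Q := by
  classical
  refine Expects.forUp (J := fun j s' => if I j s' then 0 else ⊤) hN hNi hnB hcN hci
    (by simp [h0]) (fun j s' hj hf hi => ?_) fun s' hf hi => ?_
  · split_ifs with h
    · exact hI j s' hj hf hi h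
    · exact Expects.top _
  · by_cases h : I n s'
    · simp [hQ s' hf hi h]
    · simp [h]

/-! ### Consequences for the frozen notions of success -/

/-- A finite expectation cannot give the weight `∞` to an outcome of positive probability, so every
possible outcome respects the time bound. -/
theorem Expects.achieves {X : Store → ℝ≥0∞} {ε : ℝ≥0∞} (h : c.Expects O B s X ε) (hε : ε ≠ ⊤)
    (hs : s.Bounded B) {T : ℕ} (hT : c.time.eval B ≤ T) {Q : Store → Prop}
    (hX : ∀ s', X s' ≠ ⊤ → Q s') : c.Achieves O T s Q := by
  intro o ho
  have h1 : c.weight (c.time.eval B) B T s X o ≠ ⊤ := by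
    have h2 := ENNReal.ne_top_of_tsum_ne_top (ne_top_of_le_ne_top hε (h hs T hT)) o
    intro h3
    rw [h3, ENNReal.mul_top ((PMF.mem_support_iff _ _).1 ho)] at h2
    exact h2 rfl
  rcases o with _ | ⟨s', t'⟩
  · exact absurd rfl h1
  · refine ⟨s', t', rfl, hX s' ?_⟩
    rw [weight_some] at h1
    split_ifs at h1 with h2
    · exact h1
    · exact absurd rfl h1

theorem Ensures.achieves {Q : Store → Prop} (h : c.Ensures O B s Q) (hs : s.Bounded B) {T : ℕ}
    (hT : c.time.eval B ≤ T) : c.Achieves O T s Q := by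
  refine Expects.achieves h (by simp) hs hT fun s' hs' => ?_
  by_contra hQ
  simp [hQ] at hs'

/-- Markov's inequality in its simplest form: the weight dominates the indicator of failure. -/
theorem Expects.failure_le {X : Store → ℝ≥0∞} {ε : ℝ≥0∞} (h : c.Expects O B s X ε)
    (hs : s.Bounded B) {T : ℕ} (hT : c.time.eval B ≤ T) {Q : Store → Prop}
    (hX : ∀ s', ¬ Q s' → 1 ≤ X s') : c.failure O T s Q ≤ ε := by
  classical
  rw [failure, ← expect_indicator]
  refine (expect_mono _ ?_).trans (h hs T hT)
  rintro (_ | ⟨s', t'⟩) -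
  · exact le_top
  · by_cases hQ : Q s'
    · rw [if_neg]
      · exact zero_le
      · simp [hQ]
    · rw [weight_some]
      split_ifs
      all_goals first | exact hX s' hQ | exact zero_le | exact le_top

end Program

end BBField

namespace BBField
open Program

infixr:60 " ⨟ " => Program.seq

variable {F : Type*} [Field F] [Fintype F] {l : ℕ}

/-! ## Encrypted elements and vectors -/

/-- The number `v` stands for a string that encrypts `a`. -/
def IsEnc (K : BlackBoxField F l) (v : ℕ) (a : F) : Prop :=
  ∃ x : BitVec l, v = x.toNat ∧ K.proj x = some a

/-- The first `n` entries of the array `w` of length `n` encrypt the values of `c`. -/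
def IsEncVec (K : BlackBoxField F l) (n : ℕ) (w : List ℕ) (c : ℕ → F) : Prop :=
  w.length = n ∧ ∀ i < n, IsEnc K (w.getD i 0) (c i)

/-- The array `w` encrypts the coefficients of a polynomial of degree less than `n` that agrees
with `u` at the roots of `g`. -/
def IsEncPoly (K : BlackBoxField F l) (n : ℕ) (g : F[X]) (w : List ℕ) (u : F → F) : Prop :=
  ∃ P : F[X], P.degree < n ∧ IsEncVec K n w P.coeff ∧ ∀ α, g.IsRoot α → P.eval α = u α

/-- The oracles `O` give access to `K`, and `B` is large enough for its strings and for
vectors of length `n`. -/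
structure Serves {ι : Type} (K : BlackBoxField F l) (j : FieldOp → ι) (O : Oracles ι)
    (B n : ℕ) : Prop where
  ops : ∀ q, O (j q) = K.ops q
  length_le : l ≤ B
  dim_le : n + 3 ≤ B
  dim_pos : 0 < n

variable {K : BlackBoxField F l} {ι : Type} {j : FieldOp → ι} {O : Oracles ι} {B n : ℕ} {s : Store}

theorem IsEnc.lt {v : ℕ} {a : F} (h : IsEnc K v a) : v < 2 ^ l := by
  obtain ⟨x, rfl, -⟩ := h
  exact x.isLt

theorem IsEnc.ofNat {v : ℕ} {a : F} (h : IsEnc K v a) : K.proj (BitVec.ofNat l v) = some a := by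
  obtain ⟨x, rfl, hx⟩ := h
  simpa using hx

theorem IsEnc.congr {v w : ℕ} {a b : F} (h : IsEnc K v a) (hv : w = v) (ha : a = b) :
    IsEnc K w b := by
  rw [hv, ← ha]; exact h

theorem IsEncVec.congr {w : List ℕ} {c c' : ℕ → F} (h : IsEncVec K n w c)
    (hc : ∀ i < n, c i = c' i) : IsEncVec K n w c' :=
  ⟨h.1, fun i hi => hc i hi ▸ h.2 i hi⟩

theorem IsEncVec.set {w : List ℕ} {c : ℕ → F} (h : IsEncVec K n w c) {i v : ℕ} {a : F}
    (hv : IsEnc K v a) : IsEncVec K n (w.set i v) (fun k => if k = i then a else c k) := by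
  refine ⟨by simpa using h.1, fun k hk => ?_⟩
  have hk' : k < w.length := h.1 ▸ hk
  have h2 := h.2 k hk
  rw [List.getD_eq_getElem _ _ hk'] at h2
  rw [List.getD_eq_getElem _ _ (by simpa using hk'), List.getElem_set]
  by_cases hik : i = k
  · simp [hik, hv]
  · simp [hik, Ne.symm hik, h2]

theorem IsEncVec.push {w : List ℕ} {c : ℕ → F} (h : IsEncVec K n w c) {v : ℕ}
    (hv : IsEnc K v (c n)) : IsEncVec K (n + 1) (w ++ [v]) c := by
  refine ⟨by simp [h.1], fun i hi => ?_⟩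
  rcases Nat.lt_succ_iff_lt_or_eq.1 hi with h1 | rfl
  · have h2 := h.2 i h1
    rwa [List.getD_append _ _ _ _ (h.1 ▸ h1)]
  · rw [List.getD_append_right _ _ _ _ h.1.le]
    simpa [h.1] using hv

theorem IsEncPoly.congr {g : F[X]} {w : List ℕ} {u u' : F → F} (h : IsEncPoly K n g w u)
    (hu : ∀ α, g.IsRoot α → u α = u' α) : IsEncPoly K n g w u' := by
  obtain ⟨P, h1, h2, h3⟩ := h
  exact ⟨P, h1, h2, fun α hα => (h3 α hα).trans (hu α hα)⟩

/-! ## Queries -/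

namespace Serves

theorem lt (hR : Serves K j O B n) {v : ℕ} (h : v < 2 ^ l) : v < 2 ^ B :=
  h.trans_le (Nat.pow_le_pow_right (by norm_num) hR.length_le)

theorem enc_lt (hR : Serves K j O B n) {v : ℕ} {a : F} (h : IsEnc K v a) : v < 2 ^ B :=
  hR.lt h.lt

theorem one_lt (hR : Serves K j O B n) : 1 < 2 ^ B :=
  Nat.one_lt_two_pow (by have := hR.dim_le; omega)

theorem query_add (hR : Serves K j O B n) {x : ℕ} {e₁ e₂ : Expr} {a b : F} {Q : Store → Prop}
    (h₁ : IsEnc K (e₁.eval s) a) (h₂ : IsEnc K (e₂.eval s) b)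
    (hQ : ∀ k, IsEnc K k (a + b) → Q (s.setNum x k)) :
    (query (j .add) x e₁ e₂).Ensures O B s Q := by
  refine Ensures.query fun k hk => ?_
  rw [hR.ops] at hk
  obtain ⟨z, hz, rfl⟩ := (PMF.mem_support_map_iff _ _ _).1 hk
  have hz' : IsEnc K z.toNat (a + b) := ⟨z, rfl, K.add_spec _ _ _ _ h₁.ofNat h₂.ofNat z hz⟩
  exact ⟨hR.enc_lt hz', hQ _ hz'⟩

/-- The operands need not be known to be cryptoelements. This keeps the program within its bounds in
runs where the search has failed and meaningless strings are multiplied. -/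
theorem query_mul' (hR : Serves K j O B n) {x : ℕ} {e₁ e₂ : Expr} {Q : Store → Prop}
    (hQ : ∀ k, k < 2 ^ l → (∀ a b, IsEnc K (e₁.eval s) a → IsEnc K (e₂.eval s) b →
      IsEnc K k (a * b)) → Q (s.setNum x k)) :
    (query (j .mul) x e₁ e₂).Ensures O B s Q := by
  refine Ensures.query fun k hk => ?_
  rw [hR.ops] at hk
  obtain ⟨z, hz, rfl⟩ := (PMF.mem_support_map_iff _ _ _).1 hk
  exact ⟨hR.lt z.isLt, hQ _ z.isLt fun a b ha hb =>
    ⟨z, rfl, K.mul_spec _ _ _ _ ha.ofNat hb.ofNat z hz⟩⟩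

theorem query_mul (hR : Serves K j O B n) {x : ℕ} {e₁ e₂ : Expr} {a b : F} {Q : Store → Prop}
    (h₁ : IsEnc K (e₁.eval s) a) (h₂ : IsEnc K (e₂.eval s) b)
    (hQ : ∀ k, IsEnc K k (a * b) → Q (s.setNum x k)) :
    (query (j .mul) x e₁ e₂).Ensures O B s Q :=
  hR.query_mul' fun k _ h => hQ k (h a b h₁ h₂)

theorem query_inv (hR : Serves K j O B n) {x : ℕ} {e₁ e₂ : Expr} {Q : Store → Prop}
    (hQ : ∀ k, k < 2 ^ l → (∀ a, IsEnc K (e₁.eval s) a → a ≠ 0 → IsEnc K k a⁻¹) →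
      Q (s.setNum x k)) :
    (query (j .inv) x e₁ e₂).Ensures O B s Q := by
  refine Ensures.query fun k hk => ?_
  rw [hR.ops] at hk
  obtain ⟨z, hz, rfl⟩ := (PMF.mem_support_map_iff _ _ _).1 hk
  exact ⟨hR.lt z.isLt, hQ _ z.isLt fun a ha h0 => ⟨z, rfl, K.inv_spec _ _ ha.ofNat h0 z hz⟩⟩

open Classical in
theorem query_eq (hR : Serves K j O B n) {x : ℕ} {e₁ e₂ : Expr} {a b : F} {Q : Store → Prop}
    (h₁ : IsEnc K (e₁.eval s) a) (h₂ : IsEnc K (e₂.eval s) b)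
    (hQ : Q (s.setNum x (if a = b then 1 else 0))) :
    (query (j .eq) x e₁ e₂).Ensures O B s Q := by
  refine Ensures.query fun k hk => ?_
  rw [hR.ops] at hk
  obtain ⟨v, hv, rfl⟩ := (PMF.mem_support_map_iff _ _ _).1 hk
  have h := K.eq_spec _ _ _ _ h₁.ofNat h₂.ofNat v hv
  have hv' : v.toNat = if a = b then 1 else 0 := by
    by_cases hab : a = b
    · simp [h.2 hab, hab]
    · have : v = false := by simpa [hab] using h
      simp [this, hab]
  rw [hv']
  refine ⟨?_, hQ⟩
  have := hR.one_lt
  split_ifs <;> omega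

end Serves

/-! ## Repeated squaring in `K` -/

/-- Combine scalar `10` with the `m`-fold iterate of scalar `11`, for `m` in scalar `12`. -/
def binLoop (j : FieldOp → ι) (q : FieldOp) : Program ι :=
  .whileDo (.var 12)
    (.ite (.mod (.var 12) (.lit 2)) (.query (j q) 10 (.var 10) (.var 11)) .skip ⨟
      .query (j q) 11 (.var 11) (.var 11) ⨟
      .assign 12 (.div (.var 12) (.lit 2)))

/-- Binary expansion, once for both operations: `res a b m` is `a` combined with the `m`-fold
iterate of `b`, characterized by its recursion under halving `m`. The accumulator starts at an
arbitrary `a`, so no neutral element is required. -/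
theorem binLoop_ensures {q : FieldOp} (op : F → F → F)
    (hq : ∀ (s : Store) (x : ℕ) (e₁ e₂ : Expr) (a b : F) (Q : Store → Prop),
      IsEnc K (e₁.eval s) a → IsEnc K (e₂.eval s) b →
      (∀ k, IsEnc K k (op a b) → Q (s.setNum x k)) → (query (j q) x e₁ e₂).Ensures O B s Q)
    (res : F → F → ℕ → F) (h0 : ∀ a b, res a b 0 = a)
    (h1 : ∀ a b m, m ≠ 0 → res a b m = res (if m % 2 = 0 then a else op a b) (op b b) (m / 2))
    {a b : F} (ha : IsEnc K (s.num 10) a) (hb : IsEnc K (s.num 11) b) :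
    (binLoop j q).Ensures O B s fun s' => IsEnc K (s'.num 10) (res a b (s.num 12)) := by
  refine Ensures.of_bounded fun hs => ?_
  refine Ensures.whileDo (J := fun r s' => ∃ a' b', IsEnc K (s'.num 10) a' ∧
    IsEnc K (s'.num 11) b' ∧ s'.num 12 < 2 ^ r ∧ res a' b' (s'.num 12) = res a b (s.num 12))
    ?_ le_rfl ⟨a, b, ha, hb, hs.1 12, rfl⟩
  rintro r s' hf ⟨a', b', ha', hb', hr, hres⟩
  simp only [Expr.eval]
  refine ⟨fun h => ?_, fun h => ?_⟩
  · rw [← hres, h, h0]; exact ha'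
  · have hr0 : r ≠ 0 := by
      rintro rfl
      simp at hr; omega
    obtain ⟨r, rfl⟩ := Nat.exists_eq_succ_of_ne_zero hr0
    refine ⟨r, rfl, ?_⟩
    refine Ensures.of_bounded fun hs' => ?_
    have key : ∀ v, IsEnc K v (if s'.num 12 % 2 = 0 then a' else op a' b') →
        (Program.query (j q) 11 (.var 11) (.var 11) ⨟
          .assign 12 (.div (.var 12) (.lit 2))).Ensures O B (s'.setNum 10 v) (fun s' =>
            ∃ a' b', IsEnc K (s'.num 10) a' ∧ IsEnc K (s'.num 11) b' ∧ s'.num 12 < 2 ^ r ∧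
              res a' b' (s'.num 12) = res a b (s.num 12)) := by
      intro v hv
      refine Ensures.andThen (hq _ _ _ _ b' b' _ (by simpa [Expr.eval]) (by simpa [Expr.eval])
        fun k hk => Ensures.assign ?_ ?_)
      · simp only [Expr.eval, Store.setNum_num]
        exact (Nat.div_le_self _ _).trans_lt (hs'.1 12)
      · refine ⟨_, _, by simpa using hv, by simpa using hk, ?_, ?_⟩
        · simp [Expr.eval]
          rw [pow_succ] at hr
          omega
        · simp only [Expr.eval, Store.setNum_num]
          simp only [if_true, if_neg (show (12 : ℕ) ≠ 11 by decide),
            if_neg (show (12 : ℕ) ≠ 10 by decide)]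
          rw [← h1 _ _ _ h, hres]
    refine Ensures.andThen (Ensures.ite (fun h2 => ?_) fun h2 => ?_)
    · refine hq _ _ _ _ a' b' _ ha' hb' fun k hk => key k ?_
      rw [if_neg (by simpa [Expr.eval] using h2)]
      exact hk
    · have hself : s'.setNum 10 (s'.num 10) = s' := by
        simp [Store.setNum]
      refine Ensures.skip ?_
      have := key (s'.num 10) (by
        rw [if_pos (by simpa [Expr.eval] using h2)]
        exact ha')
      rwa [hself] at this

theorem binLoop_add (hR : Serves K j O B n) {a b : F} (ha : IsEnc K (s.num 10) a)
    (hb : IsEnc K (s.num 11) b) :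
    (binLoop j .add).Ensures O B s fun s' => IsEnc K (s'.num 10) (a + (s.num 12 : F) * b) := by
  refine binLoop_ensures (· + ·) (fun s x e₁ e₂ a b Q => hR.query_add)
    (fun a b m => a + (m : F) * b) (by simp) (fun a b m _ => ?_) ha hb
  have h := congrArg (Nat.cast : ℕ → F) (Nat.mod_add_div m 2).symm
  rw [Nat.cast_add, Nat.cast_mul] at h
  rcases Nat.mod_two_eq_zero_or_one m with h2 | h2 <;> rw [h, h2] <;> simp <;> ring

theorem binLoop_mul (hR : Serves K j O B n) {a b : F} (ha : IsEnc K (s.num 10) a)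
    (hb : IsEnc K (s.num 11) b) :
    (binLoop j .mul).Ensures O B s fun s' => IsEnc K (s'.num 10) (a * b ^ s.num 12) := by
  refine binLoop_ensures (· * ·) (fun s x e₁ e₂ a b Q => hR.query_mul)
    (fun a b m => a * b ^ m) (by simp) (fun a b m _ => ?_) ha hb
  have h : m = m % 2 + 2 * (m / 2) := (Nat.mod_add_div m 2).symm
  conv_lhs => rw [h]
  rcases Nat.mod_two_eq_zero_or_one m with h2 | h2 <;> rw [h2, pow_add, pow_mul, sq] <;>
    simp [mul_assoc]

/-! ## Arithmetic of polynomials modulo `g`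

The scalars `3`, `5`, `6` hold the degree `n` of `g` and encryptions of `0`, `1`; the array `10`
encrypts the negatives of the coefficients of `g`. -/

/-- The memory contains the constants used in the arithmetic modulo `g`. -/
structure HasModulus (K : BlackBoxField F l) (n : ℕ) (g : F[X]) (s : Store) : Prop where
  dim : s.num 3 = n
  zero : IsEnc K (s.num 5) 0
  one : IsEnc K (s.num 6) 1
  coeff : IsEncVec K n (s.arr 10) fun i => - g.coeff i

theorem HasModulus.frame {g : F[X]} (h : HasModulus K n g s) {c : Program ι} {s' : Store}
    (hf : c.Frame s s') (h3 : c.writesNum 3 = false) (h5 : c.writesNum 5 = false)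
    (h6 : c.writesNum 6 = false) (h10 : c.writesArr 10 = false) : HasModulus K n g s' := by
  obtain ⟨a, b, c, d⟩ := h
  rw [← hf.1 3 h3] at a
  rw [← hf.1 5 h5] at b
  rw [← hf.1 6 h6] at c
  rw [← hf.2 10 h10] at d
  exact ⟨a, b, c, d⟩

theorem HasModulus.setNum {g : F[X]} (h : HasModulus K n g s) {x k : ℕ}
    (hx : x ≠ 3 ∧ x ≠ 5 ∧ x ≠ 6) : HasModulus K n g (s.setNum x k) := by
  obtain ⟨a, b, c, d⟩ := h
  refine ⟨?_, ?_, ?_, d⟩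
  · rw [Store.setNum_num, if_neg hx.1.symm]; exact a
  · rw [Store.setNum_num, if_neg hx.2.1.symm]; exact b
  · rw [Store.setNum_num, if_neg hx.2.2.symm]; exact c

/-- Fill the array `d` with `n` encryptions of `0`. -/
def zeros (d : ℕ) : Program ι := .clear d ⨟ forUp 13 3 (.push d (.var 5))

/-- Add the array `a` to the array `d`. -/
def addInto (j : FieldOp → ι) (d a : ℕ) : Program ι :=
  forUp 13 3 (.query (j .add) 8 (.get d (.var 13)) (.get a (.var 13)) ⨟ .put d (.var 13) (.var 8))

/-- Copy the array `a` to the array `d`. -/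
def copyInto (j : FieldOp → ι) (d a : ℕ) : Program ι := zeros d ⨟ addInto j d a

/-- Replace the polynomial `d` by `X * d + c * b`, where `c` is in scalar `25`. -/
def shiftAdd (j : FieldOp → ι) (d b : ℕ) : Program ι :=
  .assign 20 (.get d (.sub (.var 3) (.lit 1))) ⨟ .assign 21 (.var 5) ⨟ forUp 13 3
    (.query (j .mul) 23 (.var 20) (.get 10 (.var 13)) ⨟
      .query (j .mul) 24 (.var 25) (.get b (.var 13)) ⨟
      .query (j .add) 23 (.var 23) (.var 24) ⨟
      .query (j .add) 23 (.var 23) (.var 21) ⨟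
      .assign 21 (.get d (.var 13)) ⨟
      .put d (.var 13) (.var 23))

/-- Store the product of the polynomials `a` and `b` in `d`. -/
def mulInto (j : FieldOp → ι) (d a b : ℕ) : Program ι :=
  zeros d ⨟ forUp 14 3
    (.assign 25 (.get a (.sub (.sub (.var 3) (.lit 1)) (.var 14))) ⨟ shiftAdd j d b)

theorem zeros_ensures (hR : Serves K j O B n) {d : ℕ} (h3 : s.num 3 = n)
    (h5 : IsEnc K (s.num 5) 0) :
    (zeros d).Ensures O B s fun s' => IsEncVec K n (s'.arr d) 0 := by
  have := hR.dim_le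
  refine Ensures.andThen (Ensures.clear (Ensures.forUp (n := n)
    (I := fun i s' => IsEncVec K i (s'.arr d) 0) (by simpa) (by decide) (by omega) rfl rfl ?_ ?_
    fun _ _ _ h => h))
  · simp [IsEncVec]
  · intro i s' hi hf hi' h
    have h5' : IsEnc K (s'.num 5) 0 := by rw [hf.1 5 rfl]; simpa using h5
    refine Ensures.push (hR.enc_lt h5') (by rw [h.1]; omega) ?_
    simpa [Expr.eval] using h.push h5'

theorem zeros_poly (hR : Serves K j O B n) {d : ℕ} {g : F[X]} (h3 : s.num 3 = n)
    (h5 : IsEnc K (s.num 5) 0) :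
    (zeros d).Ensures O B s fun s' => IsEncPoly K n g (s'.arr d) 0 :=
  (zeros_ensures hR h3 h5).mono fun _ _ h =>
    ⟨0, by simp, h.congr (by simp), by simp⟩

theorem addInto_ensures (hR : Serves K j O B n) {d a : ℕ} (hda : d ≠ a) {c c' : ℕ → F}
    (h3 : s.num 3 = n) (hd : IsEncVec K n (s.arr d) c) (ha : IsEncVec K n (s.arr a) c') :
    (addInto j d a).Ensures O B s fun s' => IsEncVec K n (s'.arr d) fun i => c i + c' i := by
  have := hR.dim_le
  refine Ensures.forUp (n := n)
    (I := fun i s' => IsEncVec K n (s'.arr d) fun k => if k < i then c k + c' k else c k)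
    h3 (by decide) (by omega) rfl rfl (by simpa) ?_
    fun _ _ _ h => h.congr fun i hi => by simp [hi]
  intro i s' hi hf hi' h
  have ha' : IsEncVec K n (s'.arr a) c' := by
    rw [hf.2 a (by simp [forUp, writesArr, hda])]; exact ha
  have h1 := h.2 i hi
  simp only [lt_irrefl, if_false] at h1
  refine Ensures.andThen (hR.query_add (by simpa [Expr.eval, hi'] using h1)
    (by simpa [Expr.eval, hi'] using ha'.2 i hi) fun k hk =>
      Ensures.put (by simpa [Expr.eval] using hR.enc_lt hk) ?_)
  simp only [Expr.eval, Store.setNum_num, Store.setNum_arr, Store.setArr_arr, if_true, hi',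
    if_neg (show (13 : ℕ) ≠ 8 by decide)]
  refine (h.set hk).congr fun k hk => ?_
  rcases lt_trichotomy k i with h2 | rfl | h2
  · simp [h2, h2.ne, h2.trans (Nat.lt_succ_self i)]
  · simp
  · simp [h2.ne', show ¬ k < i by omega, show ¬ k < i + 1 by omega]

theorem addInto_poly (hR : Serves K j O B n) {d a : ℕ} (hda : d ≠ a) {g : F[X]} {u v : F → F}
    (h3 : s.num 3 = n) (hd : IsEncPoly K n g (s.arr d) u) (ha : IsEncPoly K n g (s.arr a) v) :
    (addInto j d a).Ensures O B s fun s' => IsEncPoly K n g (s'.arr d) (u + v) := by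
  obtain ⟨P, hP, hd, hu⟩ := hd
  obtain ⟨Q, hQ, ha, hv⟩ := ha
  refine (addInto_ensures hR hda h3 hd ha).mono fun _ _ h => ⟨P + Q, ?_, h.congr (by simp), ?_⟩
  · exact (degree_add_le _ _).trans_lt (max_lt hP hQ)
  · intro α hα
    simp [hu α hα, hv α hα]

theorem copyInto_poly (hR : Serves K j O B n) {d a : ℕ} (hda : d ≠ a) {g : F[X]} {u : F → F}
    (h3 : s.num 3 = n) (h5 : IsEnc K (s.num 5) 0) (ha : IsEncPoly K n g (s.arr a) u) :
    (copyInto j d a).Ensures O B s fun s' => IsEncPoly K n g (s'.arr d) u := by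
  refine (zeros_poly hR (g := g) h3 h5).seq fun s' hf h => ?_
  refine (addInto_poly hR hda (by rw [hf.1 3 rfl, h3]) h (by
    rw [hf.2 a (by simp [zeros, forUp, writesArr, hda])]; exact ha)).mono fun _ _ h' => ?_
  simpa using h'

/-- Multiplication by `X` produces at most one coefficient of degree `n`, which is removed by
subtracting a multiple of the monic `g`. That multiple vanishes at the roots, so values there are
unaffected. -/
theorem shiftAdd_poly (hR : Serves K j O B n) {d b : ℕ} (hdb : d ≠ b) (hd10 : d ≠ 10)
    {g : F[X]} (hg : g.Monic) (hgn : g.natDegree = n) {u v : F → F} {c : F}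
    (hm : HasModulus K n g s) (hd : IsEncPoly K n g (s.arr d) u)
    (hb : IsEncPoly K n g (s.arr b) v) (hc : IsEnc K (s.num 25) c) :
    (shiftAdd j d b).Ensures O B s fun s' =>
      IsEncPoly K n g (s'.arr d) fun α => u α * α + c * v α := by
  have hnB := hR.dim_le
  have hn := hR.dim_pos
  obtain ⟨P, hP, hd, hu⟩ := hd
  obtain ⟨Q, hQ, hb, hv⟩ := hb
  have hP' := (degree_lt_iff_coeff_zero _ _).1 hP
  have hQ' := (degree_lt_iff_coeff_zero _ _).1 hQ
  set R : F[X] := X * P - C (P.coeff (n - 1)) * g + C c * Q with hRdef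
  have htop := hd.2 (n - 1) (by omega)
  have e1 : (Expr.get d (.sub (.var 3) (.lit 1))).eval s = (s.arr d).getD (n - 1) 0 := by
    simp [Expr.eval, hm.dim]
  refine Ensures.andThen (Ensures.assign (by rw [e1]; exact hR.enc_lt htop) ?_)
  rw [e1]
  refine Ensures.andThen (Ensures.assign (by simpa [Expr.eval] using hR.enc_lt hm.zero) ?_)
  -- The update is in place: scalar `21` saves the old coefficient of index `i - 1`, already
  -- overwritten, and for `i = 0` it is the initial `0`.
  refine Ensures.forUp (n := n) (I := fun i s' => IsEnc K (s'.num 21) ((X * P).coeff i) ∧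
    IsEncVec K n (s'.arr d) fun k => if k < i then R.coeff k else P.coeff k)
    (by simp [hm.dim]) (by decide) (by omega) rfl rfl ?_ ?_ ?_
  · refine ⟨by simpa [Expr.eval] using hm.zero, by simpa using hd⟩
  · rintro i s' hi hf hi' ⟨hcar, hvec⟩
    have h20 : IsEnc K (s'.num 20) (P.coeff (n - 1)) := by
      rw [hf.1 20 rfl]; simpa [Expr.eval] using htop
    have h25 : IsEnc K (s'.num 25) c := by
      rw [hf.1 25 rfl]; simpa [Expr.eval] using hc
    have h10 : IsEnc K ((s'.arr 10).getD i 0) (- g.coeff i) := by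
      rw [hf.2 10 (by simp [forUp, writesArr, hd10])]
      simpa using hm.coeff.2 i hi
    have hbi : IsEnc K ((s'.arr b).getD i 0) (Q.coeff i) := by
      rw [hf.2 b (by simp [forUp, writesArr, hdb])]
      simpa using hb.2 i hi
    have hdi : IsEnc K ((s'.arr d).getD i 0) (P.coeff i) := by simpa using hvec.2 i hi
    refine Ensures.andThen (hR.query_mul (by simpa [Expr.eval] using h20)
      (by simpa [Expr.eval, hi'] using h10) fun k₁ hk₁ => ?_)
    refine Ensures.andThen (hR.query_mul (by simpa [Expr.eval] using h25)
      (by simpa [Expr.eval, hi'] using hbi) fun k₂ hk₂ => ?_)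
    refine Ensures.andThen (hR.query_add (by simpa [Expr.eval] using hk₁)
      (by simpa [Expr.eval] using hk₂) fun k₃ hk₃ => ?_)
    refine Ensures.andThen (hR.query_add (by simpa [Expr.eval] using hk₃)
      (by simpa [Expr.eval] using hcar) fun k₄ hk₄ => ?_)
    refine Ensures.andThen (Ensures.assign
      (by simpa [Expr.eval, hi'] using hR.enc_lt hdi) ?_)
    refine Ensures.put (by simpa [Expr.eval] using hR.enc_lt hk₄) ?_
    constructor
    · simpa [Expr.eval, hi', coeff_X_mul] using hdi
    · simp only [Expr.eval, Store.setNum_num, Store.setNum_arr, Store.setArr_arr, if_true, hi',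
        if_neg (show (13 : ℕ) ≠ 21 by decide), if_neg (show (13 : ℕ) ≠ 23 by decide),
        if_neg (show (13 : ℕ) ≠ 24 by decide), if_neg (show (23 : ℕ) ≠ 21 by decide)]
      refine (hvec.set hk₄).congr fun k hk => ?_
      rcases lt_trichotomy k i with h2 | rfl | h2
      · simp [h2, h2.ne, h2.trans (Nat.lt_succ_self i)]
      · simp [hRdef]; ring
      · simp [h2.ne', show ¬ k < i by omega, show ¬ k < i + 1 by omega]
  · rintro s' - - ⟨-, hvec⟩
    refine ⟨R, ?_, hvec.congr fun i hi => by simp [hi], fun α hα => ?_⟩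
    · rw [degree_lt_iff_coeff_zero]
      intro m hm'
      -- In degree `n` the top coefficient of `P` cancels against the leading coefficient of `g`;
      -- above it every summand vanishes.
      obtain ⟨m, rfl⟩ : ∃ m', m = m' + 1 := ⟨m - 1, by omega⟩
      rw [hRdef, coeff_add, coeff_sub, coeff_X_mul, coeff_C_mul, coeff_C_mul, hQ' _ hm']
      rcases hm'.eq_or_lt with h | h
      · have : g.coeff (m + 1) = 1 := by rw [← h, ← hgn]; exact hg.coeff_natDegree
        rw [this, show n - 1 = m by omega]; ring
      · rw [hP' m (by omega), coeff_eq_zero_of_natDegree_lt (p := g) (by omega)]; ring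
    · have : eval α g = 0 := hα
      simp [hRdef, this, hu α hα, hv α hα, mul_comm]

/-! ### Horner's scheme and multiplication modulo `g` -/

/-- The partial results of Horner's scheme for the polynomial with coefficients
`c 0, …, c (n - 1)`. -/
def horner {R : Type*} [CommSemiring R] (c : ℕ → R) (n : ℕ) (α : R) : ℕ → R
  | 0 => 0
  | i + 1 => horner c n α i * α + c (n - 1 - i)

theorem horner_eq_sum {R : Type*} [CommSemiring R] (c : ℕ → R) (n : ℕ) (α : R) :
    horner c n α n = ∑ i ∈ Finset.range n, c i * α ^ i := by
  have key : ∀ i ≤ n, horner c n α i = ∑ k ∈ Finset.range i, c (n - i + k) * α ^ k := by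
    intro i hi
    induction i with
    | zero => simp [horner]
    | succ i ih =>
      rw [horner, ih (by omega), Finset.sum_range_succ', Finset.sum_mul]
      congr 1
      · refine Finset.sum_congr rfl fun k _ => ?_
        rw [show n - (i + 1) + (k + 1) = n - i + k by omega]; ring
      · rw [show n - 1 - i = n - (i + 1) + 0 by omega]; simp
  simpa using key n le_rfl

theorem horner_coeff {R : Type*} [CommSemiring R] {P : R[X]} (hP : P.degree < n) (α : R) :
    horner P.coeff n α n = P.eval α := by
  rw [horner_eq_sum]
  by_cases h0 : P = 0
  · simp [h0]
  · rw [eval_eq_sum_range' ((natDegree_lt_iff_degree_lt h0).2 hP)]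

/-- Horner's scheme in the variable `X` with coefficients taken from `a`: each round is one
`shiftAdd`. At a root `α` the accumulator has the value of the partial Horner sum times `v α`. -/
theorem mulInto_poly (hR : Serves K j O B n) {d a b : ℕ} (hda : d ≠ a) (hdb : d ≠ b)
    (hd10 : d ≠ 10) {g : F[X]} (hg : g.Monic) (hgn : g.natDegree = n) {u v : F → F}
    (hm : HasModulus K n g s) (ha : IsEncPoly K n g (s.arr a) u)
    (hb : IsEncPoly K n g (s.arr b) v) :
    (mulInto j d a b).Ensures O B s fun s' => IsEncPoly K n g (s'.arr d) (u * v) := by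
  have hnB := hR.dim_le
  have hn := hR.dim_pos
  refine (zeros_poly hR (g := g) hm.dim hm.zero).seq fun s₁ hf₁ h₁ => ?_
  have hm₁ : HasModulus K n g s₁ := hm.frame hf₁ rfl rfl rfl
    (by simp [zeros, forUp, writesArr, hd10])
  rw [← hf₁.2 a (by simp [zeros, forUp, writesArr, hda])] at ha
  rw [← hf₁.2 b (by simp [zeros, forUp, writesArr, hdb])] at hb
  obtain ⟨P, hP, ha, hu⟩ := ha
  refine Ensures.forUp (n := n) (I := fun i s' => IsEncPoly K n g (s'.arr d)
    fun α => horner P.coeff n α i * v α) hm₁.dim (by decide) (by omega) rfl rfl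
    (h₁.congr (by simp [horner])) ?_ ?_
  · intro i s' hi hf hi' h
    have hm' : HasModulus K n g s' := hm₁.frame hf rfl rfl rfl
      (by simp [shiftAdd, forUp, writesArr, hd10])
    have ha' : IsEnc K ((s'.arr a).getD (n - 1 - i) 0) (P.coeff (n - 1 - i)) := by
      rw [hf.2 a (by simp [shiftAdd, forUp, writesArr, hda])]
      exact ha.2 _ (by omega)
    have e1 : (Expr.get a (.sub (.sub (.var 3) (.lit 1)) (.var 14))).eval s' =
        (s'.arr a).getD (n - 1 - i) 0 := by simp [Expr.eval, hm'.dim, hi']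
    refine Ensures.andThen (Ensures.assign (by rw [e1]; exact hR.enc_lt ha') ?_)
    rw [e1]
    refine (shiftAdd_poly hR hdb hd10 hg hgn (hm'.setNum (by decide)) h (b := b)
      (s := s'.setNum 25 ((s'.arr a).getD (n - 1 - i) 0)) (v := v) (c := P.coeff (n - 1 - i)) ?_ (ha'.congr (by simp) rfl)).mono fun s'' _ h'' => ?_
    · rw [Store.setNum_arr, hf.2 b (by simp [shiftAdd, forUp, writesArr, hdb])]
      exact hb
    · refine IsEncPoly.congr (by simpa using h'') fun α hα => ?_
      rw [horner]; ring
  · intro s' _ _ h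
    refine h.congr fun α hα => ?_
    rw [horner_coeff hP, hu α hα]; rfl

end BBField

namespace BBField
open Program

variable {F : Type*} [Field F] [Fintype F] {l : ℕ}

/-! ## Finite fields given by a polynomial -/

section Algebra

variable {p : ℕ} [Fact p.Prime] {f : (ZMod p)[X]}

theorem charP_of_card {n : ℕ} (hcard : Fintype.card F = p ^ n) : CharP F p := by
  obtain ⟨q, hq⟩ := CharP.exists F
  obtain ⟨m, hqp, hm⟩ := FiniteField.card F q
  rw [hcard] at hm
  have h : q ∣ p := hqp.dvd_of_dvd_pow (hm ▸ dvd_pow_self q m.ne_zero)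
  rwa [(Nat.prime_dvd_prime_iff_eq hqp Fact.out).1 h] at hq

theorem natCard_adjoinRoot (hf : f.Monic) : Nat.card (AdjoinRoot f) = p ^ f.natDegree := by
  have := (AdjoinRoot.powerBasis' hf).finite
  rw [Module.natCard_eq_pow_finrank (K := ZMod p), (AdjoinRoot.powerBasis' hf).finrank,
    AdjoinRoot.powerBasis'_dim, Nat.card_zmod]

theorem finite_adjoinRoot (hf : f.Monic) : Finite (AdjoinRoot f) :=
  have := (AdjoinRoot.powerBasis' hf).finite
  Module.finite_of_finite (ZMod p)

variable [Algebra (ZMod p) F]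

theorem finrank_of_card {n : ℕ} (hcard : Fintype.card F = p ^ n) :
    Module.finrank (ZMod p) F = n := by
  have h := Module.natCard_eq_pow_finrank (K := ZMod p) (V := F)
  rw [Nat.card_eq_fintype_card, hcard, Nat.card_zmod] at h
  exact (Nat.pow_right_injective (Fact.out : p.Prime).two_le h).symm

/-- Finite fields of equal order are isomorphic, and the image of the adjoined root is a root in
`F`. -/
theorem exists_aeval_eq_zero (hf : f.Monic) (hirr : Irreducible f)
    (hcard : Fintype.card F = p ^ f.natDegree) : ∃ α : F, aeval α f = 0 := by
  have : Fact (Irreducible f) := ⟨hirr⟩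
  have := finite_adjoinRoot hf
  have := Fintype.ofFinite (AdjoinRoot f)
  have e := FiniteField.algEquivOfCardEq (K := AdjoinRoot f) (K' := F) p (by
    rw [hcard, ← natCard_adjoinRoot hf, Nat.card_eq_fintype_card])
  refine ⟨e (AdjoinRoot.root f), ?_⟩
  have h : aeval (AdjoinRoot.root f) f = 0 := by
    rw [AdjoinRoot.aeval_eq, AdjoinRoot.mk_self]
  rw [← AlgEquiv.coe_toAlgHom, aeval_algHom_apply, h, map_zero]

/-- `f` is the minimal polynomial of a root in the normal extension `F`, so it splits there;
irreducibility over a perfect field makes the roots distinct. -/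
theorem card_roots_map (hf : f.Monic) (hirr : Irreducible f)
    (hcard : Fintype.card F = p ^ f.natDegree) [DecidableEq F] :
    (f.map (algebraMap (ZMod p) F)).roots.toFinset.card = f.natDegree := by
  obtain ⟨α, hα⟩ := exists_aeval_eq_zero hf hirr hcard
  have hmin : f = minpoly (ZMod p) α := minpoly.eq_of_irreducible_of_monic hirr hα hf
  have hs : Splits (f.map (algebraMap (ZMod p) F)) := by
    rw [hmin]
    exact Normal.splits inferInstance α
  rw [Multiset.toFinset_card_of_nodup (nodup_roots (PerfectField.separable_of_irreducible hirr).map),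
    ← hs.natDegree_eq_card_roots, natDegree_map]

/-- A root of `f` in `F` defines an isomorphism. -/
theorem exists_ringEquiv (hf : f.Monic) (hirr : Irreducible f)
    (hcard : Fintype.card F = p ^ f.natDegree) {α : F} (hα : aeval α f = 0) :
    ∃ φ : AdjoinRoot f ≃+* F, ∀ h : (ZMod p)[X], φ (AdjoinRoot.mk f h) = aeval α h := by
  have : Fact (Irreducible f) := ⟨hirr⟩
  have := finite_adjoinRoot hf
  let ψ : AdjoinRoot f →+* F := AdjoinRoot.lift (algebraMap (ZMod p) F) α hα
  have hb : Function.Bijective ψ := by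
    refine (Nat.bijective_iff_injective_and_card ψ).2 ⟨ψ.injective, ?_⟩
    rw [natCard_adjoinRoot hf, Nat.card_eq_fintype_card, hcard]
  refine ⟨RingEquiv.ofBijective ψ hb, fun h => ?_⟩
  exact AdjoinRoot.lift_mk hα h

omit [Fintype F] in
theorem map_element {α : F} {φ : AdjoinRoot f ≃+* F}
    (hφ : ∀ h : (ZMod p)[X], φ (AdjoinRoot.mk f h) = aeval α h) (c : Fin f.natDegree → ZMod p) :
    φ (element f c) = ∑ i : Fin f.natDegree, algebraMap (ZMod p) F (c i) * α ^ (i : ℕ) := by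
  simp only [element, map_sum, map_mul, map_pow]
  refine Finset.sum_congr rfl fun i _ => ?_
  have h1 := hφ (C (c i))
  have h2 := hφ X
  rw [AdjoinRoot.mk_C] at h1
  rw [AdjoinRoot.mk_X] at h2
  rw [h1, h2, aeval_C, aeval_X]

/-! ### Coordinates by traces -/

/-- Coordinates are given by traces, with a multiple of the dual basis that consists of the
coefficients of a polynomial vanishing at all other conjugates of the generator. -/
theorem sum_pow_eq_coordinate (hf : f.Monic) (hirr : Irreducible f)
    (hcard : Fintype.card F = p ^ f.natDegree) {α : F} (hα : aeval α f = 0) {E : F[X]}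
    (hE : E.degree < f.natDegree) (h1 : E.eval α ≠ 0)
    (h0 : ∀ β, (f.map (algebraMap (ZMod p) F)).IsRoot β → β ≠ α → E.eval β = 0)
    (c : Fin f.natDegree → ZMod p) (i : Fin f.natDegree) :
    ∑ k ∈ Finset.range f.natDegree, ((∑ i : Fin f.natDegree,
      algebraMap (ZMod p) F (c i) * α ^ (i : ℕ)) * (E.eval α)⁻¹ * E.coeff i) ^ p ^ k =
      algebraMap (ZMod p) F (c i) := by
  classical
  set y := ∑ i : Fin f.natDegree, algebraMap (ZMod p) F (c i) * α ^ (i : ℕ) with hy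
  set w := (E.eval α)⁻¹
  have htr := FiniteField.algebraMap_trace_eq_sum_pow (ZMod p) F (y * w * E.coeff i)
  rw [finrank_of_card hcard, Nat.card_zmod, trace_eq_sum_automorphisms] at htr
  rw [← htr]
  -- The coefficient of `Q` at `i` is the trace in question, and that of `P` is the coordinate `c
  -- i`. Both polynomials have degree below `n`, so it is enough to compare them at the `n` roots of
  -- `f`.
  let Q : F[X] := ∑ τ : F ≃ₐ[ZMod p] F, C (τ (y * w)) * E.map (τ : F →+* F)
  let P : F[X] := ∑ i : Fin f.natDegree, C (algebraMap (ZMod p) F (c i)) * X ^ (i : ℕ)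
  have hmin : minpoly (ZMod p) α = f := (minpoly.eq_of_irreducible_of_monic hirr hα hf).symm
  have hQP : Q = P := by
    refine eq_of_degrees_lt_of_eval_finset_eq
      (f.map (algebraMap (ZMod p) F)).roots.toFinset ?_ ?_ ?_
    · rw [card_roots_map hf hirr hcard]
      rw [degree_lt_iff_coeff_zero]
      intro m hm
      simp only [Q, finsetSum_coeff, coeff_C_mul, coeff_map]
      refine Finset.sum_eq_zero fun τ _ => ?_
      rw [(degree_lt_iff_coeff_zero _ _).1 hE m hm, map_zero, mul_zero]
    · rw [card_roots_map hf hirr hcard, degree_lt_iff_coeff_zero]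
      intro m hm
      simp only [P, finsetSum_coeff, coeff_C_mul, coeff_X_pow]
      refine Finset.sum_eq_zero fun k _ => ?_
      rw [if_neg (by have := k.isLt; omega), mul_zero]
    · intro β hβ
      have hβr : (f.map (algebraMap (ZMod p) F)).IsRoot β := (mem_roots'.1 (Multiset.mem_toFinset.1 hβ)).2
      have hβ' : aeval β f = 0 := by
        rw [aeval_def, ← eval_map]
        exact hβr
      have hconj : IsConjRoot (ZMod p) β α := by
        rw [IsConjRoot, hmin, ← minpoly.eq_of_irreducible_of_monic hirr hβ' hf]
      obtain ⟨τ₀, rfl⟩ := (isConjRoot_iff_exists_algEquiv).1 hconj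
      -- At the root `τ₀ α`, the conjugate of `E` by `τ` vanishes unless `τ` and `τ₀` agree at `α`.
      -- As `α` generates `F`, only the summand of `τ₀` survives, and its value is `τ₀ y = P.eval
      -- (τ₀ α)`.
      have hev : ∀ τ : F ≃ₐ[ZMod p] F, eval (τ₀ α) (E.map (τ : F →+* F)) =
          τ (E.eval (τ.symm (τ₀ α))) := by
        intro τ
        have := eval_map_apply (p := E) (f := (τ : F →+* F)) (τ.symm (τ₀ α))
        simpa using this
      simp only [Q, eval_finsetSum, eval_mul, eval_C, hev]
      rw [Finset.sum_eq_single τ₀]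
      · simp only [AlgEquiv.symm_apply_apply, ← map_mul, w]
        rw [mul_assoc, inv_mul_cancel₀ h1, mul_one, hy]
        simp [P, eval_finsetSum]
      · intro τ _ hτ
        have hne : τ.symm (τ₀ α) ≠ α := by
          intro h
          apply hτ
          have h' : τ₀ α = τ α := by rw [← h, AlgEquiv.apply_symm_apply, h]
          obtain ⟨φ, hφ⟩ := exists_ringEquiv hf hirr hcard hα
          ext x
          obtain ⟨z, rfl⟩ := φ.surjective x
          obtain ⟨h, rfl⟩ := AdjoinRoot.mk_surjective z
          rw [hφ, ← AlgEquiv.coe_toAlgHom, ← AlgEquiv.coe_toAlgHom, ← aeval_algHom_apply,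
            ← aeval_algHom_apply, AlgEquiv.coe_toAlgHom, AlgEquiv.coe_toAlgHom, h']
        rw [h0 _ _ hne, map_zero, mul_zero]
        rw [IsRoot, eval_map, ← aeval_def, ← AlgEquiv.coe_toAlgHom, aeval_algHom_apply,
          AlgEquiv.coe_toAlgHom, hβ', map_zero]
      · simp
  have h2 : Q.coeff i = P.coeff i := by rw [hQP]
  simp only [Q, P, finsetSum_coeff, coeff_C_mul, coeff_map, coeff_X_pow] at h2
  rw [Finset.sum_eq_single i] at h2
  · simpa using h2
  · intro k _ hk
    simp [Fin.val_inj, hk.symm]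
  · simp

/-! ## Separation of roots -/

/-- A function with few values: a power that is the quadratic character if `p` is odd, and the
absolute trace plus one if `p = 2`. -/
def splitter (p n : ℕ) (t : F) : F :=
  if p = 2 then 1 + ∑ i ∈ Finset.range n, t ^ 2 ^ i else t ^ (p ^ n / 2)

-- In characteristic two, `splitter + 1` is the absolute trace, so `r` separates exactly when `r *
-- (α - β)` has trace one. The trace is onto, and translation by an element of trace one, divided by
-- `α - β`, injects the bad `r` into the good ones: at least half are good.
omit [Fact p.Prime] [Algebra (ZMod p) F] in
theorem card_separated_two [Algebra (ZMod 2) F] {n : ℕ} (hcard : Fintype.card F = 2 ^ n)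
    [DecidableEq F] {α β : F} (hne : α ≠ β) :
    Fintype.card F ≤ 2 * (Finset.univ.filter fun r : F =>
      ¬ (splitter 2 n (1 + r * α) + 1 = 0 ↔ splitter 2 n (1 + r * β) + 1 = 0)).card := by
  have : CharP F 2 := charP_of_card hcard
  have htr : ∀ t : F, splitter 2 n t + 1 = 0 ↔ Algebra.trace (ZMod 2) F t = 0 := by
    intro t
    have h := FiniteField.algebraMap_trace_eq_sum_pow (ZMod 2) F t
    rw [finrank_of_card hcard, Nat.card_zmod] at h
    rw [splitter, if_pos rfl, ← h, add_right_comm, CharTwo.add_self_eq_zero, zero_add,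
      map_eq_zero_iff _ (algebraMap (ZMod 2) F).injective]
  have h2 : ∀ a b : ZMod 2, ¬ (a = 0 ↔ b = 0) ↔ a - b ≠ 0 := by decide
  simp only [htr, h2, ← map_sub]
  have hd : ∀ r : F, 1 + r * α - (1 + r * β) = r * (α - β) := fun r => by ring
  simp only [hd]
  have hγ : α - β ≠ 0 := sub_ne_zero.2 hne
  obtain ⟨x, hx⟩ := Algebra.trace_surjective (ZMod 2) F 1
  have hle : (Finset.univ.filter fun r : F => ¬ Algebra.trace (ZMod 2) F (r * (α - β)) ≠ 0).card ≤
      (Finset.univ.filter fun r : F => Algebra.trace (ZMod 2) F (r * (α - β)) ≠ 0).card := by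
    refine Finset.card_le_card_of_injOn (fun r => r + x / (α - β)) ?_
      fun a _ b _ h => add_right_cancel h
    intro r hr
    simp only [Finset.coe_filter, Finset.mem_univ, true_and, not_not, Set.mem_ofPred_eq] at hr ⊢
    rw [add_mul, div_mul_cancel₀ _ hγ, map_add, hr, hx]
    decide
  have := Finset.card_filter_add_card_filter_not (s := (Finset.univ : Finset F))
    (fun r : F => Algebra.trace (ZMod 2) F (r * (α - β)) ≠ 0)
  rw [Finset.card_univ] at this
  omega

-- For a nonsquare `ν` other than `α / β`, the equation `1 + r α = ν (1 + r β)` has a solution `r`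
-- with `1 + r β` nonzero, and this `r` separates because the two quadratic characters are opposite.
-- Distinct `ν` give distinct `r`, and there are about `|F| / 2` nonsquares; the additive 3 absorbs
-- the rounding and the excluded `ν`.
omit [Algebra (ZMod p) F] in
theorem card_separated_odd {n : ℕ} (hp : p ≠ 2) (hcard : Fintype.card F = p ^ n)
    [DecidableEq F] {α β : F} (hne : α ≠ β) (hβ : β ≠ 0) :
    Fintype.card F ≤ 2 * (Finset.univ.filter fun r : F =>
      ¬ (splitter p n (1 + r * α) + 1 = 0 ↔ splitter p n (1 + r * β) + 1 = 0)).card + 3 := by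
  have : CharP F p := charP_of_card hcard
  have hchar : ringChar F ≠ 2 := by rwa [ringChar.eq F p]
  have hodd : Fintype.card F % 2 = 1 := FiniteField.odd_card_of_char_ne_two hchar
  have hS : ∀ t : F, splitter p n t = t ^ (Fintype.card F / 2) := fun t => by
    rw [splitter, if_neg hp, hcard]
  simp only [hS]
  set m := Fintype.card F / 2
  have hm0 : 0 < m := by
    have := Fintype.one_lt_card (α := F)
    omega
  set N := Finset.univ.filter fun ν : F => ν ^ m = -1
  -- The nonsquares are counted from below: everything else is `0` or one of at most `m` roots of `x
  -- ^ m = 1`.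
  have h11 : (1 : F) ≠ -1 := (Ring.neg_one_ne_one_of_char_ne_two hchar).symm
  have hN : Fintype.card F ≤ N.card + m + 1 := by
    have hsub : (Finset.univ : Finset F) ⊆
        N ∪ (nthRoots m (1 : F)).toFinset ∪ {0} := by
      intro a _
      by_cases ha : a = 0
      · simp [ha]
      · rcases FiniteField.pow_dichotomy hchar ha with h | h
        · simp [mem_nthRoots hm0, h, m]
        · simp [N, h, m]
    have h1 := Finset.card_le_card hsub
    have h2 := Finset.card_union_le (N ∪ (nthRoots m (1 : F)).toFinset) {0}
    have h3 := Finset.card_union_le N (nthRoots m (1 : F)).toFinset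
    have h4 := (Multiset.toFinset_card_le (nthRoots m (1 : F))).trans (card_nthRoots m 1)
    rw [Finset.card_univ] at h1
    rw [Finset.card_singleton] at h2
    omega
  have hN' : N.card ≤ (N.erase (α / β)).card + 1 :=
    Nat.sub_le_iff_le_add.1 Finset.pred_card_le_card_erase
  have hle : (N.erase (α / β)).card ≤ (Finset.univ.filter fun r : F =>
      ¬ ((1 + r * α) ^ m + 1 = 0 ↔ (1 + r * β) ^ m + 1 = 0)).card := by
    have hsolve : ∀ ν ∈ N.erase (α / β), 1 + (ν - 1) / (α - ν * β) * β ≠ 0 ∧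
        1 + (ν - 1) / (α - ν * β) * α = ν * (1 + (ν - 1) / (α - ν * β) * β) := by
      intro ν hν
      have hd : α - ν * β ≠ 0 := by
        intro h
        apply (Finset.mem_erase.1 hν).1
        rw [eq_div_iff hβ]
        exact (sub_eq_zero.1 h).symm
      have e1 : 1 + (ν - 1) / (α - ν * β) * β = (α - β) / (α - ν * β) := by
        field_simp; ring
      have e2 : 1 + (ν - 1) / (α - ν * β) * α = ν * ((α - β) / (α - ν * β)) := by
        field_simp; ring
      rw [e1]
      exact ⟨div_ne_zero (sub_ne_zero.2 hne) hd, e2⟩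
    refine Finset.card_le_card_of_injOn (fun ν => (ν - 1) / (α - ν * β)) ?_ ?_
    · intro ν hν
      obtain ⟨h1, h2⟩ := hsolve ν hν
      have hν1 : ν ^ m = -1 := (Finset.mem_filter.1 (Finset.mem_of_mem_erase hν)).2
      simp only [Finset.coe_filter, Finset.mem_univ, true_and, Set.mem_ofPred_eq]
      rw [h2, mul_pow, hν1]
      rcases FiniteField.pow_dichotomy hchar h1 with h | h
      · have h3 : (1 : F) + 1 ≠ 0 := fun h3 => h11 (eq_neg_of_add_eq_zero_left h3)
        simp only [m, h]
        simp [h3]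
      · have h3 : (1 : F) + 1 ≠ 0 := fun h3 => h11 (eq_neg_of_add_eq_zero_left h3)
        simp only [m, h]
        simp [h3]
    · intro ν hν ν' hν' h
      obtain ⟨h1, h2⟩ := hsolve ν hν
      obtain ⟨h1', h2'⟩ := hsolve ν' hν'
      simp only at h
      rw [← h] at h1' h2'
      exact mul_right_cancel₀ h1 (h2.symm.trans h2')
  omega

-- For odd `p` and `n ≥ 2` the field has at least 9 elements, so at least 3 elements separate and
-- the additive 3 is absorbed by raising the factor from 2 to 3.
omit [Algebra (ZMod p) F] in
theorem card_separated {n : ℕ} (hn : 2 ≤ n) (hcard : Fintype.card F = p ^ n)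
    [DecidableEq F] {α β : F} (hne : α ≠ β) (hβ : β ≠ 0) :
    Fintype.card F ≤ 3 * (Finset.univ.filter fun r : F =>
      ¬ (splitter p n (1 + r * α) + 1 = 0 ↔ splitter p n (1 + r * β) + 1 = 0)).card := by
  by_cases hp : p = 2
  · subst hp
    have : CharP F 2 := charP_of_card hcard
    let _ := ZMod.algebra F 2
    have := card_separated_two hcard hne
    omega
  · have h := card_separated_odd hp hcard hne hβ
    have h3 : 3 ≤ p := by
      have := (Fact.out : p.Prime).two_le
      omega
    have h9 : 9 ≤ p ^ n := calc
      9 = 3 ^ 2 := rfl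
      _ ≤ p ^ 2 := Nat.pow_le_pow_left h3 2
      _ ≤ p ^ n := Nat.pow_le_pow_right (by omega) hn
    omega

end Algebra

/-! ## Random elements -/

/-- The element encrypted by a string, `0` if there is none. -/
def BlackBoxField.decrypt (K : BlackBoxField F l) (x : BitVec l) : F := (K.proj x).getD 0

theorem BlackBoxField.proj_of_mem_support (K : BlackBoxField F l) {x : BitVec l}
    (hx : x ∈ K.sample.support) : K.proj x = some (K.decrypt x) := by
  obtain ⟨a, ha⟩ := K.sample_mem x hx
  simp [decrypt, ha]

/-- The sampling hypothesis turned into a bound for missing `S`, in additive form because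
subtraction in `ℝ≥0∞` truncates. -/
theorem expect_sample_add_le (K : BlackBoxField F l) [DecidableEq F] (S : Finset F) :
    expect K.sample (fun x => if K.decrypt x ∈ S then 0 else 1) +
      (S.card : ℝ≥0∞) / (Fintype.card F : ℝ≥0∞) ≤ 1 + 1 / 4 := by
  classical
  refine (add_le_add_right (K.sample_unif S) _).trans ?_
  rw [← add_assoc]
  gcongr
  rw [← expect_indicator, ← expect_add]
  refine expect_le _ fun x hx => ?_
  have hx' := K.proj_of_mem_support hx
  by_cases h : K.decrypt x ∈ S
  · rw [if_pos h, zero_add]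
    split_ifs <;> simp
  · rw [if_neg h, if_neg, add_zero]
    rintro ⟨a, ha, ha'⟩
    rw [hx'] at ha'
    exact h (Option.some.inj ha' ▸ ha)

/-- At least half of the elements are nonzero, so the bound is 1/2 plus the sampling error 1/4. -/
theorem expect_sample_zero (K : BlackBoxField F l) [DecidableEq F] :
    expect K.sample (fun x => if K.decrypt x = 0 then 1 else 0) ≤ 3 / 4 := by
  have h := expect_sample_add_le K (Finset.univ.erase 0)
  have h1 : (1 / 2 : ℝ≥0∞) ≤
      ((Finset.univ.erase (0 : F)).card : ℝ≥0∞) / (Fintype.card F : ℝ≥0∞) := by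
    have h2 := Fintype.one_lt_card (α := F)
    rw [Finset.card_erase_of_mem (Finset.mem_univ _), Finset.card_univ,
      ENNReal.le_div_iff_mul_le (by simp) (by simp), mul_comm, mul_one_div]
    refine ENNReal.div_le_of_le_mul' ?_
    norm_cast
    omega
  have h2 := (add_le_add_right h1 _).trans h
  have e : (1 : ℝ≥0∞) + 1 / 4 = 3 / 4 + 1 / 2 := by
    rw [← ENNReal.toReal_eq_toReal_iff' (by simp) (by simp [ENNReal.div_eq_top])]
    rw [ENNReal.toReal_add (by simp) (by simp), ENNReal.toReal_add (by simp [ENNReal.div_eq_top]) (by simp)]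
    norm_num
  rw [e] at h2
  have h3 := ENNReal.le_of_add_le_add_right (by simp) h2
  refine le_trans (le_of_eq ?_) h3
  congr 1
  ext x
  simp

open Classical in
/-- The set of roots that remain after a round with the random element `r`. -/
noncomputable def refineRoots (p n : ℕ) (S : Finset F) (r : F) : Finset F :=
  if ∃ α ∈ S, splitter p n (1 + r * α) + 1 ≠ 0 then
    S.filter fun α => splitter p n (1 + r * α) + 1 ≠ 0 else S

omit [Fintype F] in
theorem refineRoots_subset (p n : ℕ) (S : Finset F) (r : F) : refineRoots p n S r ⊆ S := by
  classical
  unfold refineRoots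
  split_ifs
  · exact Finset.filter_subset _ _
  · exact subset_rfl

omit [Fintype F] in
theorem refineRoots_nonempty (p n : ℕ) {S : Finset F} (hS : S.Nonempty) (r : F) :
    (refineRoots p n S r).Nonempty := by
  classical
  unfold refineRoots
  split_ifs with h
  · obtain ⟨α, h1, h2⟩ := h
    exact ⟨α, Finset.mem_filter.2 ⟨h1, h2⟩⟩
  · exact hS

omit [Fintype F] in
theorem mem_refineRoots {p n : ℕ} {S : Finset F} {r : F}
    (h : ∃ α ∈ S, splitter p n (1 + r * α) + 1 ≠ 0) (α : F) :
    α ∈ refineRoots p n S r ↔ α ∈ S ∧ splitter p n (1 + r * α) + 1 ≠ 0 := by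
  simp only [refineRoots, if_pos h, Finset.mem_filter]

-- If some root survives the filter, all that remain are on the same side; if none does, `S` is kept
-- and all its members are on the other side.
omit [Fintype F] in
theorem separated_of_mem_refineRoots {p n : ℕ} {S : Finset F} {r α β : F}
    (hα : α ∈ refineRoots p n S r) (hβ : β ∈ refineRoots p n S r) :
    splitter p n (1 + r * α) + 1 = 0 ↔ splitter p n (1 + r * β) + 1 = 0 := by
  classical
  unfold refineRoots at hα hβ
  split_ifs at hα hβ with h
  · simp [(Finset.mem_filter.1 hα).2, (Finset.mem_filter.1 hβ).2]
  · push Not at h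
    simp [h α hα, h β hβ]

-- Linearity of expectation over ordered pairs: a remaining pair was not separated, which has
-- probability at most `1 + 1/4 - 1/3 = 11/12`. A pair exists only if `n ≥ 2`, and then `0` is not a
-- root, as `card_separated` demands.
open Classical in
theorem expect_card_offDiag_le (K : BlackBoxField F l) {p n : ℕ} [Fact p.Prime]
    (hcard : Fintype.card F = p ^ n) {S : Finset F} (hS : S.card ≤ n) (h0 : 2 ≤ n → (0 : F) ∉ S) :
    expect K.sample (fun x => ((refineRoots p n S (K.decrypt x)).offDiag.card : ℝ≥0∞)) ≤
      11 / 12 * (S.offDiag.card : ℝ≥0∞) := by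
  have hle : ∀ r, ((refineRoots p n S r).offDiag.card : ℝ≥0∞) ≤
      ∑ z ∈ S.offDiag, if r ∈ Finset.univ.filter (fun r : F =>
        ¬ (splitter p n (1 + r * z.1) + 1 = 0 ↔ splitter p n (1 + r * z.2) + 1 = 0)) then 0
        else 1 := by
    intro r
    have : ((refineRoots p n S r).offDiag.card : ℝ≥0∞) =
        ∑ z ∈ (refineRoots p n S r).offDiag, (1 : ℝ≥0∞) := by simp
    rw [this]
    refine (Finset.sum_le_sum fun z hz => ?_).trans (Finset.sum_le_sum_of_subset
      (Finset.offDiag_mono (refineRoots_subset p n S r)))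
    obtain ⟨h1, h2, -⟩ := Finset.mem_offDiag.1 hz
    rw [if_neg]
    simpa using separated_of_mem_refineRoots h1 h2
  refine (expect_mono _ fun x _ => hle (K.decrypt x)).trans ?_
  rw [expect_finset_sum]
  have key : ∀ z ∈ S.offDiag, expect K.sample (fun x => if K.decrypt x ∈
      Finset.univ.filter (fun r : F => ¬ (splitter p n (1 + r * z.1) + 1 = 0 ↔
        splitter p n (1 + r * z.2) + 1 = 0)) then 0 else 1) ≤ (11 / 12 : ℝ≥0∞) := by
    intro z hz
    obtain ⟨h1, h2, hne⟩ := Finset.mem_offDiag.1 hz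
    have hn : 2 ≤ n := by
      have : 1 < S.card := Finset.one_lt_card.2 ⟨z.1, h1, z.2, h2, hne⟩
      omega
    have hz2 : z.2 ≠ 0 := fun h => h0 hn (h ▸ h2)
    have h := expect_sample_add_le K (Finset.univ.filter fun r : F =>
      ¬ (splitter p n (1 + r * z.1) + 1 = 0 ↔ splitter p n (1 + r * z.2) + 1 = 0))
    have hc := card_separated hn hcard hne hz2
    have h3 : (1 / 3 : ℝ≥0∞) ≤ ((Finset.univ.filter fun r : F =>
      ¬ (splitter p n (1 + r * z.1) + 1 = 0 ↔ splitter p n (1 + r * z.2) + 1 = 0)).card : ℝ≥0∞) /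
        (Fintype.card F : ℝ≥0∞) := by
      rw [ENNReal.le_div_iff_mul_le (by simp) (by simp), mul_comm, mul_one_div]
      refine ENNReal.div_le_of_le_mul' ?_
      norm_cast
    have h4 := (add_le_add_right h3 _).trans h
    have e : (1 : ℝ≥0∞) + 1 / 4 = 11 / 12 + 1 / 3 := by
      rw [← ENNReal.toReal_eq_toReal_iff' (by simp) (by simp [ENNReal.div_eq_top])]
      rw [ENNReal.toReal_add (by simp) (by simp),
        ENNReal.toReal_add (by simp [ENNReal.div_eq_top]) (by simp)]
      norm_num
    rw [e] at h4
    exact ENNReal.le_of_add_le_add_right (by simp) h4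
  refine (Finset.sum_le_sum key).trans ?_
  rw [Finset.sum_const, nsmul_eq_mul, mul_comm]

end BBField

namespace BBField
open Program

variable {F : Type*} [Field F] [Fintype F] {l : ℕ}

/-! ## Evaluating the isomorphisms -/

/-- The entries of a key: `0`, `1`, a root of `f`, and the coefficients of a polynomial. -/
def keyEntry (α : F) (E : F[X]) : ℕ → F
  | 0 => 0
  | 1 => 1
  | 2 => α
  | i + 3 => E.coeff i

/-- The array `w` encrypts a root `α` of `g` and a polynomial that vanishes at all other
roots. -/
structure IsKey (K : BlackBoxField F l) (n : ℕ) (g : F[X]) (w : List ℕ) (α : F) (E : F[X]) :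
    Prop where
  root : g.IsRoot α
  degree_lt : E.degree < n
  eval_ne : E.eval α ≠ 0
  eval_eq : ∀ β, g.IsRoot β → β ≠ α → E.eval β = 0
  enc : IsEncVec K (n + 3) w (keyEntry α E)

variable {K : BlackBoxField F l} {ι : Type} {j : FieldOp → ι} {O : Oracles ι} {B n : ℕ} {s : Store}

theorem Store.Bounded.getD_lt (hs : s.Bounded B) (a i : ℕ) : (s.arr a).getD i 0 < 2 ^ B := by
  by_cases hlt : i < (s.arr a).length
  · rw [List.getD_eq_getElem _ _ hlt]
    exact (hs.2 a).2 _ (List.getElem_mem _)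
  · rw [List.getD_eq_default _ _ (not_lt.1 hlt)]
    positivity

/-- Load the degree and the first three entries of the key. -/
def loadKey : Program ι :=
  .assign 3 (.sub (.len 0) (.lit 1)) ⨟ .assign 5 (.get 1 (.lit 0)) ⨟
    .assign 6 (.get 1 (.lit 1)) ⨟ .assign 19 (.get 1 (.lit 2))

/-- Encrypt the element with coordinates in array `2`. -/
def encode : Program FieldOp :=
  loadKey ⨟ .assign 20 (.var 5) ⨟
    forUp 15 3 (.query .mul 10 (.var 20) (.var 19) ⨟ .assign 11 (.var 6) ⨟
      .assign 12 (.get 2 (.sub (.sub (.var 3) (.lit 1)) (.var 15))) ⨟ binLoop id .add ⨟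
      .assign 20 (.var 10)) ⨟
    .assign 0 (.var 20)

/-- Append to array `0` the image under `δ` of the trace of the product of scalar `7` with an
entry of the key. -/
def decodeDigit : Program (FieldOp ⊕ Unit) :=
  .query (.inl .mul) 20 (.var 7) (.get 1 (.add (.var 15) (.lit 3))) ⨟ .assign 21 (.var 5) ⨟
    forUp 14 3 (.query (.inl .add) 21 (.var 21) (.var 20) ⨟ .assign 10 (.var 6) ⨟
      .assign 11 (.var 20) ⨟ .assign 12 (.var 0) ⨟ binLoop .inl .mul ⨟ .assign 20 (.var 10)) ⨟
    .query (.inr ()) 9 (.var 21) (.lit 0) ⨟ .push 0 (.var 9)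

/-- Compute the coordinates of the element encrypted by scalar `2`. -/
def decode : Program (FieldOp ⊕ Unit) :=
  loadKey ⨟ .assign 10 (.var 5) ⨟
    forUp 15 3 (.query (.inl .mul) 10 (.var 10) (.var 19) ⨟
      .query (.inl .add) 10 (.var 10)
        (.get 1 (.add (.sub (.sub (.var 3) (.lit 1)) (.var 15)) (.lit 3)))) ⨟
    .query (.inl .inv) 8 (.var 10) (.lit 0) ⨟ .query (.inl .mul) 7 (.var 2) (.var 8) ⨟
    .clear 0 ⨟ forUp 15 3 decodeDigit

/-- The coefficient list in array `0` includes the leading coefficient, hence `n` is its length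
minus one. -/
theorem loadKey_ensures (hR : Serves K j O B n) {g : F[X]} {α : F} {E : F[X]}
    (h0 : (s.arr 0).length = n + 1) (hk : IsKey K n g (s.arr 1) α E) :
    (loadKey : Program ι).Ensures O B s fun s' => s'.num 3 = n ∧ IsEnc K (s'.num 5) 0 ∧
      IsEnc K (s'.num 6) 1 ∧ IsEnc K (s'.num 19) α := by
  have hnB := hR.dim_le
  have e0 : IsEnc K _ 0 := hk.enc.2 0 (by omega)
  have e1 : IsEnc K _ 1 := hk.enc.2 1 (by omega)
  have e2 : IsEnc K _ α := hk.enc.2 2 (by omega)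
  refine Ensures.andThen (Ensures.assign (lt_two_pow_of_le ?_) ?_)
  · simp only [Expr.eval]; omega
  refine Ensures.andThen (Ensures.assign (by simpa [Expr.eval] using hR.enc_lt e0) ?_)
  refine Ensures.andThen (Ensures.assign (by simpa [Expr.eval] using hR.enc_lt e1) ?_)
  refine Ensures.assign (by simpa [Expr.eval] using hR.enc_lt e2) ⟨?_, ?_, ?_, ?_⟩
  · simp [Expr.eval, h0]
  · simpa [Expr.eval] using e0
  · simpa [Expr.eval] using e1
  · simpa [Expr.eval] using e2

/-- Horner's scheme at the encrypted root; an integer coordinate is added as a multiple of the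
encrypted `1` by repeated doubling. -/
theorem encode_ensures (hR : Serves K id K.ops B n) {g : F[X]} {α : F} {E : F[X]}
    (h0 : (s.arr 0).length = n + 1) (hk : IsKey K n g (s.arr 1) α E) :
    encode.Ensures K.ops B s fun s' => IsEnc K (s'.num 0)
      (∑ i ∈ Finset.range n, ((s.arr 2).getD i 0 : F) * α ^ i) := by
  have hnB := hR.dim_le
  refine (loadKey_ensures hR h0 hk).seq ?_
  rintro s₁ hf₁ ⟨h3, h5, h6, h19⟩
  refine Ensures.andThen (Ensures.assign (by simpa [Expr.eval] using hR.enc_lt h5) ?_)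
  have h2 : s₁.arr 2 = s.arr 2 := hf₁.2 2 rfl
  refine Ensures.seq (R := fun s' => IsEnc K (s'.num 20)
      (horner (fun i => ((s.arr 2).getD i 0 : F)) n α n)) ?_ fun s' _ h =>
      Ensures.assign (by simpa [Expr.eval] using hR.enc_lt h) ?_
  swap
  · rw [horner_eq_sum] at h
    simpa [Expr.eval] using h
  refine Ensures.forUp (n := n) (I := fun i s' => IsEnc K (s'.num 20)
      (horner (fun i => ((s.arr 2).getD i 0 : F)) n α i)) (by simpa using h3) (by decide)
      (by omega) rfl rfl (by simpa [Expr.eval, horner] using h5) ?_ fun _ _ _ h => h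
  intro i s' hi hf hi' h
  have h3' : s'.num 3 = n := by rw [hf.1 3 rfl]; simpa using h3
  have h6' : IsEnc K (s'.num 6) 1 := by rw [hf.1 6 rfl]; simpa using h6
  have h19' : IsEnc K (s'.num 19) α := by rw [hf.1 19 rfl]; simpa using h19
  have h2' : s'.arr 2 = s.arr 2 := by rw [hf.2 2 rfl]; simpa using h2
  refine Ensures.of_bounded fun hs' => ?_
  refine Ensures.andThen (hR.query_mul (a := horner _ n α i) (b := α)
    (by simpa [Expr.eval] using h) (by simpa [Expr.eval] using h19') fun k hk => ?_)
  refine Ensures.andThen (Ensures.assign (by simpa [Expr.eval] using hR.enc_lt h6') ?_)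
  refine Ensures.andThen (Ensures.assign ?_ ?_)
  · simp only [Expr.eval, Store.setNum_arr]
    exact hs'.getD_lt 2 _
  refine Ensures.seq (binLoop_add hR
    (a := horner (fun i => ((s.arr 2).getD i 0 : F)) n α i * α) (b := 1) ?_ ?_) fun s₂ _ h₂ =>
    Ensures.assign (by simpa [Expr.eval] using hR.enc_lt h₂) ?_
  · simpa [Expr.eval] using hk
  · simpa [Expr.eval] using h6'
  · simpa [Expr.eval, h3', hi', h2', horner] using h₂

/-- The trace is accumulated as the sum of the first `n` Frobenius powers. Which encryption of it
arises is not determined, so `hd` asks for the same answer `d` on all of them. -/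
theorem decodeDigit_ensures {δ : BitVec l → ℕ}
    (hR : Serves K Sum.inl (Sum.elim K.ops (mapOracle δ)) B n) {g : F[X]} {α : F} {E : F[X]}
    {p i : ℕ} {z : F} (hi : i < n) (hk : IsKey K n g (s.arr 1) α E) (hp : s.num 0 = p)
    (h3 : s.num 3 = n) (h5 : IsEnc K (s.num 5) 0) (h6 : IsEnc K (s.num 6) 1)
    (h7 : IsEnc K (s.num 7) z) (h15 : s.num 15 = i) (hl : (s.arr 0).length < B) {d : ℕ}
    (hd : ∀ v, IsEnc K v (∑ k ∈ Finset.range n, (z * E.coeff i) ^ p ^ k) →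
      δ (BitVec.ofNat l v) = d) (hdB : d < 2 ^ B) :
    decodeDigit.Ensures (Sum.elim K.ops (mapOracle δ)) B s fun s' =>
      s'.arr 0 = s.arr 0 ++ [d] := by
  have hnB := hR.dim_le
  have e := hk.enc.2 (i + 3) (by omega)
  refine Ensures.andThen (hR.query_mul (by simpa [Expr.eval] using h7)
    (by simpa [Expr.eval, h15] using e) fun k hk => ?_)
  refine Ensures.andThen (Ensures.assign (by simpa [Expr.eval] using hR.enc_lt h5) ?_)
  refine Ensures.seq (R := fun s' => IsEnc K (s'.num 21)
    (∑ k ∈ Finset.range n, (z * E.coeff i) ^ p ^ k)) ?_ fun s' hf h => ?_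
  · refine Ensures.forUp (n := n) (I := fun m s' => IsEnc K (s'.num 20) ((z * E.coeff i) ^ p ^ m) ∧
      IsEnc K (s'.num 21) (∑ k ∈ Finset.range m, (z * E.coeff i) ^ p ^ k)) (by simpa using h3)
      (by decide) (by omega) rfl rfl ?_ ?_ fun _ _ _ h => h.2
    · exact ⟨by simpa [keyEntry] using hk, by simpa [Expr.eval] using h5⟩
    · rintro m s' hm hf - ⟨h20, h21⟩
      have h0' : s'.num 0 = p := by rw [hf.1 0 rfl]; simpa using hp
      have h6' : IsEnc K (s'.num 6) 1 := by rw [hf.1 6 rfl]; simpa using h6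
      refine Ensures.of_bounded fun hs' => ?_
      refine Ensures.andThen (hR.query_add (by simpa [Expr.eval] using h21)
        (by simpa [Expr.eval] using h20) fun k' hk' => ?_)
      refine Ensures.andThen (Ensures.assign (by simpa [Expr.eval] using hR.enc_lt h6') ?_)
      refine Ensures.andThen (Ensures.assign (by simpa [Expr.eval] using hR.enc_lt h20) ?_)
      refine Ensures.andThen (Ensures.assign (by simpa [Expr.eval] using hs'.1 0) ?_)
      refine Ensures.seq (binLoop_mul hR (a := 1) (b := (z * E.coeff i) ^ p ^ m) ?_ ?_)
        fun s₂ hf₂ h₂ => Ensures.assign (by simpa [Expr.eval] using hR.enc_lt h₂) ⟨?_, ?_⟩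
      · simpa [Expr.eval] using h6'
      · simpa [Expr.eval] using h20
      · simpa [Expr.eval, h0', ← pow_mul, ← pow_succ] using h₂
      · have : s₂.num 21 = k' := by rw [hf₂.1 21 rfl]; simp
        simpa [this, Finset.sum_range_succ] using hk'
  · have h0 : s'.arr 0 = s.arr 0 := by rw [hf.2 0 rfl]; simp
    refine Ensures.andThen (Ensures.query fun k hk => ?_)
    have hk' : k = d := by
      have : k = δ (BitVec.ofNat l (s'.num 21)) := by simpa [mapOracle, Expr.eval] using hk
      rw [this, hd _ h]
    subst hk'
    refine ⟨hdB, Ensures.push (by simpa [Expr.eval] using hdB) (by simpa [h0] using hl) ?_⟩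
    simp [Expr.eval, h0]

theorem decode_ensures {δ : BitVec l → ℕ}
    (hR : Serves K Sum.inl (Sum.elim K.ops (mapOracle δ)) B n) {g : F[X]} {α : F} {E : F[X]}
    {p : ℕ} {y : F} (h0 : (s.arr 0).length = n + 1) (hk : IsKey K n g (s.arr 1) α E)
    (hp : s.num 0 = p) (hy : IsEnc K (s.num 2) y) {w : List ℕ} (hw : w.length = n)
    (hd : ∀ i (h : i < w.length) v, IsEnc K v (∑ k ∈ Finset.range n,
      (y * (E.eval α)⁻¹ * E.coeff i) ^ p ^ k) → δ (BitVec.ofNat l v) = w[i])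
    (hwB : ∀ d ∈ w, d < 2 ^ B) :
    decode.Ensures (Sum.elim K.ops (mapOracle δ)) B s fun s' => s'.arr 0 = w := by
  have hnB := hR.dim_le
  refine (loadKey_ensures hR h0 hk).seq ?_
  rintro s₁ hf₁ ⟨h3, h5, h6, h19⟩
  have a1 : s₁.arr 1 = s.arr 1 := hf₁.2 1 rfl
  rw [← a1] at hk
  rw [← hf₁.1 0 rfl] at hp
  rw [← hf₁.1 2 rfl] at hy
  refine Ensures.andThen (Ensures.assign (by simpa [Expr.eval] using hR.enc_lt h5) ?_)
  refine Ensures.seq (R := fun s' => IsEnc K (s'.num 10) (E.eval α)) ?_ fun s₂ hf₂ h₂ => ?_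
  · refine Ensures.forUp (n := n) (I := fun i s' => IsEnc K (s'.num 10)
      (horner E.coeff n α i)) (by simpa using h3) (by decide)
      (by omega) rfl rfl (by simpa [Expr.eval, horner] using h5) ?_ fun _ _ _ h =>
      horner_coeff hk.degree_lt α ▸ h
    intro i s' hi hf hi' h
    have h3' : s'.num 3 = n := by rw [hf.1 3 rfl]; simpa using h3
    have h19' : IsEnc K (s'.num 19) α := by rw [hf.1 19 rfl]; simpa using h19
    have a1' : s'.arr 1 = s₁.arr 1 := by rw [hf.2 1 rfl]; simp
    have e := hk.enc.2 (n - 1 - i + 3) (by omega)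
    refine Ensures.andThen (hR.query_mul (a := horner _ n α i) (b := α)
      (by simpa [Expr.eval] using h) (by simpa [Expr.eval] using h19') fun k hk => ?_)
    refine hR.query_add (a := horner _ n α i * α) (b := E.coeff (n - 1 - i))
      (by simpa [Expr.eval] using hk)
      (by simpa [Expr.eval, h3', hi', a1', keyEntry] using e) fun k' hk' => ?_
    simpa [horner] using hk'
  · have n0 : s₂.num 0 = p := by rw [hf₂.1 0 rfl]; simpa using hp
    have n2 : IsEnc K (s₂.num 2) y := by rw [hf₂.1 2 rfl]; simpa using hy
    have n3 : s₂.num 3 = n := by rw [hf₂.1 3 rfl]; simpa using h3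
    have n5 : IsEnc K (s₂.num 5) 0 := by rw [hf₂.1 5 rfl]; simpa using h5
    have n6 : IsEnc K (s₂.num 6) 1 := by rw [hf₂.1 6 rfl]; simpa using h6
    have a1' : s₂.arr 1 = s₁.arr 1 := by rw [hf₂.2 1 rfl]; simp
    rw [← a1'] at hk
    refine Ensures.andThen (hR.query_inv fun k _ hk' => ?_)
    have hk'' := hk' (E.eval α) (by simpa [Expr.eval] using h₂) hk.eval_ne
    refine Ensures.andThen (hR.query_mul (a := y) (b := (E.eval α)⁻¹)
      (by simpa [Expr.eval] using n2) (by simpa [Expr.eval] using hk'') fun k₂ hk₂ => ?_)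
    refine Ensures.andThen (Ensures.clear ?_)
    refine Ensures.forUp (n := n) (I := fun i s' => s'.arr 0 = w.take i) (by simpa using n3)
      (by decide) (by omega) rfl rfl (by simp) ?_ fun _ _ _ h => by
        rw [h, ← hw, List.take_length]
    intro i s' hi hf hi' h
    refine (decodeDigit_ensures hR (i := i) (z := y * (E.eval α)⁻¹) (d := w[i]) (p := p) hi
      (g := g) (α := α) (E := E)
      ?_ ?_ ?_ ?_ ?_ ?_ hi' ?_ (hd i (by omega)) (hwB _ (List.getElem_mem _))).mono
        fun s'' hf'' h'' => ?_
    · rw [hf.2 1 rfl]; simpa using hk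
    · rw [hf.1 0 rfl]; simpa using n0
    · rw [hf.1 3 rfl]; simpa using n3
    · rw [hf.1 5 rfl]; simpa using n5
    · rw [hf.1 6 rfl]; simpa using n6
    · rw [hf.1 7 rfl]; simpa using hk₂
    · rw [h, List.length_take]; omega
    · rw [Store.setNum_arr, h'', h]
      simp

end BBField

namespace BBField
open Program

variable {F : Type*} [Field F] [Fintype F] {l : ℕ}
variable {K : BlackBoxField F l} {ι : Type} {j : FieldOp → ι} {O : Oracles ι} {B n : ℕ} {s : Store}

/-- Averaging over the sample: the continuation may be bounded separately for each sampled string.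
-/
theorem Program.Expects.sample_seq {O' : Oracles FieldOp} {X : Store → ℝ≥0∞} {ε : ℝ≥0∞} {x : ℕ}
    {e₁ e₂ : Expr} {c : Program (FieldOp ⊕ RandomOp)} (hl : l ≤ B) (Z : BitVec l → ℝ≥0∞)
    (hc : ∀ z ∈ K.sample.support, c.Expects (Sum.elim O' K.random) B (s.setNum x z.toNat) X (Z z))
    (hZ : expect K.sample Z ≤ ε) :
    (.query (.inr .sample) x e₁ e₂ ⨟ c).Expects (Sum.elim O' K.random) B s X ε := by
  classical
  -- The intermediate value depends on the memory alone, so the sampled string is recovered from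
  -- scalar `x`.
  refine Expects.seq (Y := fun s' => if s' = s.setNum x (s'.num x) ∧ s'.num x < 2 ^ l ∧
    BitVec.ofNat l (s'.num x) ∈ K.sample.support then Z (BitVec.ofNat l (s'.num x)) else ⊤)
    (expects_query ?_ ?_) fun s' _ => ?_
  · intro k hk
    obtain ⟨z, -, rfl⟩ := (PMF.mem_support_map_iff _ _ _).1 hk
    exact z.isLt.trans_le (Nat.pow_le_pow_right (by norm_num) hl)
  · refine le_trans ?_ hZ
    change expect (K.sample.map BitVec.toNat) _ ≤ _
    rw [expect_map]
    refine expect_mono _ fun z hz => ?_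
    rw [if_pos]
    · simp
    · refine ⟨by simp, by simpa using z.isLt, by simpa using hz⟩
  · split_ifs with h
    · have := hc _ h.2.2
      rwa [BitVec.toNat_ofNat, Nat.mod_eq_of_lt h.2.1, ← h.1] at this
    · exact Expects.top _

/-! ## Finding encryptions of `0` and `1` -/

/-- From a cryptoelement in scalar `7`, encrypt `0` in scalar `5`, and, if it does not encrypt
`0`, encrypt `1` in scalar `6` and set the flag `4`. -/
def unitStep (j : FieldOp → ι) : Program ι :=
  .assign 10 (.var 7) ⨟ .assign 11 (.var 7) ⨟ .assign 12 (.sub (.var 0) (.lit 1)) ⨟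
    binLoop j .add ⨟ .assign 5 (.var 10) ⨟ .query (j .eq) 8 (.var 7) (.var 5) ⨟
    .ite (.var 8) .skip (.query (j .inv) 9 (.var 7) (.lit 0) ⨟
      .query (j .mul) 6 (.var 7) (.var 9) ⨟ .assign 4 (.lit 1))

/-- Encryptions of `0` and `1` have been found. -/
def HasUnits (K : BlackBoxField F l) (s : Store) : Prop :=
  s.num 4 ≠ 0 ∧ IsEnc K (s.num 5) 0 ∧ IsEnc K (s.num 6) 1

/-- Zero is computed as `a + (p - 1) * a`, which needs no prior encryption of `0`. Comparison with
it shows whether `a` may be inverted to give `1`. A sample of `0` does not spoil units found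
earlier. -/
theorem unitStep_ensures (hR : Serves K j O B n) {p : ℕ} [CharP F p] (hp0 : 0 < p) {a : F}
    (hp : s.num 0 = p) (h7 : IsEnc K (s.num 7) a) (h4 : s.num 4 = 0 ∨ HasUnits K s) :
    (unitStep j).Ensures O B s fun s' => (s'.num 4 = 0 ∨ HasUnits K s') ∧
      (a ≠ 0 ∨ HasUnits K s → HasUnits K s') := by
  classical
  refine Ensures.of_bounded fun hs => ?_
  refine Ensures.andThen (Ensures.assign (by simpa [Expr.eval] using hR.enc_lt h7) ?_)
  refine Ensures.andThen (Ensures.assign (by simpa [Expr.eval] using hR.enc_lt h7) ?_)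
  refine Ensures.andThen (Ensures.assign ?_ ?_)
  · have := hs.1 0
    simp [Expr.eval]
    omega
  refine Ensures.seq (binLoop_add hR (a := a) (b := a) (by simpa [Expr.eval] using h7)
    (by simpa [Expr.eval] using h7)) fun s₁ hf₁ h₁ => ?_
  have h1 : IsEnc K (s₁.num 10) 0 := by
    refine h₁.congr rfl ?_
    simp only [Expr.eval, Store.setNum_num, if_true, hp, if_neg (show (0 : ℕ) ≠ 11 by decide),
      if_neg (show (0 : ℕ) ≠ 10 by decide)]
    rw [Nat.cast_sub hp0]
    simp
  have m7 : IsEnc K (s₁.num 7) a := by rw [hf₁.1 7 rfl]; simpa using h7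
  have m4 : s₁.num 4 = s.num 4 := by rw [hf₁.1 4 rfl]; simp
  have m6 : s₁.num 6 = s.num 6 := by rw [hf₁.1 6 rfl]; simp
  refine Ensures.andThen (Ensures.assign (by simpa [Expr.eval] using hR.enc_lt h1) ?_)
  refine Ensures.andThen (hR.query_eq (a := a) (b := 0) (by simpa [Expr.eval] using m7)
    (by simpa [Expr.eval] using h1) ?_)
  refine Ensures.ite (fun h => Ensures.skip ?_) (fun h => ?_)
  · have ha : a = 0 := by
      by_contra ha
      simp [Expr.eval, ha] at h
    have hu : HasUnits K s → HasUnits K (((s₁.setNum 5 (Expr.eval s₁ (.var 10))).setNum 8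
        (if a = 0 then 1 else 0))) := fun hu => by
      refine ⟨?_, ?_, ?_⟩
      · simpa [m4] using hu.1
      · simpa [Expr.eval] using h1
      · simpa [m6] using hu.2.2
    refine ⟨h4.imp (fun h4 => by simpa [m4] using h4) hu, fun h' => hu ?_⟩
    exact h'.resolve_left (by simp [ha])
  · have ha : a ≠ 0 := by
      rintro rfl
      simp [Expr.eval] at h
    refine Ensures.andThen (hR.query_inv fun k _ hk => ?_)
    have hk' := hk a (by simpa [Expr.eval] using m7) ha
    refine Ensures.andThen (hR.query_mul (a := a) (b := a⁻¹) (by simpa [Expr.eval] using m7)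
      (by simpa [Expr.eval] using hk') fun k₂ hk₂ => ?_)
    rw [mul_inv_cancel₀ ha] at hk₂
    refine Ensures.assign (by simpa [Expr.eval] using hR.one_lt) ?_
    have hu : HasUnits K ((((((s₁.setNum 5 (Expr.eval s₁ (.var 10))).setNum 8
        (if a = 0 then 1 else 0)).setNum 9 k).setNum 6 k₂).setNum 4
          (Expr.eval ((((s₁.setNum 5 (Expr.eval s₁ (.var 10))).setNum 8
        (if a = 0 then 1 else 0)).setNum 9 k).setNum 6 k₂) (.lit 1)))) :=
      ⟨by simp [Expr.eval], by simpa [Expr.eval] using h1, by simpa using hk₂⟩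
    exact ⟨Or.inr hu, fun _ => hu⟩

-- `ε` stands for the failure bound of the later stage, which is carried along; each round fails to
-- produce units with probability at most 3/4.
open Classical in
theorem unitLoop_expects {O' : Oracles FieldOp}
    (hR : Serves K (Sum.inl : FieldOp → FieldOp ⊕ RandomOp) (Sum.elim O' K.random) B n)
    {p : ℕ} [CharP F p] (hp0 : 0 < p) {M : ℕ} (hM : M ≤ B)
    (hp : s.num 0 = p) (h16 : s.num 16 = M) (h4 : s.num 4 = 0) (ε : ℝ≥0∞) :
    (forUp 15 16 (.query (.inr .sample) 7 (.lit 0) (.lit 0) ⨟ unitStep .inl)).Expects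
      (Sum.elim O' K.random) B s
      (fun s' => if HasUnits K s' then ε else if s'.num 4 = 0 then 1 + ε else ⊤)
      ((3 / 4) ^ M + ε) := by
  -- The flag in scalar `4` tells the program whether units are available; a set flag without units
  -- never occurs and gets the value `∞`.
  refine Expects.forUp (n := M) (J := fun i s' => if HasUnits K s' then ε else
      if s'.num 4 = 0 then (3 / 4) ^ (M - i) + ε else ⊤) h16 (by decide) hM rfl rfl ?_ ?_ ?_
  · simp [HasUnits, h4]
  · intro i s' hi hf _
    by_cases h : s'.num 4 = 0 ∨ HasUnits K s'
    swap
    · push Not at h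
      simp only [if_neg h.2, if_neg h.1]
      exact Expects.top _
    have hp' : s'.num 0 = p := by rw [hf.1 0 rfl, hp]
    refine Expects.sample_seq hR.length_le (fun z => if HasUnits K s' then ε else
      (3 / 4) ^ (M - (i + 1)) * (if K.decrypt z = 0 then 1 else 0) + ε) (fun z hz => ?_) ?_
    · have hz' : IsEnc K z.toNat (K.decrypt z) := ⟨z, rfl, K.proj_of_mem_support hz⟩
      have hU : HasUnits K (s'.setNum 7 z.toNat) ↔ HasUnits K s' := by simp [HasUnits]
      refine (unitStep_ensures hR (p := p) hp0 (a := K.decrypt z) (by simpa using hp')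
        (by simpa using hz') (by simpa [hU] using h)).expects fun s₂ _ h₂ => ?_
      have hU₂ : HasUnits K (s₂.setNum 15 (i + 1)) ↔ HasUnits K s₂ := by simp [HasUnits]
      simp only [hU₂]
      rw [hU] at h₂
      by_cases hu : HasUnits K s'
      · rw [if_pos hu, if_pos (h₂.2 (Or.inr hu))]
      · rw [if_neg hu]
        by_cases ha : K.decrypt z = 0
        · simp only [ha, if_true, mul_one]
          split_ifs with h5 h6
          · exact le_add_self
          · exact le_rfl
          · exact absurd h₂.1 (by simpa [h5] using h6)
        · rw [if_pos (h₂.2 (Or.inl ha))]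
          exact le_add_self
    · split_ifs with hu h4'
      · exact (expect_const _ _).le
      · rw [expect_add, expect_const, expect_const_mul]
        gcongr
        rw [show M - i = M - (i + 1) + 1 by omega, pow_succ]
        gcongr
        exact expect_sample_zero K
      · exact le_top
  · intro s' _ _
    simp

/-! ## Splitting off a root -/

/-- The state between two rounds: array `15` encrypts a polynomial that does not vanish exactly
at the roots in `S`. -/
structure HasFactor (K : BlackBoxField F l) (p n : ℕ) (g : F[X]) (S : Finset F) (s : Store) :
    Prop where
  modulus : HasModulus K n g s
  char : s.num 0 = p
  exponent : s.num 18 = p ^ n / 2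
  unit : IsEncPoly K n g (s.arr 11) 1
  nonempty : S.Nonempty
  isRoot : ∀ α ∈ S, g.IsRoot α
  factor : ∃ u : F → F, IsEncPoly K n g (s.arr 15) u ∧ ∀ α, g.IsRoot α → (u α ≠ 0 ↔ α ∈ S)

/-- One step in computing `splitter` of the polynomial in array `12`, accumulated in `13`. -/
def powerStep (j : FieldOp → ι) : Program ι :=
  .ite (.sub (.var 0) (.lit 2))
      (.ite (.mod (.var 17) (.lit 2)) (mulInto j 14 13 12 ⨟ copyInto j 13 14) .skip)
      (addInto j 13 12) ⨟
    mulInto j 14 12 12 ⨟ copyInto j 12 14 ⨟ .assign 17 (.div (.var 17) (.lit 2))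

/-- Compute in array `13` the function `splitter` of `1 + r X`, for `r` in scalar `7`. -/
def splitterProgram (j : FieldOp → ι) : Program ι :=
  zeros 12 ⨟ .assign 25 (.var 7) ⨟ shiftAdd j 12 11 ⨟ .assign 25 (.var 6) ⨟ shiftAdd j 12 11 ⨟
    copyInto j 13 11 ⨟ .assign 17 (.var 18) ⨟ .whileDo (.var 17) (powerStep j)

/-- Set scalar `26` to a nonzero number if the polynomial in array `14` is nonzero. -/
def testZero (j : FieldOp → ι) : Program ι :=
  .assign 26 (.lit 0) ⨟ forUp 13 3 (.query (j .eq) 8 (.get 14 (.var 13)) (.var 5) ⨟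
    .assign 26 (.add (.var 26) (.sub (.lit 1) (.var 8))))

/-- A round of the splitting algorithm. -/
def splitRound (j : FieldOp → ι) : Program ι :=
  splitterProgram j ⨟ mulInto j 14 15 13 ⨟ addInto j 14 15 ⨟ testZero j ⨟
    .ite (.var 26) (copyInto j 15 14) .skip

theorem powerStep_ensures (hR : Serves K j O B n) {g : F[X]} (hg : g.Monic)
    (hgn : g.natDegree = n) {p m : ℕ} (hp2 : 2 ≤ p) (hm : HasModulus K n g s) (hp : s.num 0 = p)
    (h17 : s.num 17 = m) {u v : F → F} (h13 : IsEncPoly K n g (s.arr 13) u)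
    (h12 : IsEncPoly K n g (s.arr 12) v) :
    (powerStep j).Ensures O B s fun s' => s'.num 17 = m / 2 ∧
      IsEncPoly K n g (s'.arr 12) (v * v) ∧
      IsEncPoly K n g (s'.arr 13) (if p = 2 then u + v else if m % 2 = 0 then u else u * v) := by
  refine Ensures.of_bounded fun hs => ?_
  refine Ensures.seq (R := fun s' => IsEncPoly K n g (s'.arr 13)
    (if p = 2 then u + v else if m % 2 = 0 then u else u * v)) ?_ fun s₁ hf₁ h₁ => ?_
  · refine Ensures.ite (fun h => ?_) fun h => ?_
    · rw [if_neg (show p ≠ 2 by simp [Expr.eval] at h; omega)]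
      refine Ensures.ite (fun h' => ?_) fun h' => ?_
      · rw [if_neg (by simpa [Expr.eval, h17] using h')]
        refine (mulInto_poly hR (by decide) (by decide) (by decide) hg hgn hm h13 h12).seq
          fun s₁ hf₁ h₁ => copyInto_poly hR (by decide) ?_ ?_ h₁
        · rw [hf₁.1 3 rfl]; exact hm.dim
        · rw [hf₁.1 5 rfl]; exact hm.zero
      · rw [if_pos (by simpa [Expr.eval, h17] using h')]
        exact Ensures.skip h13
    · rw [if_pos (show p = 2 by simp [Expr.eval] at h; omega)]
      exact addInto_poly hR (by decide) hm.dim h13 h12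
  · have hm₁ := hm.frame hf₁ rfl rfl rfl rfl
    rw [← hf₁.2 12 rfl] at h12
    refine (mulInto_poly hR (by decide) (by decide) (by decide) hg hgn hm₁ h12 h12).seq
      fun s₂ hf₂ h₂ => ?_
    have hm₂ := hm₁.frame hf₂ rfl rfl rfl rfl
    refine (copyInto_poly hR (by decide) hm₂.dim hm₂.zero h₂).seq fun s₃ hf₃ h₃ => ?_
    have e17 : s₃.num 17 = m := by rw [hf₃.1 17 rfl, hf₂.1 17 rfl, hf₁.1 17 rfl, h17]
    refine Ensures.assign ?_ ⟨?_, by simpa using h₃, ?_⟩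
    · simp only [Expr.eval, e17]
      have := hs.1 17
      omega
    · simp [Expr.eval, e17]
    · rw [Store.setNum_arr, hf₃.2 13 rfl, hf₂.2 13 rfl]
      exact h₁

/-- One loop serves both characteristics. Halving `p ^ n / 2` down to zero drives binary powering
for odd `p`; for `p = 2` it takes exactly `n` rounds, one for each term of the trace. The
accumulator starts at `1`, the summand in `splitter` for `p = 2`. -/
theorem splitterProgram_ensures (hR : Serves K j O B n) {g : F[X]} (hg : g.Monic)
    (hgn : g.natDegree = n) {p : ℕ} (hp2 : 2 ≤ p) {S : Finset F} (hS : HasFactor K p n g S s)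
    {r : F} (h7 : IsEnc K (s.num 7) r) :
    (splitterProgram j).Ensures O B s fun s' =>
      IsEncPoly K n g (s'.arr 13) fun α => splitter p n (1 + r * α) := by
  have hn := hR.dim_pos
  obtain ⟨hm, hp, h18, hunit, -, -, -⟩ := hS
  refine (zeros_poly hR (g := g) hm.dim hm.zero).seq fun s₁ hf₁ h₁ => ?_
  have hm₁ := hm.frame hf₁ rfl rfl rfl rfl
  have e7 : IsEnc K (s₁.num 7) r := by rw [hf₁.1 7 rfl]; exact h7
  refine Ensures.andThen (Ensures.assign (by simpa [Expr.eval] using hR.enc_lt e7) ?_)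
  refine Ensures.seq (shiftAdd_poly hR (d := 12) (b := 11) (by decide) (by decide) hg hgn
    (u := 0) (v := 1) (c := r) (hm₁.setNum (by decide)) (by simpa using h₁)
    (by rw [Store.setNum_arr, hf₁.2 11 rfl]; exact hunit) (by simpa [Expr.eval] using e7))
    fun s₂ hf₂ h₂ => ?_
  have hm₂ : HasModulus K n g s₂ :=
    (hm₁.setNum (by decide)).frame hf₂ rfl rfl rfl rfl
  refine Ensures.andThen (Ensures.assign (by simpa [Expr.eval] using hR.enc_lt hm₂.one) ?_)
  refine Ensures.seq (shiftAdd_poly hR (d := 12) (b := 11) (by decide) (by decide) hg hgn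
    (v := 1) (c := 1) (hm₂.setNum (by decide)) h₂
    (by rw [Store.setNum_arr, hf₂.2 11 rfl, Store.setNum_arr, hf₁.2 11 rfl]; exact hunit)
    (by simpa [Expr.eval] using hm₂.one)) fun s₃ hf₃ h₃ => ?_
  have hm₃ : HasModulus K n g s₃ :=
    (hm₂.setNum (by decide)).frame hf₃ rfl rfl rfl rfl
  refine (copyInto_poly hR (d := 13) (a := 11) (u := 1) (by decide) hm₃.dim hm₃.zero (by
    rw [hf₃.2 11 rfl, Store.setNum_arr, hf₂.2 11 rfl, Store.setNum_arr, hf₁.2 11 rfl]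
    exact hunit)).seq fun s₄ hf₄ h₄ => ?_
  have hm₄ := hm₃.frame hf₄ rfl rfl rfl rfl
  have h12 : IsEncPoly K n g (s₄.arr 12) fun α => 1 + r * α := by
    rw [hf₄.2 12 rfl]
    exact h₃.congr fun α _ => by simp [add_comm]
  have e18 : s₄.num 18 = p ^ n / 2 := by
    rw [hf₄.1 18 rfl, hf₃.1 18 rfl, Store.setNum_num, if_neg (by decide), hf₂.1 18 rfl,
      Store.setNum_num, if_neg (by decide), hf₁.1 18 rfl, h18]
  have e0 : s₄.num 0 = p := by
    rw [hf₄.1 0 rfl, hf₃.1 0 rfl, Store.setNum_num, if_neg (by decide), hf₂.1 0 rfl,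
      Store.setNum_num, if_neg (by decide), hf₁.1 0 rfl, hp]
  refine Ensures.of_bounded fun hs => ?_
  refine Ensures.andThen (Ensures.assign (by simpa [Expr.eval] using hs.1 18) ?_)
  -- For `p = 2`, `i` counts the trace terms still to be added; the counter is `2 ^ i / 2`, which
  -- vanishes only for `i = 0`.
  refine Ensures.whileDo (r := B) (J := fun k s' => s'.num 17 < 2 ^ k ∧ ∃ u v : F → F,
    IsEncPoly K n g (s'.arr 13) u ∧ IsEncPoly K n g (s'.arr 12) v ∧
    (p ≠ 2 → ∀ α, u α * v α ^ s'.num 17 = splitter p n (1 + r * α)) ∧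
    (p = 2 → ∃ i, s'.num 17 = 2 ^ i / 2 ∧
      ∀ α, u α + ∑ k ∈ Finset.range i, v α ^ 2 ^ k = splitter p n (1 + r * α))) ?_ le_rfl ?_
  · rintro k s' hf ⟨hk, u, v, h13, h12, hodd, htwo⟩
    simp only [Expr.eval]
    refine ⟨fun h => h13.congr fun α _ => ?_, fun h => ?_⟩
    · by_cases hp' : p = 2
      · obtain ⟨i, hi, hsum⟩ := htwo hp'
        have : i = 0 := by
          rcases i with _ | i
          · rfl
          · rw [h, pow_succ, Nat.mul_div_cancel _ (by norm_num)] at hi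
            exact absurd hi (by positivity)
        subst this
        simpa using hsum α
      · simpa [h] using hodd hp' α
    · have hk0 : k ≠ 0 := by
        rintro rfl
        simp at hk; omega
      obtain ⟨k, rfl⟩ := Nat.exists_eq_succ_of_ne_zero hk0
      refine ⟨k, rfl, ?_⟩
      have hm' : HasModulus K n g s' :=
        (hm₄.setNum (by decide)).frame hf rfl rfl rfl rfl
      have e0' : s'.num 0 = p := by rw [hf.1 0 rfl]; simpa using e0
      refine (powerStep_ensures hR hg hgn hp2 hm' e0' rfl h13 h12).mono ?_
      rintro s'' - ⟨h17, h12', h13'⟩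
      refine ⟨?_, _, _, h13', h12', fun hp' α => ?_, fun hp' => ?_⟩
      · rw [h17]
        rw [Nat.succ_eq_add_one, pow_succ] at hk
        omega
      · rw [if_neg hp', ← hodd hp' α, h17]
        have hdiv := Nat.mod_add_div (s'.num 17) 2
        conv_rhs => rw [← hdiv, pow_add, pow_mul, sq]
        rcases Nat.mod_two_eq_zero_or_one (s'.num 17) with h2 | h2 <;> simp [h2, mul_assoc]
      · obtain ⟨i, hi, hsum⟩ := htwo hp'
        rcases i with _ | i
        · simp at hi; omega
        · refine ⟨i, ?_, fun α => ?_⟩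
          · rw [h17, hi, pow_succ, Nat.mul_div_cancel _ (by norm_num)]
          · rw [if_pos hp', ← hsum α, Finset.sum_range_succ']
            simp only [Pi.add_apply, Pi.mul_apply, pow_zero, pow_one]
            rw [add_assoc, add_comm (v α)]
            congr 2
            refine Finset.sum_congr rfl fun k _ => ?_
            rw [← sq, ← pow_mul, ← pow_succ']
  · refine ⟨by simpa [Expr.eval] using hs.1 18, 1, _, by simpa using h₄, by simpa using h12,
      fun hp' α => ?_, fun hp' => ⟨n, ?_, fun α => ?_⟩⟩
    · simp [Expr.eval, e18, splitter, hp']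
    · simp [Expr.eval, e18, hp']
    · simp [splitter, hp']

theorem testZero_ensures (hR : Serves K j O B n) {P : F[X]} (hP : P.degree < n)
    (h3 : s.num 3 = n) (h5 : IsEnc K (s.num 5) 0) (h14 : IsEncVec K n (s.arr 14) P.coeff) :
    (testZero j).Ensures O B s fun s' => s'.num 26 ≠ 0 ↔ P ≠ 0 := by
  classical
  have hnB := hR.dim_le
  refine Ensures.andThen (Ensures.assign (by simp [Expr.eval]) ?_)
  refine Ensures.forUp (n := n) (I := fun i s' => s'.num 26 ≤ i ∧
    (s'.num 26 = 0 ↔ ∀ k < i, P.coeff k = 0)) (by simpa using h3) (by decide) (by omega) rfl rfl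
    (by simp [Expr.eval]) ?_ ?_
  · rintro i s' hi hf hi' ⟨hle, hiff⟩
    have h5' : IsEnc K (s'.num 5) 0 := by rw [hf.1 5 rfl]; simpa using h5
    have h14' : IsEncVec K n (s'.arr 14) P.coeff := by rw [hf.2 14 rfl]; simpa using h14
    refine Ensures.andThen (hR.query_eq (a := P.coeff i) (b := 0)
      (by simpa [Expr.eval, hi'] using h14'.2 i hi) (by simpa [Expr.eval] using h5') ?_)
    have hsucc : (∀ k < i + 1, P.coeff k = 0) ↔ (∀ k < i, P.coeff k = 0) ∧ P.coeff i = 0 :=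
      ⟨fun h => ⟨fun k hk => h k (by omega), h i (by omega)⟩, fun h k hk =>
        (Nat.lt_succ_iff_lt_or_eq.1 hk).elim (h.1 k) fun e => e ▸ h.2⟩
    by_cases h0 : P.coeff i = 0
    · refine Ensures.assign (lt_two_pow_of_le ?_) ⟨?_, ?_⟩
      · simp [Expr.eval, h0]; omega
      · simp [Expr.eval, h0]; omega
      · rw [hsucc, ← hiff]
        simp [Expr.eval, h0]
    · refine Ensures.assign (lt_two_pow_of_le ?_) ⟨?_, ?_⟩
      · simp [Expr.eval, h0]; omega
      · simp [Expr.eval, h0]; omega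
      · rw [hsucc]
        simp [Expr.eval, h0]
  · rintro s' - - ⟨-, hiff⟩
    rw [not_iff_not, hiff]
    refine ⟨fun h => ext fun k => ?_, fun h => by simp [h]⟩
    by_cases hk : k < n
    · exact h k hk
    · exact (degree_lt_iff_coeff_zero _ _).1 hP k (by omega)

-- This makes the coefficientwise zero test decide whether a function on the roots vanishes
-- identically.
omit [Fintype F] in
theorem eq_zero_of_forall_isRoot {g : F[X]} [DecidableEq F] (hg0 : g ≠ 0)
    (hroots : g.roots.toFinset.card = n) {P : F[X]} (hP : P.degree < n)
    (h : ∀ α, g.IsRoot α → P.eval α = 0) : P = 0 := by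
  refine eq_zero_of_degree_lt_of_eval_finset_eq_zero g.roots.toFinset (by rwa [hroots]) ?_
  intro α hα
  exact h α ((mem_roots hg0).1 (Multiset.mem_toFinset.1 hα))

/-- The new polynomial has the values `u * (splitter + 1)`, so its nonvanishing set is the filtered
`S`. It is accepted exactly when it is nonzero, that is, when the filtered set is nonempty, in
agreement with `refineRoots`. -/
theorem splitRound_ensures (hR : Serves K j O B n) {g : F[X]} [DecidableEq F] (hg : g.Monic)
    (hgn : g.natDegree = n) (hroots : g.roots.toFinset.card = n) {p : ℕ} (hp2 : 2 ≤ p)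
    {S : Finset F} (hS : HasFactor K p n g S s) {r : F} (h7 : IsEnc K (s.num 7) r) :
    (splitRound j).Ensures O B s (HasFactor K p n g (refineRoots p n S r)) := by
  classical
  refine (splitterProgram_ensures hR hg hgn hp2 hS h7).seq fun s₁ hf₁ h₁ => ?_
  obtain ⟨hm, hp, h18, hunit, hne, hSr, u, hu, huS⟩ := hS
  have hm₁ := hm.frame hf₁ rfl rfl rfl rfl
  rw [← hf₁.1 0 rfl] at hp
  rw [← hf₁.1 18 rfl] at h18
  rw [← hf₁.2 11 rfl] at hunit
  rw [← hf₁.2 15 rfl] at hu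
  refine (mulInto_poly hR (by decide) (by decide) (by decide) hg hgn hm₁ hu h₁).seq
    fun s₂ hf₂ h₂ => ?_
  have hm₂ := hm₁.frame hf₂ rfl rfl rfl rfl
  rw [← hf₂.1 0 rfl] at hp
  rw [← hf₂.1 18 rfl] at h18
  rw [← hf₂.2 11 rfl] at hunit
  rw [← hf₂.2 15 rfl] at hu
  refine (addInto_poly hR (by decide) hm₂.dim h₂ hu).seq fun s₃ hf₃ h₃ => ?_
  have hm₃ := hm₂.frame hf₃ rfl rfl rfl rfl
  rw [← hf₃.1 0 rfl] at hp
  rw [← hf₃.1 18 rfl] at h18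
  rw [← hf₃.2 11 rfl] at hunit
  rw [← hf₃.2 15 rfl] at hu
  obtain ⟨P, hP, h14, hPu⟩ := h₃
  refine (testZero_ensures hR hP hm₃.dim hm₃.zero h14).seq fun s₄ hf₄ h₄ => ?_
  have hm₄ := hm₃.frame hf₄ rfl rfl rfl rfl
  rw [← hf₄.1 0 rfl] at hp
  rw [← hf₄.1 18 rfl] at h18
  rw [← hf₄.2 11 rfl] at hunit
  rw [← hf₄.2 15 rfl] at hu
  rw [← hf₄.2 14 rfl] at h14
  have hPS : ∀ α, g.IsRoot α → (P.eval α ≠ 0 ↔ α ∈ S ∧ splitter p n (1 + r * α) + 1 ≠ 0) := by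
    intro α hα
    rw [hPu α hα, ← huS α hα, ← mul_ne_zero_iff]
    simp [mul_add]
  have hex : P ≠ 0 ↔ ∃ α ∈ S, splitter p n (1 + r * α) + 1 ≠ 0 := by
    constructor
    · intro h0
      by_contra hno
      push Not at hno
      refine h0 (eq_zero_of_forall_isRoot hg.ne_zero hroots hP fun α hα => ?_)
      by_contra h
      obtain ⟨h5, h6⟩ := (hPS α hα).1 h
      exact h6 (hno α h5)
    · rintro ⟨α, hα, h⟩ rfl
      exact absurd eval_zero ((hPS α (hSr α hα)).2 ⟨hα, h⟩)
  have hne' := refineRoots_nonempty p n hne r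
  have hSr' : ∀ α ∈ refineRoots p n S r, g.IsRoot α := fun α hα =>
    hSr α (refineRoots_subset p n S r hα)
  refine Ensures.ite (fun h => ?_) fun h => ?_
  · have hP0 := h₄.1 (by simpa [Expr.eval] using h)
    refine (copyInto_poly hR (g := g) (by decide) hm₄.dim hm₄.zero ⟨P, hP, h14, fun _ _ => rfl⟩).mono
      fun s₅ hf₅ h₅ => ?_
    refine ⟨hm₄.frame hf₅ rfl rfl rfl rfl, by rw [hf₅.1 0 rfl, hp], by rw [hf₅.1 18 rfl, h18],
      by rw [hf₅.2 11 rfl]; exact hunit, hne', hSr', _, h₅, fun α hα => ?_⟩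
    rw [mem_refineRoots (hex.1 hP0)]
    exact hPS α hα
  · have hP0 : ¬ P ≠ 0 := fun h0 => h₄.2 h0 (by simpa [Expr.eval] using h)
    refine Ensures.skip ⟨hm₄, hp, h18, hunit, hne', hSr', u, hu, ?_⟩
    rw [refineRoots, if_neg fun h => hP0 (hex.2 h)]
    exact huS

-- The potential is the number of ordered pairs in `S`, initially at most `n * n`. A nonempty set
-- with more than one element has at least one pair, so the expected number of pairs bounds the
-- failure probability.
open Classical in
theorem splitLoop_expects {O' : Oracles FieldOp}
    (hR : Serves K (Sum.inl : FieldOp → FieldOp ⊕ RandomOp) (Sum.elim O' K.random) B n)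
    {g : F[X]} (hg : g.Monic) (hgn : g.natDegree = n) (hroots : g.roots.toFinset.card = n)
    (h0 : 2 ≤ n → ¬ g.IsRoot 0) {p : ℕ} [Fact p.Prime] (hcard : Fintype.card F = p ^ n)
    {M : ℕ} (hM : M ≤ B) (h16 : s.num 16 = M) {S : Finset F} (hS : HasFactor K p n g S s)
    {X : Store → ℝ≥0∞}
    (hX : ∀ s' S', HasFactor K p n g S' s' → X s' ≤ if S'.card = 1 then 0 else 1) :
    (forUp 15 16 (.query (.inr .sample) 7 (.lit 0) (.lit 0) ⨟ splitRound .inl)).Expects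
      (Sum.elim O' K.random) B s X ((11 / 12) ^ M * (n * n : ℕ)) := by
  have hp2 := (Fact.out : p.Prime).two_le
  have hsub : ∀ {S' : Finset F} {s'}, HasFactor K p n g S' s' → S'.card ≤ n := by
    intro S' s' h
    rw [← hroots]
    exact Finset.card_le_card fun α hα =>
      Multiset.mem_toFinset.2 ((mem_roots hg.ne_zero).2 (h.isRoot α hα))
  -- The set `S` is not stored in memory. The infimum over all admissible sets takes its place, and
  -- it is `∞` when there is none.
  refine Expects.forUp (n := M) (J := fun i s' => ⨅ S', ⨅ _ : HasFactor K p n g S' s',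
    (11 / 12) ^ (M - i) * (S'.offDiag.card : ℝ≥0∞)) h16 (by decide) hM rfl rfl ?_ ?_ ?_
  · have hS' : HasFactor K p n g S (s.setNum 15 0) := by
      obtain ⟨⟨a, b, c, d⟩, e, f, g, h, i, k⟩ := hS
      exact ⟨⟨a, b, c, d⟩, e, f, g, h, i, k⟩
    refine (iInf₂_le S hS').trans ?_
    rw [Nat.sub_zero, Finset.offDiag_card]
    gcongr
    exact (Nat.sub_le _ _).trans (Nat.mul_le_mul (hsub hS) (hsub hS))
  · intro i s' hi hf _ hs t ht
    refine le_iInf₂ fun S' hS' => ?_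
    have key : (.query (.inr .sample) 7 (.lit 0) (.lit 0) ⨟ splitRound .inl :
        Program (FieldOp ⊕ RandomOp)).Expects (Sum.elim O' K.random) B s'
        (fun s'' => ⨅ S', ⨅ _ : HasFactor K p n g S' (s''.setNum 15 (i + 1)),
          (11 / 12) ^ (M - (i + 1)) * (S'.offDiag.card : ℝ≥0∞))
        ((11 / 12) ^ (M - i) * (S'.offDiag.card : ℝ≥0∞)) := by
      refine Expects.sample_seq hR.length_le (fun z => (11 / 12) ^ (M - (i + 1)) *
        ((refineRoots p n S' (K.decrypt z)).offDiag.card : ℝ≥0∞)) (fun z hz => ?_) ?_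
      · have hz' : IsEnc K z.toNat (K.decrypt z) := ⟨z, rfl, K.proj_of_mem_support hz⟩
        have hS'' : HasFactor K p n g S' (s'.setNum 7 z.toNat) := by
          obtain ⟨⟨a, b, c, d⟩, e, f, g, h, i, k⟩ := hS'
          exact ⟨⟨a, b, c, d⟩, e, f, g, h, i, k⟩
        refine (splitRound_ensures hR hg hgn hroots hp2 hS'' (r := K.decrypt z)
          (by simpa using hz')).expects fun s₂ _ h₂ => ?_
        have h₂' : HasFactor K p n g (refineRoots p n S' (K.decrypt z)) (s₂.setNum 15 (i + 1)) := by
          obtain ⟨⟨a, b, c, d⟩, e, f, g, h, i, k⟩ := h₂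
          exact ⟨⟨a, b, c, d⟩, e, f, g, h, i, k⟩
        exact iInf₂_le (refineRoots p n S' (K.decrypt z)) h₂'
      · rw [expect_const_mul, show M - i = M - (i + 1) + 1 by omega, pow_succ, mul_assoc]
        gcongr
        exact expect_card_offDiag_le K hcard (hsub hS') fun hn h => h0 hn (hS'.isRoot 0 h)
    exact key hs t ht
  · intro s' _ _
    refine le_iInf₂ fun S' hS' => (hX s' S' hS').trans ?_
    rw [Nat.sub_self, pow_zero, one_mul, Finset.offDiag_card]
    split_ifs with h1
    · exact zero_le
    · have h2 : 2 ≤ S'.card := by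
        have := hS'.nonempty.card_pos
        omega
      have h3 : 2 * S'.card ≤ S'.card * S'.card := Nat.mul_le_mul_right _ h2
      norm_cast
      omega

end BBField

namespace BBField
open Program

variable {F : Type*} [Field F] [Fintype F] {l : ℕ}
variable {K : BlackBoxField F l} {ι : Type} {j : FieldOp → ι} {O : Oracles ι} {B n : ℕ} {s : Store}

/-! ## The complete algorithm -/

/-- Half of the order of the field, in scalar `18`. -/
def halfOrder : Program ι :=
  .assign 18 (.lit 1) ⨟ forUp 15 3 (.assign 18 (.mul (.var 18) (.var 0))) ⨟
    .assign 18 (.div (.var 18) (.lit 2))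

/-- Encrypt the negatives of the coefficients in array `0`. -/
def negCoeffs (j : FieldOp → ι) : Program ι :=
  .clear 10 ⨟ forUp 15 3 (.assign 10 (.var 5) ⨟ .assign 11 (.var 6) ⨟
    .assign 12 (.sub (.var 0) (.get 0 (.var 15))) ⨟ binLoop j .add ⨟ .push 10 (.var 10))

/-- Put the constant polynomial `1` into the arrays `11` and `15`. -/
def unitPolys (j : FieldOp → ι) : Program ι :=
  zeros 11 ⨟ .put 11 (.lit 0) (.var 6) ⨟ copyInto j 15 11

/-- Store the key in array `0`. -/
def writeKey (j : FieldOp → ι) : Program ι :=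
  copyInto j 14 15 ⨟ .assign 25 (.var 5) ⨟ shiftAdd j 14 11 ⨟
    .query (j .inv) 8 (.get 15 (.sub (.var 3) (.lit 1))) (.lit 0) ⨟
    .query (j .mul) 19 (.get 14 (.sub (.var 3) (.lit 1))) (.var 8) ⨟
    .clear 0 ⨟ .push 0 (.var 5) ⨟ .push 0 (.var 6) ⨟ .push 0 (.var 19) ⨟
    forUp 13 3 (.push 0 (.get 15 (.var 13)))

/-- Find a key. -/
def findKey : Program (FieldOp ⊕ RandomOp) :=
  .assign 3 (.sub (.len 0) (.lit 1)) ⨟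
  .assign 16 (.mul (.lit 12) (.add (.add (.var 2) (.mul (.lit 2) (.var 3))) (.lit 1))) ⨟
  forUp 15 16 (.query (.inr .sample) 7 (.lit 0) (.lit 0) ⨟ unitStep .inl) ⨟
  .ite (.var 4) (halfOrder ⨟ negCoeffs .inl ⨟ unitPolys .inl ⨟
    forUp 15 16 (.query (.inr .sample) 7 (.lit 0) (.lit 0) ⨟ splitRound .inl) ⨟
    writeKey .inl) .skip

theorem halfOrder_ensures {p : ℕ} (hp2 : 2 ≤ p) (hp : s.num 0 = p) (h3 : s.num 3 = n)
    (hnB : n ≤ B) (hpn : p ^ n < 2 ^ B) :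
    (halfOrder : Program ι).Ensures O B s fun s' => s'.num 18 = p ^ n / 2 := by
  refine Ensures.andThen (Ensures.assign ?_ ?_)
  · exact (Nat.one_le_pow n p (by omega)).trans_lt hpn
  refine Ensures.seq (R := fun s' => s'.num 18 = p ^ n) ?_ fun s' _ h => Ensures.assign ?_ ?_
  · refine Ensures.forUp (n := n) (I := fun i s' => s'.num 18 = p ^ i) (by simpa using h3)
      (by decide) hnB rfl rfl (by simp [Expr.eval]) ?_ fun _ _ _ h => h
    intro i s' hi hf _ h
    have e0 : s'.num 0 = p := by rw [hf.1 0 rfl]; simpa using hp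
    have hle : p ^ (i + 1) ≤ p ^ n := Nat.pow_le_pow_right (by omega) hi
    rw [pow_succ] at hle
    refine Ensures.assign ?_ ?_
    · simp only [Expr.eval, h, e0]; omega
    · simp [Expr.eval, h, e0, pow_succ]
  · simp only [Expr.eval, h]; omega
  · simp [Expr.eval, h]

/-- The box has no subtraction; the negative of a residue `a` is the integer multiple `p - a` of
`1`. -/
theorem negCoeffs_ensures (hR : Serves K j O B n) {p : ℕ} [CharP F p] {g : F[X]}
    (hp : s.num 0 = p) (h3 : s.num 3 = n) (h5 : IsEnc K (s.num 5) 0) (h6 : IsEnc K (s.num 6) 1)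
    (h0 : ∀ i < n, (s.arr 0).getD i 0 ≤ p ∧ (((s.arr 0).getD i 0 : ℕ) : F) = g.coeff i) :
    (negCoeffs j).Ensures O B s (HasModulus K n g) := by
  have hnB := hR.dim_le
  refine Ensures.andThen (Ensures.clear ?_)
  refine Ensures.forUp (n := n) (I := fun i s' => IsEncVec K i (s'.arr 10) fun i => - g.coeff i)
    (by simpa using h3) (by decide) (by omega) rfl rfl (by simp [IsEncVec]) ?_ ?_
  · intro i s' hi hf hi' h
    have e0 : s'.num 0 = p := by rw [hf.1 0 rfl]; simpa using hp
    have e5 : IsEnc K (s'.num 5) 0 := by rw [hf.1 5 rfl]; simpa using h5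
    have e6 : IsEnc K (s'.num 6) 1 := by rw [hf.1 6 rfl]; simpa using h6
    have a0 : s'.arr 0 = s.arr 0 := by rw [hf.2 0 rfl]; simp
    refine Ensures.of_bounded fun hs' => ?_
    refine Ensures.andThen (Ensures.assign (by simpa [Expr.eval] using hR.enc_lt e5) ?_)
    refine Ensures.andThen (Ensures.assign (by simpa [Expr.eval] using hR.enc_lt e6) ?_)
    refine Ensures.andThen (Ensures.assign ?_ ?_)
    · have := hs'.1 0
      simp [Expr.eval]; omega
    refine (binLoop_add hR (a := 0) (b := 1) (by simpa [Expr.eval] using e5)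
      (by simpa [Expr.eval] using e6)).seq fun s₁ hf₁ h₁ => ?_
    have h₁' : IsEnc K (s₁.num 10) (- g.coeff i) := by
      refine h₁.congr rfl ?_
      simp only [Expr.eval, Store.setNum_num, Store.setNum_arr, if_true, a0,
        if_neg (show (0 : ℕ) ≠ 11 by decide), if_neg (show (0 : ℕ) ≠ 10 by decide),
        if_neg (show (15 : ℕ) ≠ 11 by decide), if_neg (show (15 : ℕ) ≠ 10 by decide), e0, hi']
      rw [Nat.cast_sub (h0 i hi).1, (h0 i hi).2]
      simp
    have a10 : s₁.arr 10 = s'.arr 10 := by rw [hf₁.2 10 rfl]; simp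
    refine Ensures.push (by simpa [Expr.eval] using hR.enc_lt h₁') (by rw [a10, h.1]; omega) ?_
    simpa [Expr.eval, a10] using h.push h₁'
  · intro s' hf _ h
    refine ⟨?_, ?_, ?_, h⟩
    · rw [hf.1 3 rfl]; simpa using h3
    · rw [hf.1 5 rfl]; simpa using h5
    · rw [hf.1 6 rfl]; simpa using h6

theorem unitPolys_ensures (hR : Serves K j O B n) {g : F[X]} (hm : HasModulus K n g s) :
    (unitPolys j).Ensures O B s fun s' => IsEncPoly K n g (s'.arr 11) 1 ∧
      IsEncPoly K n g (s'.arr 15) 1 := by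
  have hn := hR.dim_pos
  refine (zeros_ensures hR hm.dim hm.zero).seq fun s₁ hf₁ h₁ => ?_
  have hm₁ := hm.frame hf₁ rfl rfl rfl rfl
  refine Ensures.andThen (Ensures.put (by simpa [Expr.eval] using hR.enc_lt hm₁.one) ?_)
  have h11 : IsEncPoly K n g ((s₁.arr 11).set 0 (s₁.num 6)) 1 :=
    ⟨1, by rw [degree_one]; exact_mod_cast hn, (h₁.set hm₁.one).congr fun i _ => by
      simp [coeff_one], by simp⟩
  refine (copyInto_poly hR (s := s₁.setArr 11 ((s₁.arr 11).set 0 (s₁.num 6))) (d := 15) (a := 11)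
    (g := g) (u := 1) (by decide) hm₁.dim hm₁.zero (by simpa using h11)).mono fun s₂ hf₂ h₂ => ⟨?_, h₂⟩
  rw [hf₂.2 11 rfl]
  simpa [Expr.eval] using h11

/-- If only `α` is left, `X * P` and `α * P` agree at all roots, so the reduced product is `Q = C α
* P`, and `α` is the quotient of the coefficients at `n - 1`. For other `S` the bounds still have to
hold, so the cardinality is a premise of the postcondition only. -/
theorem writeKey_ensures (hR : Serves K j O B n) {g : F[X]} [DecidableEq F] (hg : g.Monic)
    (hgn : g.natDegree = n) (hroots : g.roots.toFinset.card = n) {p : ℕ}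
    {S : Finset F} (hS : HasFactor K p n g S s) :
    (writeKey j).Ensures O B s fun s' => S.card = 1 → ∃ α E, IsKey K n g (s'.arr 0) α E := by
  have hnB := hR.dim_le
  have hn := hR.dim_pos
  obtain ⟨hm, -, -, hunit, -, hSr, u, ⟨P, hP, h15, hPu⟩, huS⟩ := hS
  refine (copyInto_poly hR (g := g) (by decide) hm.dim hm.zero ⟨P, hP, h15, hPu⟩).seq
    fun s₁ hf₁ h₁ => ?_
  have hm₁ := hm.frame hf₁ rfl rfl rfl rfl
  rw [← hf₁.2 15 rfl] at h15
  rw [← hf₁.2 11 rfl] at hunit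
  refine Ensures.andThen (Ensures.assign (by simpa [Expr.eval] using hR.enc_lt hm₁.zero) ?_)
  refine Ensures.seq (shiftAdd_poly hR (d := 14) (b := 11) (by decide) (by decide) hg hgn (v := 1)
    (c := 0) (hm₁.setNum (by decide)) h₁ hunit (by simpa [Expr.eval] using hm₁.zero))
    fun s₂ hf₂ h₂ => ?_
  have hm₂ : HasModulus K n g s₂ := (hm₁.setNum (by decide)).frame hf₂ rfl rfl rfl rfl
  obtain ⟨Q, hQ, h14, hQu⟩ := h₂
  have h15' : IsEncVec K n (s₂.arr 15) P.coeff := by rw [hf₂.2 15 rfl]; exact h15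
  have hQP : ∀ α, S = {α} → P.eval α ≠ 0 ∧ (∀ β, g.IsRoot β → β ≠ α → P.eval β = 0) ∧
      Q = C α * P := by
    intro α hα
    have hr : g.IsRoot α := hSr α (by simp [hα])
    have h3 : ∀ β, g.IsRoot β → β ≠ α → P.eval β = 0 := fun β hβ hne => by
      rw [hPu β hβ]
      by_contra h
      have := (huS β hβ).1 h
      rw [hα, Finset.mem_singleton] at this
      exact hne this
    refine ⟨?_, h3, ?_⟩
    · rw [hPu α hr, huS α hr, hα]; simp
    · rw [← sub_eq_zero]
      refine eq_zero_of_forall_isRoot hg.ne_zero hroots ?_ fun β hβ => ?_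
      · refine (degree_sub_le _ _).trans_lt (max_lt hQ ?_)
        rw [degree_lt_iff_coeff_zero]
        intro m hm
        rw [coeff_C_mul, (degree_lt_iff_coeff_zero _ _).1 hP m hm, mul_zero]
      · simp only [eval_sub, hQu β hβ, eval_mul, eval_C, ← hPu β hβ]
        by_cases hne : β = α
        · rw [hne]; ring
        · rw [h3 β hβ hne]; ring
  -- Were the top coefficient zero, `(X - α) * P` would have degree below `n` and vanish at all `n`
  -- roots, forcing `P = 0`.
  have htop : ∀ α, S = {α} → P.coeff (n - 1) ≠ 0 := by
    intro α hα h
    obtain ⟨h1, h3, -⟩ := hQP α hα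
    have hP' := (degree_lt_iff_coeff_zero _ _).1 hP
    have : (X - C α) * P = 0 := by
      refine eq_zero_of_forall_isRoot hg.ne_zero hroots ?_ fun β hβ => ?_
      · rw [degree_lt_iff_coeff_zero]
        intro m hm
        obtain ⟨m, rfl⟩ : ∃ m', m = m' + 1 := ⟨m - 1, by omega⟩
        rw [sub_mul, coeff_sub, coeff_X_mul, coeff_C_mul, hP' _ hm]
        rcases hm.eq_or_lt with h' | h'
        · rw [show m = n - 1 by omega, h]; ring
        · rw [hP' m (by omega)]; ring
      · by_cases hne : β = α
        · simp [hne]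
        · simp [h3 β hβ hne]
    rcases mul_eq_zero.1 this with h' | h'
    · exact X_sub_C_ne_zero α h'
    · simp [h'] at h1
  have e15 := h15'.2 (n - 1) (by omega)
  have e14 := h14.2 (n - 1) (by omega)
  -- When `S` is not a singleton this may invert zero; then only the size of the answer is used.
  refine Ensures.andThen (hR.query_inv fun k hkl hk => ?_)
  refine Ensures.andThen (hR.query_mul' fun k₂ hkl₂ hk₂ => ?_)
  have hroot : ∀ α, S = {α} → IsEnc K k₂ α := by
    intro α hα
    have h0 := htop α hα
    have h1 := hk _ (by simpa [Expr.eval, hm₂.dim] using e15) h0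
    have h2 := hk₂ (Q.coeff (n - 1)) (P.coeff (n - 1))⁻¹
      (by simpa [Expr.eval, hm₂.dim] using e14) (by simpa [Expr.eval] using h1)
    refine h2.congr rfl ?_
    rw [(hQP α hα).2.2, coeff_C_mul, mul_assoc, mul_inv_cancel₀ h0, mul_one]
  refine Ensures.andThen (Ensures.clear ?_)
  refine Ensures.andThen (Ensures.push (by simpa [Expr.eval] using hR.enc_lt hm₂.zero)
    (by simp; omega) ?_)
  refine Ensures.andThen (Ensures.push (by simpa [Expr.eval] using hR.enc_lt hm₂.one)
    (by simp; omega) ?_)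
  refine Ensures.andThen (Ensures.push (by simpa [Expr.eval] using hR.lt hkl₂)
    (by simp; omega) ?_)
  refine Ensures.forUp (n := n) (I := fun i s' => (s'.arr 0).length = i + 3 ∧
    ∀ α, S = {α} → IsEncVec K (i + 3) (s'.arr 0) (keyEntry α P)) ?_ (by decide) (by omega) rfl rfl
    ?_ ?_ ?_
  · simpa using hm₂.dim
  · refine ⟨by simp, fun α hα => ?_⟩
    have v0 : IsEncVec K 0 [] (keyEntry α P) := by simp [IsEncVec]
    have v3 := ((v0.push (v := s₂.num 5) hm₂.zero).push (v := s₂.num 6) hm₂.one).push (hroot α hα)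
    simpa [Expr.eval] using v3
  · rintro i s' hi hf hi' ⟨hlen, hvec⟩
    have e := h15'.2 i hi
    rw [show s₂.arr 15 = s'.arr 15 by rw [hf.2 15 rfl]; simp] at e
    refine Ensures.push (by simpa [Expr.eval, hi'] using hR.enc_lt e) (by omega) ⟨?_, ?_⟩
    · simp [hlen]
    · intro α hα
      have := (hvec α hα).push (v := (s'.arr 15).getD i 0) e
      simpa [Expr.eval, hi', add_right_comm] using this
  · rintro s' hf - ⟨-, hvec⟩ hcard
    obtain ⟨α, hα⟩ := Finset.card_eq_one.1 hcard
    obtain ⟨h1, h3, -⟩ := hQP α hα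
    exact ⟨α, P, hSr α (by simp [hα]), hP, h1, h3, hvec α hα⟩

/-- Twelve rounds bring both 3/4 and 11/12 below 1/2. Of the resulting exponent `k + 2n + 1`, the
part `2n` pays for `n * n ≤ 2 ^ (2n)`, and the extra 1 pays for adding the two failure
probabilities. -/
theorem failure_bound (k n : ℕ) :
    (3 / 4 : ℝ≥0∞) ^ (12 * (k + 2 * n + 1)) + (11 / 12) ^ (12 * (k + 2 * n + 1)) * (n * n : ℕ) ≤
      (1 / 2) ^ k := by
  have h34 : (3 / 4 : ℝ≥0∞) ^ 12 ≤ 1 / 2 := by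
    rw [← ENNReal.toReal_le_toReal (by finiteness) (by finiteness)]
    norm_num
  have h11 : (11 / 12 : ℝ≥0∞) ^ 12 ≤ 1 / 2 := by
    rw [← ENNReal.toReal_le_toReal (by finiteness) (by finiteness)]
    norm_num
  have hhalf : (1 / 2 : ℝ≥0∞) ≤ 1 := by
    rw [← ENNReal.toReal_le_toReal (by finiteness) (by finiteness)]
    norm_num
  have hn : (1 / 2 : ℝ≥0∞) ^ (2 * n) * (n * n : ℕ) ≤ 1 := by
    have hle : n * n ≤ 2 ^ (2 * n) := by
      rw [two_mul, pow_add]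
      exact Nat.mul_le_mul Nat.lt_two_pow_self.le Nat.lt_two_pow_self.le
    calc (1 / 2 : ℝ≥0∞) ^ (2 * n) * (n * n : ℕ) ≤ (1 / 2) ^ (2 * n) * ((2 ^ (2 * n) : ℕ) : ℝ≥0∞) := by
          gcongr
      _ = 1 := by
          rw [Nat.cast_pow, ← mul_pow, Nat.cast_ofNat, ENNReal.div_mul_cancel (by simp) (by simp),
            one_pow]
  rw [pow_mul, pow_mul]
  calc _ ≤ (1 / 2 : ℝ≥0∞) ^ (k + 2 * n + 1) + (1 / 2) ^ (k + 2 * n + 1) * (n * n : ℕ) := by gcongr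
    _ = (1 / 2) ^ k * (1 / 2) * ((1 / 2) ^ (2 * n) + (1 / 2) ^ (2 * n) * (n * n : ℕ)) := by ring
    _ ≤ (1 / 2) ^ k * (1 / 2) * (1 + 1) := by
      gcongr
      exact pow_le_one₀ zero_le hhalf
    _ = (1 / 2) ^ k := by
      rw [mul_assoc, one_add_one_eq_two, ENNReal.div_mul_cancel (by simp) (by simp), mul_one]

open Classical in
theorem findKey_expects {O' : Oracles FieldOp}
    (hR : Serves K (Sum.inl : FieldOp → FieldOp ⊕ RandomOp) (Sum.elim O' K.random) B n)
    {g : F[X]} (hg : g.Monic) (hgn : g.natDegree = n) (hroots : g.roots.toFinset.card = n)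
    (hg0 : 2 ≤ n → ¬ g.IsRoot 0) {p k : ℕ} [Fact p.Prime] (hcard : Fintype.card F = p ^ n)
    (hpn : p ^ n < 2 ^ B) (hM : 12 * (k + 2 * n + 1) ≤ B)
    (hp : s.num 0 = p) (h2 : s.num 2 = k) (h4 : s.num 4 = 0) (hlen : (s.arr 0).length = n + 1)
    (h0 : ∀ i < n, (s.arr 0).getD i 0 ≤ p ∧ (((s.arr 0).getD i 0 : ℕ) : F) = g.coeff i) :
    findKey.Expects (Sum.elim O' K.random) B s
      (fun s' => if ∃ α E, IsKey K n g (s'.arr 0) α E then 0 else 1) ((1 / 2) ^ k) := by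
  have hnB := hR.dim_le
  have hn := hR.dim_pos
  have hp2 := (Fact.out : p.Prime).two_le
  have : CharP F p := charP_of_card hcard
  refine Expects.mono ?_ (fun _ _ => le_rfl) (failure_bound k n)
  refine Ensures.seq_expects (R := fun s' => s' = s.setNum 3 n) (Ensures.assign
    (lt_two_pow_of_le ?_) ?_) ?_
  · simp only [Expr.eval]; omega
  · simp [Expr.eval, hlen]
  rintro _ - rfl
  refine Ensures.seq_expects (R := fun s' => s' = (s.setNum 3 n).setNum 16
    (12 * (k + 2 * n + 1))) (Ensures.assign (lt_two_pow_of_le ?_) ?_) ?_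
  · simpa [Expr.eval, h2] using hM
  · simp [Expr.eval, h2]
  rintro _ - rfl
  refine (unitLoop_expects hR (p := p) (by omega) hM (by simpa using hp) (by simp)
    (by simpa using h4) ((11 / 12) ^ (12 * (k + 2 * n + 1)) * (n * n : ℕ))).seq fun s₁ hf₁ => ?_
  have e0 : s₁.num 0 = p := by rw [hf₁.1 0 rfl]; simpa using hp
  have e3 : s₁.num 3 = n := by rw [hf₁.1 3 rfl]; simp
  have e16 : s₁.num 16 = 12 * (k + 2 * n + 1) := by rw [hf₁.1 16 rfl]; simp
  have a0 : s₁.arr 0 = s.arr 0 := by rw [hf₁.2 0 rfl]; simp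
  by_cases hu : HasUnits K s₁
  · rw [if_pos hu]
    obtain ⟨hu4, h5, h6⟩ := hu
    refine Expects.ite (fun _ => ?_) fun h => absurd h hu4
    refine (halfOrder_ensures hp2 e0 e3 (by omega) hpn).seq_expects fun s₂ hf₂ h₂ => ?_
    rw [← hf₂.1 0 rfl] at e0
    rw [← hf₂.1 3 rfl] at e3
    rw [← hf₂.1 16 rfl] at e16
    rw [← hf₂.2 0 rfl] at a0
    rw [← hf₂.1 5 rfl] at h5
    rw [← hf₂.1 6 rfl] at h6
    refine (negCoeffs_ensures hR (g := g) e0 e3 h5 h6 (by rwa [a0])).seq_expects fun s₃ hf₃ h₃ => ?_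
    rw [← hf₃.1 0 rfl] at e0
    rw [← hf₃.1 16 rfl] at e16
    rw [← hf₃.1 18 rfl] at h₂
    refine (unitPolys_ensures hR h₃).seq_expects fun s₄ hf₄ h₄ => ?_
    rw [← hf₄.1 0 rfl] at e0
    rw [← hf₄.1 16 rfl] at e16
    rw [← hf₄.1 18 rfl] at h₂
    have hS : HasFactor K p n g g.roots.toFinset s₄ :=
      ⟨h₃.frame hf₄ rfl rfl rfl rfl, e0, h₂, h₄.1, Finset.card_pos.1 (by omega),
        fun α hα => (mem_roots hg.ne_zero).1 (Multiset.mem_toFinset.1 hα), 1, h₄.2, fun α hα => by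
          simp only [Pi.one_apply, ne_eq, one_ne_zero, not_false_eq_true, true_iff,
            Multiset.mem_toFinset]
          exact (mem_roots hg.ne_zero).2 hα⟩
    -- After the loop the value is 0 or 1, as the final set can or cannot be chosen a singleton, so
    -- the expectation bounds the probability that no key can be written.
    refine (splitLoop_expects hR hg hgn hroots hg0 hcard hM e16 hS
      (X := fun s' => ⨅ S', ⨅ _ : HasFactor K p n g S' s', if S'.card = 1 then 0 else 1)
      fun s' S' h => iInf₂_le S' h).seq fun s₅ _ => ?_
    intro hs t ht
    refine le_iInf₂ fun S' hS' => ?_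
    have key : (writeKey (Sum.inl : FieldOp → FieldOp ⊕ RandomOp)).Expects (Sum.elim O' K.random) B
        s₅ (fun s' => if ∃ α E, IsKey K n g (s'.arr 0) α E then 0 else 1)
        (if S'.card = 1 then 0 else 1) := by
      refine (writeKey_ensures hR hg hgn hroots hS').expects fun s₆ _ h₆ => ?_
      by_cases h1 : S'.card = 1
      · simp [h₆ h1]
      · rw [if_neg h1]
        split_ifs <;> simp
    exact key hs t ht
  · rw [if_neg hu]
    split_ifs with h40
    -- Without units the program stops and counts as failed, at a cost of at most 1, covered by the
    -- value `1 + ε` of the first loop.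
    · refine Expects.ite (fun h => absurd h40 h) fun _ => expects_skip ?_
      refine le_trans ?_ le_self_add
      split_ifs <;> simp
    · exact Expects.top _

end BBField

/-! ### Input sizes and the two isomorphisms obtained from a key -/

namespace BBField
open Program

variable {F : Type*} [Field F] [Fintype F] {l : ℕ} {K : BlackBoxField F l}

/-- Distinct elements have distinct encryptions. Hence `p`, and the degree, are bounded in terms of
`l`, so time polynomial in `l` is enough. -/
theorem BlackBoxField.card_le (K : BlackBoxField F l) : Fintype.card F ≤ 2 ^ l := by
  choose e he using K.proj_surj
  have hinj : Function.Injective e := fun a b h => by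
    have := he a
    rw [h, he b] at this
    exact (Option.some.inj this).symm
  have h2 : Function.Injective fun a => (⟨(e a).toNat, (e a).isLt⟩ : Fin (2 ^ l)) := fun a b h =>
    hinj (BitVec.eq_of_toNat_eq (Fin.mk.inj h))
  simpa using Fintype.card_le_of_injective _ h2

theorem input_bounded {B : ℕ} {nums : List ℕ} {arrs : List (List ℕ)}
    (hn : ∀ v ∈ nums, v < 2 ^ B) (ha : ∀ w ∈ arrs, w.length ≤ B ∧ ∀ v ∈ w, v < 2 ^ B) :
    (input nums arrs).Bounded B := by
  refine ⟨fun x => ?_, fun a => ?_⟩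
  · change nums.getD x 0 < _
    by_cases h : x < nums.length
    · rw [List.getD_eq_getElem _ _ h]
      exact hn _ (List.getElem_mem _)
    · rw [List.getD_eq_default _ _ (not_lt.1 h)]
      positivity
  · change (arrs.getD a []).length ≤ B ∧ ∀ v ∈ arrs.getD a [], v < 2 ^ B
    by_cases h : a < arrs.length
    · rw [List.getD_eq_getElem _ _ h]
      exact ha _ (List.getElem_mem _)
    · rw [List.getD_eq_default _ _ (not_lt.1 h)]
      simp

theorem IsEncVec.bounded {B n : ℕ} {w : List ℕ} {c : ℕ → F} (h : IsEncVec K n w c) (hl : l ≤ B)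
    (hn : n ≤ B) : w.length ≤ B ∧ ∀ v ∈ w, v < 2 ^ B := by
  refine ⟨h.1.trans_le hn, fun v hv => ?_⟩
  obtain ⟨i, hi, rfl⟩ := List.getElem_of_mem hv
  have := (h.2 i (h.1 ▸ hi)).lt
  rw [List.getD_eq_getElem _ _ hi] at this
  exact this.trans_le (Nat.pow_le_pow_right (by norm_num) hl)

section

variable {p : ℕ} [Fact p.Prime]

theorem mem_ofFn_val_lt {m : ℕ} {c : Fin m → ZMod p} {B v : ℕ} (hB : p ≤ 2 ^ B)
    (hv : v ∈ List.ofFn fun i => (c i).val) : v < 2 ^ B := by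
  obtain ⟨i, rfl⟩ := (List.mem_ofFn' _ _).1 hv
  exact (ZMod.val_lt _).trans_le hB

theorem length_coeffList (f : (ZMod p)[X]) : (coeffList f).length = f.natDegree + 1 :=
  List.length_ofFn

theorem coeffList_getD {f : (ZMod p)[X]} {i : ℕ} (hi : i < f.natDegree + 1) :
    (coeffList f).getD i 0 = (f.coeff i).val := by
  rw [List.getD_eq_getElem _ _ ((length_coeffList f).symm ▸ hi)]
  exact List.getElem_ofFn _

omit [Fact p.Prime] in
theorem coordList_getD {n : ℕ} (c : Fin n → ZMod p) (i : Fin n) :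
    (coordList c).getD i 0 = (c i).val := by
  rw [List.getD_eq_getElem _ _ (by simp [coordList])]
  simp [coordList]

omit [Fintype F] in
theorem natCast_val_eq_algebraMap [Algebra (ZMod p) F] (a : ZMod p) :
    ((a.val : ℕ) : F) = algebraMap (ZMod p) F a := by
  rw [← map_natCast (algebraMap (ZMod p) F), ZMod.natCast_zmod_val]

-- Ring homomorphisms out of `ZMod p` are unique, so every choice of `ψ` is inverse to the algebra
-- map.
omit [Fintype F] in
theorem algebraMap_eq_symm [Algebra (ZMod p) F] (ψ : (⊥ : Subfield F) ≃+* ZMod p) (a : ZMod p) :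
    algebraMap (ZMod p) F a = (ψ.symm a : F) := by
  have : algebraMap (ZMod p) F = (⊥ : Subfield F).subtype.comp (ψ.symm : ZMod p →+* _) :=
    Subsingleton.elim _ _
  exact congrArg (fun h : ZMod p →+* F => h a) this

/-- Size bound for memory, linear in the length of the input. -/
def memBound (m : ℕ) : ℕ := 24 * m + 20

/-- A common time bound for the three programs. -/
noncomputable def timeBound : ℕ[X] :=
  (findKey.time + encode.time + decode.time).comp (24 * X + 20)

theorem eval_timeBound (m : ℕ) : timeBound.eval m = findKey.time.eval (memBound m) +
    encode.time.eval (memBound m) + decode.time.eval (memBound m) := by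
  simp [timeBound, memBound]

variable {f : (ZMod p)[X]} [Algebra (ZMod p) F]

theorem computesTo_of_isKey (hl : f.natDegree ≤ l) (hpl : p ≤ 2 ^ l) (hn : 0 < f.natDegree)
    {w : List ℕ} {α : F} {E : F[X]}
    (hk : IsKey K f.natDegree (f.map (algebraMap (ZMod p) F)) w α E) {φ : AdjoinRoot f ≃+* F}
    (hφ : ∀ h : (ZMod p)[X], φ (AdjoinRoot.mk f h) = aeval α h) :
    ComputesTo f K encode (timeBound.eval l) w φ := by
  intro c
  have hpB : p ≤ 2 ^ memBound l := hpl.trans (Nat.pow_le_pow_right (by norm_num)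
    (by unfold memBound; omega))
  have hR : Serves K id K.ops (memBound l) f.natDegree :=
    ⟨fun _ => rfl, by unfold memBound; omega, by unfold memBound; omega, hn⟩
  refine (Ensures.mono (encode_ensures hR (s := input [p, l] [coeffList f, w, coordList c])
    (length_coeffList f) hk) fun s' _ h => ?_).achieves (input_bounded ?_ ?_) (B := memBound l) ?_
  · obtain ⟨y, hy, hy'⟩ := h
    refine ⟨y, hy, ?_⟩
    rw [hy', map_element hφ, Finset.sum_range]
    congr 1
    refine Finset.sum_congr rfl fun i _ => ?_
    change (((coordList c).getD i 0 : ℕ) : F) * _ = _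
    rw [coordList_getD, natCast_val_eq_algebraMap]
  · simp only [List.mem_cons, List.not_mem_nil, or_false, forall_eq_or_imp, forall_eq]
    refine ⟨?_, lt_two_pow_of_le (by unfold memBound; omega)⟩
    refine hpl.trans_lt (Nat.pow_lt_pow_right (by norm_num) (by unfold memBound; omega))
  · simp only [List.mem_cons, List.not_mem_nil, or_false, forall_eq_or_imp, forall_eq]
    refine ⟨⟨?_, fun v hv => mem_ofFn_val_lt hpB hv⟩, hk.enc.bounded hR.length_le hR.dim_le,
      ?_, fun v hv => mem_ofFn_val_lt hpB hv⟩
    · rw [length_coeffList, memBound]; omega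
    · simp [coordList, memBound]; omega
  · rw [eval_timeBound]; omega

/-- By `sum_pow_eq_coordinate` each trace handed to `δ` is the image of a coordinate in the prime
field, and `ψ` carries it back to that coordinate. -/
theorem computesFrom_of_isKey (hf : f.Monic) (hirr : Irreducible f)
    (hcard : Fintype.card F = p ^ f.natDegree) (hl : f.natDegree ≤ l) (hpl : p ≤ 2 ^ l)
    (hn : 0 < f.natDegree) {w : List ℕ} {α : F} {E : F[X]}
    (hk : IsKey K f.natDegree (f.map (algebraMap (ZMod p) F)) w α E) {φ : AdjoinRoot f ≃+* F}
    (hα : aeval α f = 0) (hφ : ∀ h : (ZMod p)[X], φ (AdjoinRoot.mk f h) = aeval α h)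
    {ψ : (⊥ : Subfield F) ≃+* ZMod p} {δ : BitVec l → ℕ} (hδ : K.PrimeIso ψ δ) :
    ComputesFrom f K decode δ (timeBound.eval l) w φ := by
  intro x c hx
  have hlB : l ≤ memBound l := by unfold memBound; omega
  have hpB : p ≤ 2 ^ memBound l := hpl.trans (Nat.pow_le_pow_right (by norm_num) hlB)
  have hR : Serves K Sum.inl (Sum.elim K.ops (mapOracle δ)) (memBound l) f.natDegree :=
    ⟨fun _ => rfl, hlB, by unfold memBound; omega, hn⟩
  refine (decode_ensures hR (s := input [p, l, x.toNat] [coeffList f, w])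
    (y := φ (element f c)) (p := p) (length_coeffList f) hk rfl ⟨x, rfl, hx⟩
    (w := coordList c) (by simp [coordList]) ?_ fun v hv => mem_ofFn_val_lt hpB hv).achieves
      (input_bounded ?_ ?_) ?_
  · intro i hi v hv
    have hi' : i < f.natDegree := by simpa [coordList] using hi
    rw [map_element hφ, sum_pow_eq_coordinate hf hirr hcard hα hk.degree_lt hk.eval_ne hk.eval_eq c
      ⟨i, hi'⟩, algebraMap_eq_symm ψ] at hv
    rw [hδ _ _ hv.ofNat, RingEquiv.apply_symm_apply]
    simp [coordList]
  · simp only [List.mem_cons, List.not_mem_nil, or_false, forall_eq_or_imp, forall_eq]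
    refine ⟨hpl.trans_lt (Nat.pow_lt_pow_right (by norm_num) (by unfold memBound; omega)),
      lt_two_pow_of_le (by unfold memBound; omega),
      x.isLt.trans_le (Nat.pow_le_pow_right (by norm_num) hlB)⟩
  · simp only [List.mem_cons, List.not_mem_nil, or_false, forall_eq_or_imp, forall_eq]
    refine ⟨⟨?_, fun v hv => mem_ofFn_val_lt hpB hv⟩, hk.enc.bounded hlB hR.dim_le⟩
    rw [length_coeffList, memBound]; omega
  · rw [eval_timeBound]; omega

omit [Fintype F] in
theorem symm_eq_of_primeIso {α : F} {φ : AdjoinRoot f ≃+* F}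
    (hφ : ∀ h : (ZMod p)[X], φ (AdjoinRoot.mk f h) = aeval α h)
    (ψ : (⊥ : Subfield F) ≃+* ZMod p) (u : (⊥ : Subfield F)) :
    φ.symm u = AdjoinRoot.of f (ψ u) := by
  rw [RingEquiv.symm_apply_eq, ← AdjoinRoot.mk_C, hφ, aeval_C, algebraMap_eq_symm ψ,
    RingEquiv.symm_apply_apply]

end

end BBField

/-! ### The main theorem -/

open BBField
theorem mainTheorem3 :
    ∃ (find : Program (FieldOp ⊕ RandomOp)) (enc : Program FieldOp)
      (dec : Program (FieldOp ⊕ Unit)) (P : ℕ[X]),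
      ∀ (p : ℕ) (_ : p.Prime) (f : (ZMod p)[X]) (_ : f.Monic) (_ : Irreducible f)
        (F : Type*) [Field F] [Fintype F] (_ : Fintype.card F = p ^ f.natDegree)
        (l : ℕ) (K : BlackBoxField F l) (k : ℕ),
        find.Achieves (Sum.elim K.ops K.random) (P.eval (l + k))
            (input [p, l, k] [coeffList f]) (fun _ => True) ∧
          find.failure (Sum.elim K.ops K.random) (P.eval (l + k))
            (input [p, l, k] [coeffList f])
            (fun s => ∃ φ : AdjoinRoot f ≃+* F,
              ComputesTo f K enc (P.eval l) (s.arr 0) φ ∧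
                ∀ (ψ : (⊥ : Subfield F) ≃+* ZMod p) (δ : BitVec l → ℕ), K.PrimeIso ψ δ →
                  ComputesFrom f K dec δ (P.eval l) (s.arr 0) φ ∧
                    ∀ u : (⊥ : Subfield F), φ.symm u = AdjoinRoot.of f (ψ u))
            ≤ (1 / 2) ^ k := by
  classical
  refine ⟨findKey, encode, decode, timeBound, ?_⟩
  intro p hp f hf hirr F _ _ hcard l K k
  have : Fact p.Prime := ⟨hp⟩
  have : CharP F p := charP_of_card hcard
  let _ : Algebra (ZMod p) F := ZMod.algebra F p
  have hn : 0 < f.natDegree := hirr.natDegree_pos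
  have hpow : p ^ f.natDegree ≤ 2 ^ l := hcard ▸ K.card_le
  have hpl : p ≤ 2 ^ l := (Nat.le_self_pow hn.ne' p).trans hpow
  -- From `2 ^ n ≤ p ^ n = |F| ≤ 2 ^ l`.
  have hl : f.natDegree ≤ l := (Nat.pow_le_pow_iff_right (by norm_num)).1
    ((Nat.pow_le_pow_left hp.two_le _).trans hpow)
  have hlB : l < memBound (l + k) := by unfold memBound; omega
  have hpB : p ≤ 2 ^ memBound (l + k) := hpl.trans (Nat.pow_le_pow_right (by norm_num) hlB.le)
  have hR : Serves K (Sum.inl : FieldOp → FieldOp ⊕ RandomOp) (Sum.elim K.ops K.random)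
      (memBound (l + k)) f.natDegree :=
    ⟨fun _ => rfl, hlB.le, by unfold memBound; omega, hn⟩
  have hb : (input [p, l, k] [coeffList f]).Bounded (memBound (l + k)) := by
    refine input_bounded ?_ ?_
    · simp only [List.mem_cons, List.not_mem_nil, or_false, forall_eq_or_imp, forall_eq]
      exact ⟨hpl.trans_lt (Nat.pow_lt_pow_right (by norm_num) hlB),
        Program.lt_two_pow_of_le hlB.le, Program.lt_two_pow_of_le (by unfold memBound; omega)⟩
    · simp only [List.mem_singleton, forall_eq]
      refine ⟨?_, fun v hv => mem_ofFn_val_lt hpB hv⟩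
      rw [length_coeffList, memBound]; omega
  have hT : findKey.time.eval (memBound (l + k)) ≤ timeBound.eval (l + k) := by
    rw [eval_timeBound]; omega
  -- The factor 24 in `memBound` comes from the number of rounds: `12 * (k + 2n + 1) ≤ 24 * (l + k)
  -- + 20` because `n ≤ l`.
  have hfind := findKey_expects hR (g := f.map (algebraMap (ZMod p) F)) (hf.map _)
    (hf.natDegree_map _) (card_roots_map hf hirr hcard) ?_ (p := p) (k := k) hcard
    (hpow.trans_lt (Nat.pow_lt_pow_right (by norm_num) hlB)) (by unfold memBound; omega)
    (s := input [p, l, k] [coeffList f]) rfl rfl rfl (length_coeffList f) ?_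
  · refine ⟨hfind.achieves (by finiteness) hb hT fun _ _ => trivial,
      hfind.failure_le hb hT fun s' hs' => ?_⟩
    rw [if_neg]
    rintro ⟨α, E, hk⟩
    have hα : aeval α f = 0 := by
      rw [aeval_def, ← eval_map]
      exact hk.root
    obtain ⟨φ, hφ⟩ := exists_ringEquiv hf hirr hcard hα
    exact hs' ⟨φ, computesTo_of_isKey hl hpl hn hk hφ, fun ψ δ hδ =>
      ⟨computesFrom_of_isKey hf hirr hcard hl hpl hn hk hα hφ hδ, symm_eq_of_primeIso hφ ψ⟩⟩
  -- An irreducible polynomial with the root `0` has degree one.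
  · intro hn2 h0
    have h0' : f.IsRoot 0 := by
      rw [← map_zero (algebraMap (ZMod p) F), IsRoot, eval_map_apply,
        map_eq_zero_iff _ (algebraMap (ZMod p) F).injective] at h0
      exact h0
    have h1 : f.natDegree = 1 :=
      natDegree_eq_of_degree_eq_some (degree_eq_one_of_irreducible_of_root hirr h0')
    omega
  · intro i hi
    change (BBField.coeffList f).getD i 0 ≤ p ∧ (((BBField.coeffList f).getD i 0 : ℕ) : F) = _
    rw [coeffList_getD (by omega), natCast_val_eq_algebraMap, coeff_map]
    exact ⟨(ZMod.val_lt _).le, rfl⟩
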